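/- Let $\mathbf k$ be a field, $R=\mathbf k[x_1,\dots,x_n]$, $\mathfrak m=(x_1,\dots,x_n)$, and let $I=(f_0,\dots,f_n)\subset R$ be a perfect ideal of codimension $2$ generated by homogeneous forms $f_0,\dots,f_n$ of the same degree $d$, with a homogeneous presentation $$\bigoplus_{j=1}^n R(-d-d_j)\xrightarrow{\ \varphi\ }R(-d)^{n+1}\xrightarrow{(f_0,\dots,f_n)}I\to 0,\qquad 1\le d_1\le\dots\le d_n .$$ Assume that $\mu(I_{\mathfrak p})\le\dim R_{\mathfrak p}$ for every prime $\mathfrak p\supseteq I$ with $\mathfrak p\ne\mathfrak m$, where $\mu$ denotes the minimal number of generators. Let $S=\mathbf k[T_0,\dots,T_n]$ and $B=R\otimes_{\mathbf k}S$, let $(l_1,\dots,l_n)=(T_0,\dots,T_n)\,\varphi$, and regard $\mathrm{Sym}_R(I)$ as a bigraded quotient of $B$ via $T_i\mapsto f_i\in \mathrm{Sym}^1_R(I)=I$, where $\deg x_i=(1,0)$ and $\deg T_i=(0,1)$. Put $\delta=d_1+\dots+d_n-n$ (which equals $d-n$), fix $0\le i\le\delta$, and let $M=\mathrm{Sym}(I)_{\delta-i}=\bigoplus_j[\mathrm{Sym}_R(I)]_{(\delta-i,j)}$,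 a graded $S$-module. Let $$0\to F_n\xrightarrow{\alpha_n}\cdots\to F_1\xrightarrow{\alpha_1}F_0$$ be the part of $x$-degree $\delta-i$ of the Koszul complex of $l_1,\dots,l_n$ over $B$; it is a graded $S$-free resolution of $M$ (some of the $F_t$ may be $0$). For a matrix $\alpha$ over $S$ let $I_t(\alpha)$ be the ideal of its $t\times t$ minors (with $I_0(\alpha)=S$), let $\operatorname{rk}\alpha$ be the largest $t$ with $I_t(\alpha)\neq0$, and let $I(\alpha)=I_{\operatorname{rk}\alpha}(\alpha)$; the unit ideal has grade $\infty$. Put $f_t=\operatorname{rk}F_t$, $r_t=\operatorname{rk}\alpha_t$ and $s_1=\sum_{p=1}^n(-1)^{p-1}r_p$, and fix orientations $\eta_t:\wedge^{f_t}F_t\cong S$. Assume that $\operatorname{rank}_S M=2$. Then there are unique elements $a_t\in\wedge^{r_t}F_{t-1}$, $1\le t\le n$ (the Buchsbaum–Eisenbud multipliers), such that $a_n=(\wedge^{r_n}\alpha_n)(\eta_n^{-1}(1))$ (where $r_n=f_n$) and $(\wedge^{r_t}\alpha_t)(x)=\eta_t(a_{t+1}\wedge x)\,a_t$ for all $1\le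 t<n$ and $x\in\wedge^{r_t}F_t$. The homomorphism $$\psi:\wedge^{f_0-r_1-1}F_0\otimes S(-s_1)\to F_0^*,\qquad \psi(v)(w)=\eta_0(v\wedge a_1\wedge w),$$ is graded (its entries in the standard bases are zero or homogeneous of degree $s_1$); here $f_0-r_1-1=1$, so its source is $F_0\otimes S(-s_1)$. Consider the statements: (a) $M$ satisfies Serre's condition $(S_2)$, i.e. $\operatorname{depth}M_{\mathfrak p}\ge\min(2,\dim M_{\mathfrak p})$ for all primes $\mathfrak p$ of $S$; (b) $\operatorname{grade}I(\alpha_t)\ge t+2$ for $t=1,\dots,n$; (c) the sequence $\wedge^{f_0-r_1-1}F_0\otimes S(-s_1)\xrightarrow{\ \psi\ }F_0^*\xrightarrow{\ \alpha_1^*\ }F_1^*$ is exact, i.e. $\operatorname{im}\psi=\ker\alpha_1^*$. Then (a) $\Rightarrow$ (b) $\Rightarrow$ (c). -/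

import Mathlib

open MvPolynomial

noncomputable section

namespace ReesDual

/-! ### Grade, depth, perfect ideals, Serre's conditions -/

/-- The grade of an ideal `I` on a module `M`: the supremum of the lengths of `M`-regular
sequences in `I`.  Weakly regular sequences are used, so for finitely generated `M` over a
Noetherian ring the value is `⊤` when `I M = M`, and if `I M ≠ M` every such sequence is
automatically regular. -/
def gradeOn {A : Type*} [CommRing A] (I : Ideal A) (M : Type*) [AddCommGroup M] [Module A M] :
    ℕ∞ :=
  ⨆ (rs : List A) (_ : RingTheory.Sequence.IsWeaklyRegular M rs ∧ ∀ x ∈ rs, x ∈ I),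
    (rs.length : ℕ∞)

/-- The grade of an ideal (`⊤` for the unit ideal). -/
def grade {A : Type*} [CommRing A] (I : Ideal A) : ℕ∞ := gradeOn I A

/-- The depth of a module over a local ring. -/
def depth (A : Type*) [CommRing A] [IsLocalRing A] (M : Type*) [AddCommGroup M] [Module A M] :
    ℕ∞ :=
  gradeOn (IsLocalRing.maximalIdeal A) M

/-- A perfect ideal: the projective dimension of `A / I` equals the grade of `I`. -/
def IsPerfect {A : Type*} [CommRing A] (I : Ideal A) : Prop :=
  CategoryTheory.projectiveDimension (ModuleCat.of A (A ⧸ I)) = ((grade I : ℕ∞) : WithBot ℕ∞)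

/-- Serre's condition `(S_r)` for a module `M`: `depth M_p ≥ min (r, dim M_p)` for every
prime `p`. -/
def SerreCondition (A : Type*) [CommRing A] (M : Type*) [AddCommGroup M] [Module A M]
    (r : ℕ) : Prop :=
  ∀ (p : Ideal A) [p.IsPrime],
    min ((r : ℕ∞) : WithBot ℕ∞)
        (Module.supportDim (Localization.AtPrime p) (LocalizedModule p.primeCompl M)) ≤
      ((depth (Localization.AtPrime p) (LocalizedModule p.primeCompl M) : ℕ∞) : WithBot ℕ∞)

/-! ### Determinantal ideals -/

/-- The ideal `I_t(N)` generated by the `t × t` minors of `N`.  It is the unit ideal for `t = 0`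
and zero when `t` exceeds the size of `N` (a repeated row or column gives determinant `0`). -/
def minorsIdeal {A : Type*} [CommRing A] {p q : Type*} (N : Matrix p q A) (t : ℕ) : Ideal A :=
  Ideal.span {x | ∃ (u : Fin t → p) (v : Fin t → q), x = (N.submatrix u v).det}

/-- The rank of a matrix: the largest `t` with `I_t(N) ≠ 0`. -/
def detRank {A : Type*} [CommRing A] {p q : Type*} (N : Matrix p q A) : ℕ :=
  sSup {t | minorsIdeal N t ≠ ⊥}

/-- `I(N) = I_r(N)` with `r` the rank of `N`. -/
def rankIdeal {A : Type*} [CommRing A] {p q : Type*} (N : Matrix p q A) : Ideal A :=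
  minorsIdeal N (detRank N)

/-! ### Orientations and Buchsbaum-Eisenbud multipliers -/

/-- The linear functional on the exterior algebra of `F` obtained from `η : ⋀^f F ≃ A` by first
projecting to degree `f`. -/
def orientFun {A : Type*} [CommRing A] {F : Type*} [AddCommGroup F] [Module A F] {f : ℕ}
    (η : (⋀[A]^f F) ≃ₗ[A] A) : ExteriorAlgebra A F →ₗ[A] A :=
  η.toLinearMap ∘ₗ DirectSum.component A ℕ (fun i => ⋀[A]^i F) f ∘ₗ
    (ExteriorAlgebra.GradedAlgebra.liftι A F).toLinearMap

theorem orientFun_apply {A : Type*} [CommRing A] {F : Type*} [AddCommGroup F] [Module A F] {f : ℕ}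
    (η : (⋀[A]^f F) ≃ₗ[A] A) (x : ⋀[A]^f F) : orientFun η (x : ExteriorAlgebra A F) = η x := by
  simp [orientFun, ExteriorAlgebra.GradedAlgebra.liftι_eq, ← DirectSum.lof_eq_of A]

/-- The map `⋀^q F → F^*` given by wedging with `a` and then using the functional `ω`, i.e.
`v ↦ (w ↦ ω (v ∧ a ∧ w))`.  When `a` has degree `f - 1 - q`, with `f` the rank of `F`, and
`ω` comes from an orientation `η`, it is the composite of `v ↦ v ∧ a`, `⋀^q F → ⋀^(f - 1) F`,
and the identification of `⋀^(f - 1) F` with `F^*` by `η`. -/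
def wedgeDual {A : Type*} [CommRing A] {F : Type*} [AddCommGroup F] [Module A F]
    (ω : ExteriorAlgebra A F →ₗ[A] A) (a : ExteriorAlgebra A F) (q : ℕ) :
    (⋀[A]^q F) →ₗ[A] Module.Dual A F :=
  LinearMap.mk₂ A (fun v w => ω ((v : ExteriorAlgebra A F) * a * ExteriorAlgebra.ι A w))
    (by intros; simp [add_mul]) (by intros; simp)
    (by intros; simp [mul_add]) (by intros; simp)

/-- The Buchsbaum-Eisenbud multipliers of a complex `⋯ → F_2 → F_1 → F_0` of finite free modules
`F_t = A^(ι t)` with `F_t = 0` for `t > n`.  The matrix `α t` is that of the `(t + 1)`-st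
differential `F_(t+1) → F_t`, of rank `r_(t+1) = detRank (α t)`, and `a t` stands for the
multiplier `a_(t+1) ∈ ⋀^(r_(t+1)) F_t`.  The conditions say that `⋀^(r_t) α_t = a_t ∘ a_(t+1)^*`,
where `a_(t+1)^* : ⋀^(r_t) F_t → A` sends `x` to `η_t (a_(t+1) ∧ x)`.  The convention
`a_(n+1) = 1 ∈ ⋀^0 F_n` makes the instance `t = n` read `a_n = ⋀^(r_n) α_n`, where
`⋀^(r_n) F_n` is identified with `A` by `η_n`. -/
structure IsMultiplierFamily {A : Type*} [CommRing A] {ι : ℕ → Type*} [∀ t, Fintype (ι t)]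
    (n : ℕ) (α : ∀ t, Matrix (ι t) (ι (t + 1)) A)
    (η : ∀ t, (⋀[A]^(Fintype.card (ι t)) (ι t → A)) ≃ₗ[A] A)
    (a : ∀ t, ExteriorAlgebra A (ι t → A)) : Prop where
  mem : ∀ t, a t ∈ ⋀[A]^(detRank (α t)) (ι t → A)
  eq_one : ∀ t, n ≤ t → a t = 1
  factor : ∀ t, t < n → ∀ x ∈ ⋀[A]^(detRank (α t)) (ι (t + 1) → A),
    ExteriorAlgebra.map (Matrix.mulVecLin (α t)) x =
      orientFun (η (t + 1)) (a (t + 1) * x) • a t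

/-! ### The symmetric algebra of an ideal as a bigraded algebra -/

/-- The ring homomorphism `B = k[T_1, …, T_m][x_1, …, x_n] → Sym_R(I)`, where `R = k[x_1, …, x_n]`
and `I = (f_1, …, f_m)`, which is the structure map on `R` and sends `T_i` to `f_i`, viewed in
degree one of the symmetric algebra. -/
def toSym {K : Type*} [Field K] {n m : ℕ} (f : Fin m → MvPolynomial (Fin n) K) :
    MvPolynomial (Fin n) (MvPolynomial (Fin m) K) →+*
      SymmetricAlgebra (MvPolynomial (Fin n) K) (Ideal.span (Set.range f)) :=
  eval₂Hom
    (eval₂Hom ((algebraMap (MvPolynomial (Fin n) K)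
        (SymmetricAlgebra (MvPolynomial (Fin n) K) (Ideal.span (Set.range f)))).comp C)
      (fun i => SymmetricAlgebra.ι (MvPolynomial (Fin n) K) (Ideal.span (Set.range f))
        ⟨f i, Ideal.subset_span ⟨i, rfl⟩⟩))
    (fun j => algebraMap (MvPolynomial (Fin n) K)
      (SymmetricAlgebra (MvPolynomial (Fin n) K) (Ideal.span (Set.range f))) (X j))

/-- The part of degree `k` (in the variables `x`) of `S[x] / J`, as an `S`-module: the quotient of
the `S`-module of homogeneous polynomials of degree `k` by its intersection with `J`. -/
def DegreePart {S : Type*} [CommRing S] {σ : Type*} (J : Ideal (MvPolynomial σ S)) (k : ℕ) :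
    Type _ :=
  homogeneousSubmodule σ S k ⧸
    Submodule.comap (homogeneousSubmodule σ S k).subtype (J.restrictScalars S)

instance {S : Type*} [CommRing S] {σ : Type*} (J : Ideal (MvPolynomial σ S)) (k : ℕ) :
    AddCommGroup (DegreePart J k) :=
  inferInstanceAs (AddCommGroup (homogeneousSubmodule σ S k ⧸
    Submodule.comap (homogeneousSubmodule σ S k).subtype (J.restrictScalars S)))

instance {S : Type*} [CommRing S] {σ : Type*} (J : Ideal (MvPolynomial σ S)) (k : ℕ) :
    Module S (DegreePart J k) :=
  inferInstanceAs (Module S (homogeneousSubmodule σ S k ⧸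
    Submodule.comap (homogeneousSubmodule σ S k).subtype (J.restrictScalars S)))

/-- `Sym(I)_k`, the part of `x`-degree `k` of `Sym_R(I) = B / ker (toSym f)`, as a module over
`S = k[T_1, …, T_m]`. -/
abbrev SymPart {K : Type*} [Field K] {n m : ℕ} (f : Fin m → MvPolynomial (Fin n) K) (k : ℕ) :
    Type _ :=
  DegreePart (RingHom.ker (toSym f)) k

/-! ### The strands of the Koszul complex -/

/-- The forms `l_1, …, l_n` in `B = S[x_1, …, x_n]` with
`[l_1 … l_n] = [T_1 … T_m] φ`. -/
def symEquation {K : Type*} [Field K] {n m : ℕ}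
    (φ : Matrix (Fin m) (Fin n) (MvPolynomial (Fin n) K)) (j : Fin n) :
    MvPolynomial (Fin n) (MvPolynomial (Fin m) K) :=
  ∑ i, C (X i) * map C (φ i j)

/-- The `S`-basis `x^μ e_J` (`|J| = t`) of the part of `x`-degree `k` of
`⋀^t (B(-e_1) ⊕ ⋯ ⊕ B(-e_n))`: the degree of `x^μ` plus the sum of the `e_j`, `j ∈ J`,
equals `k`. -/
def KoszulIndex {n : ℕ} (e : Fin n → ℕ) (k t : ℕ) : Type :=
  {p : Finset (Fin n) × (Fin n →₀ ℕ) // p.1.card = t ∧ p.2.degree + ∑ j ∈ p.1, e j = k}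

instance {n : ℕ} (e : Fin n → ℕ) (k t : ℕ) : DecidableEq (KoszulIndex e k t) :=
  inferInstanceAs (DecidableEq {p : Finset (Fin n) × (Fin n →₀ ℕ) //
    p.1.card = t ∧ p.2.degree + ∑ j ∈ p.1, e j = k})

instance {n : ℕ} (e : Fin n → ℕ) (k t : ℕ) : Finite (KoszulIndex e k t) := by
  refine Finite.of_injective
    (fun p : KoszulIndex e k t => ((p.1.1, fun i => ⟨p.1.2 i, ?_⟩) :
      Finset (Fin n) × (Fin n → Fin (k + 1)))) ?_
  · have h1 := Finsupp.le_degree i p.1.2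
    have h2 := p.2.2
    omega
  · intro p q h
    simp only [Prod.mk.injEq, funext_iff, Fin.mk.injEq] at h
    exact Subtype.ext (Prod.ext h.1 (Finsupp.ext h.2))

instance {n : ℕ} (e : Fin n → ℕ) (k t : ℕ) : Fintype (KoszulIndex e k t) := Fintype.ofFinite _

/-- The matrix over `S` of the differential `F_(t+1) → F_t` of the strand of `x`-degree `k` of the
Koszul complex of `l_1, …, l_n` over `B`:
`x^μ e_J ↦ ∑ j ∈ J, (-1)^(#{i ∈ J | i < j}) x^μ l_j e_(J \ {j})`. -/
def koszulMatrix {S : Type*} [CommRing S] {n : ℕ} (l : Fin n → MvPolynomial (Fin n) S)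
    (e : Fin n → ℕ) (k t : ℕ) :
    Matrix (KoszulIndex e k t) (KoszulIndex e k (t + 1)) S :=
  fun q p => ∑ j ∈ p.1.1, if q.1.1 = p.1.1.erase j then
    (-1) ^ (p.1.1.filter (· < j)).card * coeff q.1.2 (monomial p.1.2 1 * l j) else 0

end ReesDual

end

/-! Resolution. Let a prime `P` of `R[T]` contain the forms `l_j` and lie over `p`. The depth of
`R[T]_P` is at least the depth of `R_p` plus the size of any minor of `φ` outside `p`, because such
a minor makes as many of the `l_j` part of a coordinate system over `R_p`. Away from the origin the
bound on `μ(I_p)` yields a minor of size at least `n - dim R_p`; over the origin the variables `x_i`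
alone give depth `n`. Hence `(l_1, …, l_n)` contains a regular sequence of length `n`
(`exists_isWeaklyRegular_symEquation`), the Koszul complex is acyclic, and its strand resolves `M`
(`exact_koszulMatrix`, `ker_toSym`, `nonempty_cokernel_equiv_degreePart`).

(a) ⇒ (b). If (b) fails for `α_t`, some prime `P ⊇ I(α_t)` has depth `S_P ≤ t + 1`. Since `M` has
positive rank, `dim M_P = dim S_P`, so `(S_2)` gives `depth M_P ≥ min(2, depth S_P)`. Each syzygy
gains one in depth until the depth of `S_P` is reached, so the cokernel of `α_t` at `P` has full
depth; having a finite free resolution it is free, and then a maximal minor of `α_t` is a unit at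
`P`, a contradiction (`free_coker_of_extVanish`, `le_grade_rankIdeal`). The same argument without
`(S_2)` gives the Buchsbaum–Eisenbud bound `grade I(α_t) ≥ t`.

Multipliers. Both `x ↦ η_t(a_(t+1) ∧ x)` and `⋀^(r_t) α_t` are alternating and kill the image of
`α_(t+1)`, whose corank is `r_t`; so they are proportional. The values of the first contain
`I(α_(t+1))`, an ideal of grade at least two, so the ratio `a_t` has no denominators
(`exists_multiplier`). Comparing degrees in the factorization gives the shift `s_1`.

(b) ⇒ (c). For `M` of rank two, `(x, y) ↦ η_0(x ∧ a_1 ∧ y)` is a skew form on `F_0` whose radical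
is, up to minors of `α_1`, the image of `α_1`. It splices the resolution with its dual to a complex
`0 → F_n → ⋯ → F_1 → F_0 → F_0^* → F_1^*`, in which `α_t` sits two places further to the left.
Condition (b) is exactly the grade condition for acyclicity of the longer complex
(`exact_of_le_grade_rankIdeal`), and exactness at `F_0^*` is (c). -/

open MvPolynomial
open scoped Matrix

noncomputable section

namespace ReesDual

universe u v

section

open CategoryTheory Abelian IsLocalRing RingTheory.Sequence Pointwise

/-! ### Depth over a Noetherian local ring -/

/-- `Ext^i(κ, M) = 0` for `i < g`. -/
def ExtVanish (A : Type u) [CommRing A] [IsLocalRing A] (M : Type u) [AddCommGroup M] [Module A M]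
    (g : ℕ) : Prop :=
  ∀ i < g, Subsingleton (Ext (ModuleCat.of A (ResidueField A)) (ModuleCat.of A M) i)

section

variable {A : Type u} [CommRing A] [IsLocalRing A]
variable {M : Type u} [AddCommGroup M] [Module A M] {N : Type u} [AddCommGroup N] [Module A N]

theorem ExtVanish.mono {g h : ℕ} (hM : ExtVanish A M g) (hgh : h ≤ g) : ExtVanish A M h :=
  fun i hi => hM i (hi.trans_le hgh)

theorem ExtVanish.of_linearEquiv {g : ℕ} (e : M ≃ₗ[A] N) (h : ExtVanish A M g) :
    ExtVanish A N g := by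
  intro i hi
  have : Subsingleton ((extFunctorObj (ModuleCat.of A (ResidueField A)) i).obj
    (ModuleCat.of A M)) := h i hi
  have e' := (((extFunctorObj (ModuleCat.of A (ResidueField A)) i).mapIso e.toModuleIso))
  exact e'.symm.addCommGroupIsoToAddEquiv.toEquiv.subsingleton

theorem support_residueField_eq [IsNoetherianRing A] :
    Module.support A (ResidueField A) = PrimeSpectrum.zeroLocus (maximalIdeal A : Set A) := by
  rw [Module.support_eq_zeroLocus]
  congr 1
  exact congrArg _ (Ideal.annihilator_quotient)

/-- One half of Rees' theorem. Depth is carried by Ext from here on, since long exact sequences move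
it along resolutions without any choice of regular sequences. -/
theorem ExtVanish.of_isWeaklyRegular [IsNoetherianRing A] [Module.Finite A M] [Nontrivial M]
    {rs : List A} (hrs : ∀ r ∈ rs, r ∈ maximalIdeal A) (h : IsWeaklyRegular M rs) :
    ExtVanish A M rs.length := by
  have h' : IsRegular M rs :=
    (IsLocalRing.isRegular_iff_isWeaklyRegular_of_subset_maximalIdeal hrs).mpr h
  intro i hi
  refine ModuleCat.subsingleton_ext_of_exists_isRegular (maximalIdeal A)
    (ModuleCat.of A (ResidueField A)) (Nfin := ?_) ?_ (ModuleCat.of A M) ?_ rs hrs h' i hi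
  · exact inferInstanceAs (Module.Finite A (ResidueField A))
  · exact support_residueField_eq.le
  · exact lt_top_iff_ne_top.mpr
      (Submodule.top_ne_ideal_smul_of_le_jacobson_annihilator
        (IsLocalRing.maximalIdeal_le_jacobson _)).symm

theorem ExtVanish.quotSMulTop {g : ℕ} (h : ExtVanish A M (g + 1)) {x : A}
    (hx : IsSMulRegular M x) : ExtVanish A (QuotSMulTop x M) g := by
  intro i hi
  have zero1 := AddCommGrpCat.isZero_of_iff_subsingleton.mpr (h i (by omega))
  have zero2 := AddCommGrpCat.isZero_of_iff_subsingleton.mpr (h (i + 1) (by omega))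
  exact AddCommGrpCat.subsingleton_of_isZero <| ShortComplex.Exact.isZero_of_both_zeros
    ((Ext.covariant_sequence_exact₃' (ModuleCat.of A (ResidueField A))
      (IsSMulRegular.smulShortComplex_shortExact (M := ModuleCat.of A M) hx)) i (i + 1) rfl)
    (zero1.eq_zero_of_src _) (zero2.eq_zero_of_tgt _)

theorem ExtVanish.quotient_ofList {g : ℕ} {rs : List A} (h : ExtVanish A M (g + rs.length))
    (hrs : IsWeaklyRegular M rs) :
    ExtVanish A (M ⧸ (Ideal.ofList rs • ⊤ : Submodule A M)) g := by
  induction rs generalizing M with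
  | nil =>
    refine ExtVanish.of_linearEquiv (Submodule.quotEquivOfEqBot _ ?_).symm (by simpa using h)
    simp
  | cons x rs ih =>
    rw [isWeaklyRegular_cons_iff] at hrs
    refine ExtVanish.of_linearEquiv
      (Submodule.quotOfListConsSMulTopEquivQuotSMulTopInner M x rs).symm (ih ?_ hrs.2)
    exact ExtVanish.quotSMulTop (by simpa [add_assoc] using h) hrs.1

/-- If the maximal ideal were associated, `κ` would embed in `M`, a nonzero element of `Hom(κ, M) =
Ext^0(κ, M)`. -/
theorem ExtVanish.notMem_associatedPrimes [IsNoetherianRing A] (h : ExtVanish A M 1) :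
    maximalIdeal A ∉ associatedPrimes A M := by
  intro hm
  obtain ⟨-, f, hf⟩ := (isAssociatedPrime_iff_exists_injective_linearMap (maximalIdeal A) M).mp hm
  have := h 0 one_pos
  have h0 : Subsingleton (ModuleCat.of A (ResidueField A) ⟶ ModuleCat.of A M) :=
    Ext.addEquiv₀.subsingleton_congr.mp this
  have h1 : Subsingleton (ResidueField A →ₗ[A] M) :=
    (ModuleCat.homAddEquiv (M := ModuleCat.of A (ResidueField A))
      (N := ModuleCat.of A M)).symm.subsingleton
  have h2 : (f : ResidueField A →ₗ[A] M) = 0 := @Subsingleton.elim _ h1 _ _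
  have : (1 : ResidueField A) = 0 := hf (by rw [h2]; rfl)
  exact one_ne_zero this

end

/-! ### Grade and associated primes -/

section

variable {A : Type u} [CommRing A]

theorem ofList_le_of_mem_associatedPrimes {x : List A} {P : Ideal A}
    (hP : P ∈ associatedPrimes A (A ⧸ (Ideal.ofList x • ⊤ : Submodule A A))) :
    Ideal.ofList x ≤ P := by
  refine le_trans ?_ (IsAssociatedPrime.annihilator_le hP)
  intro a ha
  rw [Submodule.mem_annihilator]
  intro b _
  obtain ⟨b, rfl⟩ := Submodule.Quotient.mk_surjective _ b
  rw [← Submodule.Quotient.mk_smul, Submodule.Quotient.mk_eq_zero]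
  exact Submodule.smul_mem_smul ha trivial

theorem mem_maximalIdeal_of_mem_map {P : Ideal A} [P.IsPrime] {x : List A} (hx : ∀ a ∈ x, a ∈ P) :
    ∀ r ∈ x.map (algebraMap A (Localization.AtPrime P)),
      r ∈ maximalIdeal (Localization.AtPrime P) := by
  intro r hr
  obtain ⟨a, ha, rfl⟩ := List.mem_map.mp hr
  exact (IsLocalization.AtPrime.to_map_mem_maximal_iff _ P a).mpr (hx a ha)

variable [IsNoetherianRing A]

/-- The maximal ideal of `A_P` is associated to `A_P / (x)`, so this quotient has depth zero, while
dividing by `x` costs only `x.length` degrees of Ext vanishing. Thus `A_P` has depth exactly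
`x.length`. -/
theorem not_extVanish_of_mem_associatedPrimes {x : List A} (hx : IsWeaklyRegular A x)
    {P : Ideal A} [P.IsPrime]
    (hP : P ∈ associatedPrimes A (A ⧸ (Ideal.ofList x • ⊤ : Submodule A A))) :
    ¬ ExtVanish (Localization.AtPrime P) (Localization.AtPrime P) (x.length + 1) := by
  intro h
  have hx' := IsWeaklyRegular.of_isLocalization (Localization.AtPrime P) P.primeCompl hx
  have h1 := ExtVanish.quotient_ofList (g := 1) (rs := x.map (algebraMap A (Localization.AtPrime P)))
    (by rw [List.length_map, add_comm]; exact h) hx'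
  refine h1.notMem_associatedPrimes ?_
  have key := Module.associatedPrimes.mem_associatedPrimes_of_comap_mem_associatedPrimes_of_isLocalizedModule
    P.primeCompl
    (Submodule.toLocalizedQuotient' (Localization.AtPrime P) P.primeCompl
      (Algebra.linearMap A (Localization.AtPrime P)) (Ideal.ofList x • ⊤ : Submodule A A))
    (maximalIdeal (Localization.AtPrime P)) (by
      rw [← Ideal.under_def, IsLocalization.AtPrime.under_maximalIdeal (Localization.AtPrime P) P]
      exact hP)
  have heq : Submodule.localized' (Localization.AtPrime P) P.primeCompl
      (Algebra.linearMap A (Localization.AtPrime P)) (Ideal.ofList x • ⊤ : Submodule A A) =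
      (Ideal.ofList (x.map (algebraMap A (Localization.AtPrime P))) • ⊤ :
        Submodule (Localization.AtPrime P) (Localization.AtPrime P)) := by
    rw [Ideal.smul_eq_mul, Ideal.mul_top, Ideal.smul_eq_mul, Ideal.mul_top, ← Ideal.map_ofList]
    exact Ideal.localized'_eq_map _ _ _
  rw [heq] at key
  exact key

theorem length_le_of_mem_associatedPrimes {x : List A} (hx : IsWeaklyRegular A x)
    {P : Ideal A} [P.IsPrime]
    (hP : P ∈ associatedPrimes A (A ⧸ (Ideal.ofList x • ⊤ : Submodule A A)))
    {rs : List (Localization.AtPrime P)}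
    (hmem : ∀ r ∈ rs, r ∈ maximalIdeal (Localization.AtPrime P))
    (hrs : IsWeaklyRegular (Localization.AtPrime P) rs) : rs.length ≤ x.length := by
  by_contra! hlt
  exact not_extVanish_of_mem_associatedPrimes hx hP
    ((ExtVanish.of_isWeaklyRegular hmem hrs).mono hlt)

/-- Prime avoidance over the finitely many associated primes extends `x` inside `I`. Together with
`not_extVanish_of_mem_associatedPrimes`, a failure of `grade I ≥ G` produces a prime `P ⊇ I` with
`depth A_P < G`; both grade estimates below are contradictions to this. The unit ideal is covered,
as only weak regularity is asked. -/
theorem exists_isWeaklyRegular_of_forall_associatedPrimes (I : Ideal A) (G : ℕ)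
    (h : ∀ x : List A, IsWeaklyRegular A x → (∀ a ∈ x, a ∈ I) → x.length < G →
      ∀ P ∈ associatedPrimes A (A ⧸ (Ideal.ofList x • ⊤ : Submodule A A)), ¬ I ≤ P) :
    ∃ x : List A, x.length = G ∧ IsWeaklyRegular A x ∧ ∀ a ∈ x, a ∈ I := by
  induction G with
  | zero => exact ⟨[], rfl, by simp, by simp⟩
  | succ G ih =>
    obtain ⟨x, hlen, hx, hxI⟩ := ih fun x h1 h2 h3 => h x h1 h2 (h3.trans (Nat.lt_succ_self G))
    have hx' := h x hx hxI (by omega)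
    have hnot : ¬ ((I : Set A) ⊆
        ⋃ P ∈ associatedPrimes A (A ⧸ (Ideal.ofList x • ⊤ : Submodule A A)), (P : Set A)) := by
      intro hsub
      rw [Ideal.subset_union_prime_finite (associatedPrimes.finite A _) ⊤ ⊤
        (fun P hP _ _ => IsAssociatedPrime.isPrime hP)] at hsub
      obtain ⟨P, hP, hle⟩ := hsub
      exact hx' P hP hle
    rw [biUnion_associatedPrimes_eq_compl_regular] at hnot
    obtain ⟨y, hyI, hy⟩ := Set.not_subset.mp hnot
    refine ⟨x ++ [y], by simp [hlen], ?_, ?_⟩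
    · rw [isWeaklyRegular_append_iff, isWeaklyRegular_singleton_iff]
      exact ⟨hx, by simpa using hy⟩
    · intro a ha
      rcases List.mem_append.mp ha with ha | ha
      · exact hxI a ha
      · rw [List.mem_singleton.mp ha]; exact hyI

theorem le_gradeOn_of_isWeaklyRegular {B : Type*} [CommRing B] {M : Type*} [AddCommGroup M]
    [Module B M] {I : Ideal B} {x : List B} (hx : IsWeaklyRegular M x) (hxI : ∀ a ∈ x, a ∈ I) :
    (x.length : ℕ∞) ≤ gradeOn I M :=
  le_iSup₂_of_le x ⟨hx, hxI⟩ le_rfl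

theorem exists_isWeaklyRegular_of_le_gradeOn {B : Type*} [CommRing B] {M : Type*} [AddCommGroup M]
    [Module B M] {I : Ideal B} {G : ℕ} (h : (G : ℕ∞) ≤ gradeOn I M) :
    ∃ x : List B, x.length = G ∧ IsWeaklyRegular M x ∧ ∀ a ∈ x, a ∈ I := by
  obtain ⟨x, hlen, hx, hxI⟩ : ∃ x : List B, G ≤ x.length ∧ IsWeaklyRegular M x ∧ ∀ a ∈ x, a ∈ I := by
    rcases Nat.eq_zero_or_pos G with rfl | hG
    · exact ⟨[], by simp, by simp, by simp⟩
    by_contra! hcon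
    have : gradeOn I M ≤ ((G - 1 : ℕ) : ℕ∞) := by
      refine iSup₂_le fun x hx => ?_
      have hlt : x.length < G := by
        by_contra! hge
        obtain ⟨a, ha, hna⟩ := hcon x hge hx.1
        exact hna (hx.2 a ha)
      exact_mod_cast Nat.le_sub_one_of_lt hlt
    have h2 : (G : ℕ∞) ≤ ((G - 1 : ℕ) : ℕ∞) := h.trans this
    have : G ≤ G - 1 := by exact_mod_cast h2
    omega
  refine ⟨x.take G, by simpa using hlen, ?_, fun a ha => hxI a (List.mem_of_mem_take ha)⟩
  have := hx
  rw [← List.take_append_drop G x, isWeaklyRegular_append_iff] at this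
  exact this.1

end

/-! ### Syzygies over a local ring -/

section

variable {A : Type u} [CommRing A]
variable {X Y Z : Type u} [AddCommGroup X] [Module A X] [AddCommGroup Y] [Module A Y]
  [AddCommGroup Z] [Module A Z]

theorem shortExact_of_linearMap {f : X →ₗ[A] Y} {g : Y →ₗ[A] Z} (hf : Function.Injective f)
    (hfg : Function.Exact f g) (hg : Function.Surjective g) :
    (ShortComplex.mk (ModuleCat.ofHom f) (ModuleCat.ofHom g)
      (by ext x; exact hfg.apply_apply_eq_zero x)).ShortExact := by
  have : Mono (ModuleCat.ofHom f) := (ModuleCat.mono_iff_injective _).mpr hf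
  have : Epi (ModuleCat.ofHom g) := (ModuleCat.epi_iff_surjective _).mpr hg
  refine ⟨?_⟩
  rw [ShortComplex.moduleCat_exact_iff]
  intro y hy
  exact (hfg y).mp hy

variable [IsLocalRing A]

/-- The depth lemma for a first syzygy: `Ext^(i+1)(κ, X)` lies between `Ext^i(κ, Z)` and
`Ext^(i+1)(κ, Y)`, and `Hom(κ, -)` is left exact. -/
theorem ExtVanish.kernel {f : X →ₗ[A] Y} {g : Y →ₗ[A] Z} (hf : Function.Injective f)
    (hfg : Function.Exact f g) (hg : Function.Surjective g) {a : ℕ}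
    (hY : ExtVanish A Y (a + 1)) (hZ : ExtVanish A Z a) : ExtVanish A X (a + 1) := by
  intro i hi
  rcases i with _ | i
  · have : Mono (ModuleCat.ofHom f) := (ModuleCat.mono_iff_injective _).mpr hf
    have h0 := hY 0 hi
    have hinj := Ext.postcomp_mk₀_injective_of_mono (ModuleCat.of A (ResidueField A))
      (ModuleCat.ofHom f)
    exact hinj.subsingleton
  · have zero1 := AddCommGrpCat.isZero_of_iff_subsingleton.mpr (hZ i (by omega))
    have zero2 := AddCommGrpCat.isZero_of_iff_subsingleton.mpr (hY (i + 1) hi)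
    exact AddCommGrpCat.subsingleton_of_isZero <| ShortComplex.Exact.isZero_of_both_zeros
      ((Ext.covariant_sequence_exact₁' (ModuleCat.of A (ResidueField A))
        (shortExact_of_linearMap hf hfg hg)) i (i + 1) rfl)
      (zero1.eq_zero_of_src _) (zero2.eq_zero_of_tgt _)

theorem smul_ext_residueField_eq_zero {i : ℕ} {a : A} (ha : a ∈ maximalIdeal A)
    (ε : Ext (ModuleCat.of A (ResidueField A)) (ModuleCat.of A X) i) : a • ε = 0 := by
  have h0 : a • 𝟙 (ModuleCat.of A (ResidueField A)) = 0 := by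
    ext x
    have : a • x = 0 := by
      obtain ⟨r, rfl⟩ := residue_surjective x
      rw [Algebra.smul_def]
      have : algebraMap A (ResidueField A) a = 0 := (residue_eq_zero_iff a).mpr ha
      rw [this, zero_mul]
    exact this
  have : a • ε = (Ext.mk₀ (a • 𝟙 (ModuleCat.of A (ResidueField A)))).comp ε (zero_add i) := by
    rw [Ext.mk₀_smul, Ext.smul_comp, Ext.mk₀_id_comp]
  rw [this, h0, Ext.mk₀_zero, Ext.zero_comp]

/-- The map `1 ↦ y` is an `𝔪`-linear combination of maps `A → Y`, and `𝔪` annihilates every `Ext(κ,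
-)`. -/
theorem comp_mk₀_toSpanSingleton_eq_zero {i : ℕ} {y : Y}
    (hy : y ∈ maximalIdeal A • (⊤ : Submodule A Y))
    (ε : Ext (ModuleCat.of A (ResidueField A)) (ModuleCat.of A A) i) :
    ε.comp (Ext.mk₀ (ModuleCat.ofHom (LinearMap.toSpanSingleton A Y y))) (add_zero i) = 0 := by
  refine Submodule.smul_induction_on hy (fun a ha y _ => ?_) (fun y z h1 h2 => ?_)
  · have : ModuleCat.ofHom (LinearMap.toSpanSingleton A Y (a • y)) =
        a • ModuleCat.ofHom (LinearMap.toSpanSingleton A Y y) := by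
      ext; simp
    rw [this, Ext.mk₀_smul, Ext.comp_smul, smul_ext_residueField_eq_zero ha]
  · have : ModuleCat.ofHom (LinearMap.toSpanSingleton A Y (y + z)) =
        ModuleCat.ofHom (LinearMap.toSpanSingleton A Y y) +
          ModuleCat.ofHom (LinearMap.toSpanSingleton A Y z) := by
      ext; simp
    rw [this, Ext.mk₀_add, Ext.comp_add, h1, h2, add_zero]

/-- A finite module with a free resolution of length one and depth at least that of the ring
is free. -/
theorem free_of_extVanish [IsNoetherianRing A] [Module.Finite A X] [Module.Free A X]
    [Module.Finite A Y] [Module.Free A Y] {f : X →ₗ[A] Y} {g : Y →ₗ[A] Z}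
    (hf : Function.Injective f) (hfg : Function.Exact f g) (hg : Function.Surjective g) {D : ℕ}
    (hA : ¬ ExtVanish A A (D + 1)) (hZ : ExtVanish A Z D) : Module.Free A Z := by
  -- It remains to see that `f` sends no element outside `𝔪X` into `𝔪Y`. A nonzero class in
  -- `Ext^i(κ, A)` with `i ≤ D` detects this.
  refine Module.free_of_lTensor_residueField_injective f g hg hfg ?_
  obtain ⟨i, hi, hne⟩ : ∃ i < D + 1, ¬ Subsingleton
      (Ext (ModuleCat.of A (ResidueField A)) (ModuleCat.of A A) i) := by
    simpa [ExtVanish] using hA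
  -- The kernel on `Ext^i` comes from `Ext^(i-1)(κ, Z)`, which vanishes because `i - 1 < D`.
  have hinj : Function.Injective ((Ext.mk₀ (ModuleCat.ofHom f)).postcomp
      (ModuleCat.of A (ResidueField A)) (add_zero i)) := by
    rcases i with _ | i
    · have : Mono (ModuleCat.ofHom f) := (ModuleCat.mono_iff_injective _).mpr hf
      exact Ext.postcomp_mk₀_injective_of_mono (ModuleCat.of A (ResidueField A))
        (ModuleCat.ofHom f)
    · have zero1 := AddCommGrpCat.isZero_of_iff_subsingleton.mpr (hZ i (by omega))
      have := (Ext.covariant_sequence_exact₁' (ModuleCat.of A (ResidueField A))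
        (shortExact_of_linearMap hf hfg hg) i (i + 1) rfl).mono_g (zero1.eq_zero_of_src _)
      exact (AddCommGrpCat.mono_iff_injective _).mp this
  rw [← LinearMap.ker_eq_bot, Submodule.eq_bot_iff]
  intro w hw
  obtain ⟨z, rfl⟩ : ∃ z : X, w = (1 : ResidueField A) ⊗ₜ[A] z := by
    obtain ⟨z, hz⟩ := TensorProduct.mk_surjective A X (ResidueField A) residue_surjective w
    exact ⟨z, hz.symm⟩
  have key : ∀ (W : Type u) [AddCommGroup W] [Module A W] (v : W),
      (1 : ResidueField A) ⊗ₜ[A] v = 0 ↔ v ∈ maximalIdeal A • (⊤ : Submodule A W) := by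
    intro W _ _ v
    have := (TensorProduct.quotTensorEquivQuotSMul W (maximalIdeal A)).map_eq_zero_iff
      (x := (1 : A ⧸ maximalIdeal A) ⊗ₜ[A] v)
    refine Iff.trans this.symm ?_
    rw [show (1 : A ⧸ maximalIdeal A) = Ideal.Quotient.mk _ 1 from rfl,
      TensorProduct.quotTensorEquivQuotSMul_mk_tmul, one_smul, Submodule.Quotient.mk_eq_zero]
  rw [key]
  have hfz : f z ∈ maximalIdeal A • (⊤ : Submodule A Y) := by
    rw [← key]; simpa using hw
  by_contra hz
  let b := Module.Free.chooseBasis A X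
  have : ∃ j, b.repr z j ∉ maximalIdeal A := by
    by_contra! hcon
    apply hz
    rw [← b.sum_repr z]
    exact Submodule.sum_mem _ fun j _ => Submodule.smul_mem_smul (hcon j) trivial
  obtain ⟨j, hj⟩ := this
  have hu : IsUnit (b.repr z j) := by simpa using hj
  apply hne
  refine subsingleton_of_forall_eq 0 fun ε => ?_
  -- Pushing `ε` along `1 ↦ z` and then `f` is pushing it along `1 ↦ f z ∈ 𝔪Y`, which gives zero;
  -- injectivity removes `f`. The coordinate of `z` that is a unit then recovers `ε` up to this
  -- unit, so `ε = 0`.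
  have h1 : ε.comp (Ext.mk₀ (ModuleCat.ofHom (LinearMap.toSpanSingleton A X z))) (add_zero i) = 0 := by
    apply hinj
    rw [map_zero]
    change (ε.comp (Ext.mk₀ (ModuleCat.ofHom (LinearMap.toSpanSingleton A X z))) (add_zero i)).comp
      (Ext.mk₀ (ModuleCat.ofHom f)) (add_zero i) = 0
    rw [Ext.comp_assoc_of_third_deg_zero, Ext.mk₀_comp_mk₀]
    have : ModuleCat.ofHom (LinearMap.toSpanSingleton A X z) ≫ ModuleCat.ofHom f =
        ModuleCat.ofHom (LinearMap.toSpanSingleton A Y (f z)) := by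
      ext; simp
    rw [this]
    exact comp_mk₀_toSpanSingleton_eq_zero hfz ε
  have h2 : (b.repr z j) • ε = 0 := by
    have : (b.repr z j) • ε = (ε.comp (Ext.mk₀ (ModuleCat.ofHom
        (LinearMap.toSpanSingleton A X z))) (add_zero i)).comp
        (Ext.mk₀ (ModuleCat.ofHom (b.coord j))) (add_zero i) := by
      rw [Ext.comp_assoc_of_third_deg_zero, Ext.mk₀_comp_mk₀]
      have : ModuleCat.ofHom (LinearMap.toSpanSingleton A X z) ≫ ModuleCat.ofHom (b.coord j) =
          (b.repr z j) • 𝟙 (ModuleCat.of A A) := by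
        ext; simp
      rw [this, Ext.mk₀_smul, Ext.comp_smul, Ext.comp_mk₀_id]
    rw [this, h1, Ext.zero_comp]
  exact (hu.smul_eq_zero).mp h2

end

theorem isWeaklyRegular_of_flat {A : Type*} [CommRing A] {rs : List A}
    (h : IsWeaklyRegular A rs) {F : Type*} [AddCommGroup F] [Module A F] [Module.Flat A F] :
    IsWeaklyRegular F rs :=
  ((TensorProduct.rid A F).isWeaklyRegular_congr rs).mp (h.isWeaklyRegular_lTensor (M₂ := F))

/-- In a finite free resolution over a local ring of depth at most `D`, the cokernels from
the step `t` on are free if `D ≤ t + g` and the resolved module has depth at least `min g D`. -/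
theorem free_coker_of_extVanish {A : Type u} [CommRing A] [IsLocalRing A] [IsNoetherianRing A]
    {F : ℕ → Type u} [∀ t, AddCommGroup (F t)] [∀ t, Module A (F t)] [∀ t, Module.Finite A (F t)]
    [∀ t, Module.Free A (F t)] (d : ∀ t, F (t + 1) →ₗ[A] F t)
    (hd : ∀ t, Function.Exact (d (t + 1)) (d t)) {n : ℕ} (hn : ∀ t, n < t → Subsingleton (F t))
    {D g : ℕ} {rs : List A} (hD : rs.length = D) (hrs : IsWeaklyRegular A rs)
    (hmem : ∀ r ∈ rs, r ∈ maximalIdeal A) (hA : ¬ ExtVanish A A (D + 1))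
    (h0 : ExtVanish A (F 0 ⧸ LinearMap.range (d 0)) (min g D)) {t : ℕ} (ht : D ≤ t + g) :
    Module.Free A (F t ⧸ LinearMap.range (d t)) := by
  -- By exactness the cokernel of `d (s + 1)` is the image of `d s`, i.e. the first syzygy of the
  -- cokernel of `d s`.
  let φ : ∀ s, (F (s + 1) ⧸ LinearMap.range (d (s + 1))) →ₗ[A] F s := fun s =>
    Submodule.liftQ _ (d s) (by
      rw [LinearMap.range_le_ker_iff]; exact (hd s).linearMap_comp_eq_zero)
  have hφ : ∀ s, Function.Injective (φ s) := by
    intro s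
    rw [← LinearMap.ker_eq_bot, Submodule.ker_liftQ_eq_bot]
    exact fun x hx => ((hd s) x).mp hx
  have hφr : ∀ s, Function.Exact (φ s) (LinearMap.range (d s)).mkQ := by
    intro s
    rw [LinearMap.exact_iff, Submodule.ker_mkQ, Submodule.range_liftQ]
  have hFree : ∀ s, ExtVanish A (F s) D := by
    intro s
    rcases subsingleton_or_nontrivial (F s) with h | h
    · intro i _
      have hz : 𝟙 (ModuleCat.of A (F s)) = 0 := by ext x; exact Subsingleton.elim _ _
      refine subsingleton_of_forall_eq 0 fun ε => ?_
      rw [← Ext.comp_mk₀_id ε, hz, Ext.mk₀_zero, Ext.comp_zero]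
    · rw [← hD]
      exact ExtVanish.of_isWeaklyRegular hmem (isWeaklyRegular_of_flat hrs)
  have hdepth : ∀ s, ExtVanish A (F s ⧸ LinearMap.range (d s)) (min (g + s) D) := by
    intro s
    induction s with
    | zero => simpa using h0
    | succ s ih =>
      rcases Nat.lt_or_ge (g + s) D with hlt | hge
      · rw [min_eq_left hlt.le] at ih
        have hlt' : g + (s + 1) ≤ D := by omega
        rw [min_eq_left hlt']
        exact ExtVanish.kernel (hφ s) (hφr s) (Submodule.mkQ_surjective _)
          ((hFree s).mono (by omega)) ih
      · rw [min_eq_right (by omega)] at ih ⊢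
        rcases D with _ | D
        · intro i hi; omega
        · exact ExtVanish.kernel (hφ s) (hφr s) (Submodule.mkQ_surjective _) (hFree s)
            (ih.mono (Nat.le_succ D))
  -- Freeness descends from `s > n`, where `F s` is zero: once the cokernel at `s + 1` is free, the
  -- one at `s` has a free resolution of length one, and its depth is full because `D ≤ t + g ≤ s +
  -- g`.
  have main : ∀ m s, t ≤ s → n < s + m → Module.Free A (F s ⧸ LinearMap.range (d s)) := by
    intro m
    induction m with
    | zero =>
      intro s _ hs
      have := hn s hs
      infer_instance
    | succ m ih =>
      intro s hs hm
      have := ih (s + 1) (by omega) (by omega)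
      refine free_of_extVanish (hφ s) (hφr s) (Submodule.mkQ_surjective _) hA ?_
      have hDs : D ≤ g + s := by omega
      exact (hdepth s).mono (min_eq_right hDs).ge
  exact main (n + 1) t le_rfl (by omega)

end

section

open IsLocalRing RingTheory.Sequence Pointwise

/-! ### Regular local rings are Cohen-Macaulay -/

theorem isWeaklyRegular_cons_of_quotient {A : Type*} [CommRing A] {x : A} (hx : IsSMulRegular A x)
    {rs : List (A ⧸ Ideal.span {x})} (hrs : IsWeaklyRegular (A ⧸ Ideal.span {x}) rs) :
    ∃ xs : List A, xs.map (Ideal.Quotient.mk (Ideal.span {x})) = rs ∧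
      IsWeaklyRegular A (x :: xs) := by
  obtain ⟨xs, rfl⟩ : ∃ xs : List A, xs.map (Ideal.Quotient.mk (Ideal.span {x})) = rs :=
    List.map_surjective_iff.mpr Ideal.Quotient.mk_surjective rs
  refine ⟨xs, rfl, ?_⟩
  rw [isWeaklyRegular_cons_iff]
  refine ⟨hx, ?_⟩
  have h1 : IsWeaklyRegular (A ⧸ Ideal.span {x}) xs :=
    (isWeaklyRegular_map_algebraMap_iff (S := A ⧸ Ideal.span {x}) (A ⧸ Ideal.span {x}) xs).mp hrs
  refine ((Submodule.quotEquivOfEq _ _ ?_).isWeaklyRegular_congr xs).mp h1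
  rw [← Submodule.ideal_span_singleton_smul, Ideal.smul_eq_mul, Ideal.mul_top]

/-- An expression of `x` in `S` with all coefficients in the maximal ideal would put `x` in its
square; a generator with unit coefficient can be exchanged for `x`. -/
theorem exists_span_insert_erase_eq {A : Type*} [CommRing A] [IsLocalRing A] [DecidableEq A]
    {S : Finset A} (hS : Ideal.span (S : Set A) = maximalIdeal A) {x : A}
    (hx : x ∈ maximalIdeal A) (hx2 : x ∉ maximalIdeal A ^ 2) :
    ∃ s ∈ S, Ideal.span {x} ⊔ Ideal.span ((S.erase s : Finset A) : Set A) = maximalIdeal A := by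
  rw [← hS] at hx
  obtain ⟨c, hc⟩ := (Submodule.mem_span_finset' (s := S)).mp hx
  have : ∃ s : S, IsUnit (c s) := by
    by_contra! hcon
    apply hx2
    rw [← hc, pow_two]
    refine Ideal.sum_mem _ fun s _ => ?_
    exact Ideal.mul_mem_mul ((mem_maximalIdeal _).mpr (hcon s)) (hS ▸ Ideal.subset_span s.2)
  obtain ⟨s, hs⟩ := this
  refine ⟨s, s.2, le_antisymm ?_ ?_⟩
  · rw [← hS, sup_le_iff]
    refine ⟨?_, Ideal.span_mono (by simp)⟩
    rw [Ideal.span_le, Set.singleton_subset_iff]; exact hx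
  · rw [← hS, Ideal.span_le]
    intro t ht
    by_cases hts : t = s
    · subst hts
      have hmem : c s * s.1 ∈ Ideal.span {x} ⊔ Ideal.span ((S.erase s : Finset A) : Set A) := by
        have : c s * s.1 = x - ∑ i ∈ (Finset.univ.erase s), c i • i.1 := by
          rw [← hc, ← Finset.add_sum_erase _ _ (Finset.mem_univ s)]; simp
        rw [this]
        refine sub_mem (Ideal.mem_sup_left (Ideal.mem_span_singleton_self x))
          (Ideal.mem_sup_right (Ideal.sum_mem _ fun i hi => ?_))
        refine Ideal.mul_mem_left _ _ (Ideal.subset_span ?_)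
        simp only [Finset.coe_erase, Set.mem_sdiff, Finset.mem_coe, Set.mem_singleton_iff]
        exact ⟨i.2, fun h => (Finset.mem_erase.mp hi).1 (Subtype.ext h)⟩
      exact (Ideal.unit_mul_mem_iff_mem _ hs).mp hmem
    · exact Ideal.mem_sup_right (Ideal.subset_span (by simpa using ⟨ht, hts⟩))

/-- The domain property has to be carried along in the induction. For `x ∈ 𝔪 \ 𝔪²` outside all
minimal primes, `A / x` is a domain by induction, so `(x)` is prime and contains a minimal prime
`q`. As `x ∉ q`, one gets `q = xq`, hence `q = 0` by Nakayama, and `x` is a nonzerodivisor. -/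
theorem isDomain_and_exists_isWeaklyRegular (d : ℕ) : ∀ (A : Type u) [CommRing A] [IsLocalRing A]
    [IsNoetherianRing A] (S : Finset A), S.card ≤ d → Ideal.span (S : Set A) = maximalIdeal A →
    ringKrullDim A = d → IsDomain A ∧ ∃ rs : List A, rs.length = d ∧
      (∀ r ∈ rs, r ∈ maximalIdeal A) ∧ IsWeaklyRegular A rs := by
  classical
  induction d with
  | zero =>
    intro A _ _ _ S hS hspan _
    have hm : maximalIdeal A = ⊥ := by
      rw [← hspan, Finset.card_eq_zero.mp (Nat.le_zero.mp hS)]; simp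
    have := (IsLocalRing.isField_iff_maximalIdeal_eq.mpr hm).isDomain
    exact ⟨this, [], rfl, by simp, by simp⟩
  | succ d ih =>
    intro A _ _ _ S hS hspan hdim
    have hne : maximalIdeal A ∉ minimalPrimes A := by
      intro hmem
      have h0 := Ideal.height_eq_zero_iff.mpr hmem
      have h1 := maximalIdeal_height_eq_ringKrullDim (R := A)
      rw [h0, hdim] at h1
      have : ((0 : ℕ) : WithBot ℕ∞) = ((d + 1 : ℕ) : WithBot ℕ∞) := by simpa using h1
      exact absurd (by exact_mod_cast this) (Nat.succ_ne_zero d).symm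
    have hsq : ¬ maximalIdeal A ≤ maximalIdeal A ^ 2 := by
      intro hle
      have hbot : maximalIdeal A = ⊥ := by
        refine Submodule.eq_bot_of_le_smul_of_le_jacobson_bot (maximalIdeal A) _
          (maximalIdeal A).fg_of_isNoetherianRing (by rwa [smul_eq_mul, ← pow_two])
          (maximalIdeal_le_jacobson _)
      have hf := (IsLocalRing.isField_iff_maximalIdeal_eq.mpr hbot)
      have := hf.isDomain
      apply hne
      rw [hbot, IsDomain.minimalPrimes_eq_singleton_bot]; rfl
    -- Prime avoidance tolerates the one ideal `𝔪²` that is not prime.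
    have hnot : ¬ ((maximalIdeal A : Set A) ⊆
        ⋃ P ∈ insert (maximalIdeal A ^ 2) (minimalPrimes A), (P : Set A)) := by
      intro hsub
      rw [Ideal.subset_union_prime_finite
        ((minimalPrimes.finite_of_isNoetherianRing A).insert _) (maximalIdeal A ^ 2)
        (maximalIdeal A ^ 2)] at hsub
      · obtain ⟨P, hP, hle⟩ := hsub
        rcases hP with rfl | hP
        · exact hsq hle
        · have hPp : P.IsPrime := Ideal.IsMinimalPrime.isPrime hP
          have : P = maximalIdeal A := le_antisymm (le_maximalIdeal hPp.ne_top) hle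
          exact hne (this ▸ hP)
      · intro P hP hP' _
        rcases hP with rfl | hP
        · exact absurd rfl hP'
        · exact Ideal.IsMinimalPrime.isPrime hP
    obtain ⟨x, hxm, hx⟩ := Set.not_subset.mp hnot
    simp only [Set.mem_insert_iff, Set.iUnion_iUnion_eq_or_left, Set.mem_union, Set.mem_iUnion,
      not_or, not_exists, SetLike.mem_coe] at hx
    obtain ⟨hx2, hxmin⟩ := hx
    obtain ⟨s, hsS, hspan'⟩ := exists_span_insert_erase_eq hspan hxm hx2
    have hxtop : Ideal.span {x} ≠ ⊤ := fun h =>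
      (maximalIdeal.isMaximal A).ne_top (top_le_iff.mp (h ▸ (Ideal.span_singleton_le_iff_mem _).mpr hxm))
    have : Nontrivial (A ⧸ Ideal.span {x}) := Ideal.Quotient.nontrivial_iff.mpr hxtop
    have : IsLocalRing (A ⧸ Ideal.span {x}) :=
      IsLocalRing.of_surjective' (Ideal.Quotient.mk _) Ideal.Quotient.mk_surjective
    have hmap : (maximalIdeal A).map (Ideal.Quotient.mk (Ideal.span {x})) =
        maximalIdeal (A ⧸ Ideal.span {x}) :=
      map_maximalIdeal_of_surjective _ Ideal.Quotient.mk_surjective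
    let S' : Finset (A ⧸ Ideal.span {x}) := (S.erase s).image (Ideal.Quotient.mk _)
    have hS'card : S'.card ≤ d := by
      refine Finset.card_image_le.trans ?_
      rw [Finset.card_erase_of_mem hsS]; omega
    have hS'span : Ideal.span (S' : Set (A ⧸ Ideal.span {x})) =
        maximalIdeal (A ⧸ Ideal.span {x}) := by
      rw [← hmap, ← hspan', Ideal.map_sup, Ideal.map_span, Ideal.map_span]
      simp [S']
    -- At most `d` generators of the maximal ideal bound the dimension from above; dividing by one
    -- element lowers it by at most one.
    have hdim' : ringKrullDim (A ⧸ Ideal.span {x}) = d := by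
      apply le_antisymm
      · rw [← maximalIdeal_height_eq_ringKrullDim, ← hS'span]
        have h1 := Ideal.height_le_spanFinrank (Ideal.span (S' : Set (A ⧸ Ideal.span {x})))
          (by rw [hS'span]; exact (maximalIdeal.isMaximal _).ne_top)
        have h2 := Submodule.spanFinrank_span_le_ncard_of_finite (R := A ⧸ Ideal.span {x})
          (S'.finite_toSet)
        rw [Set.ncard_coe_finset] at h2
        exact_mod_cast h1.trans (by exact_mod_cast h2.trans hS'card)
      · have h1 := ringKrullDim_le_ringKrullDim_quotSMulTop_succ hxm
        have he : x • (⊤ : Ideal A) = Ideal.span {x} := by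
          rw [← Submodule.ideal_span_singleton_smul, Ideal.smul_eq_mul, Ideal.mul_top]
        rw [he, hdim, Nat.cast_add, Nat.cast_one] at h1
        exact (ENat.WithBot.add_le_add_natCast_right_iff (c := 1)).mp (by exact_mod_cast h1)
    obtain ⟨hdom, rs, hlen, hmem, hreg⟩ := ih (A ⧸ Ideal.span {x}) S' hS'card hS'span hdim'
    have hprime : (Ideal.span {x}).IsPrime := (Ideal.Quotient.isDomain_iff_prime _).mp hdom
    obtain ⟨q, hq, hqx⟩ := Ideal.exists_minimalPrimes_le (I := (⊥ : Ideal A)) (J := Ideal.span {x})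
      bot_le
    have hqp : q.IsPrime := Ideal.IsMinimalPrime.isPrime hq
    have hxq : x ∉ q := hxmin q hq
    have hqbot : q = ⊥ := by
      refine Submodule.eq_bot_of_le_smul_of_le_jacobson_bot (Ideal.span {x}) _
        q.fg_of_isNoetherianRing ?_ ((le_maximalIdeal hxtop).trans (maximalIdeal_le_jacobson _))
      intro y hy
      obtain ⟨a, rfl⟩ := Ideal.mem_span_singleton.mp (hqx hy)
      have ha : a ∈ q := (hqp.mem_or_mem hy).resolve_left hxq
      exact Ideal.mul_mem_mul (Ideal.mem_span_singleton_self x) ha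
    have hdomA : IsDomain A := by
      have : (⊥ : Ideal A).IsPrime := hqbot ▸ hqp
      exact (IsDomain.of_bot_isPrime A)
    refine ⟨hdomA, ?_⟩
    have hx0 : x ≠ 0 := fun h => hxq (h ▸ q.zero_mem)
    obtain ⟨xs, hxs, hxreg⟩ := isWeaklyRegular_cons_of_quotient
      (IsSMulRegular.of_ne_zero hx0) hreg
    refine ⟨x :: xs, ?_, ?_, hxreg⟩
    · rw [← hxs, List.length_map] at hlen
      simp [hlen]
    · intro r hr
      rcases List.mem_cons.mp hr with rfl | hr
      · exact hxm
      · have := hmem (Ideal.Quotient.mk _ r) (hxs ▸ List.mem_map_of_mem hr)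
        rw [← hmap, Ideal.mem_map_iff_of_surjective _ Ideal.Quotient.mk_surjective] at this
        obtain ⟨y, hy, hyr⟩ := this
        have h2 := Ideal.Quotient.eq.mp hyr
        have h3 : y - r ∈ maximalIdeal A := le_maximalIdeal hxtop h2
        simpa using sub_mem hy h3

theorem exists_isWeaklyRegular_of_isRegularLocalRing (A : Type u) [CommRing A]
    [IsRegularLocalRing A] : ∃ rs : List A, (rs.length : WithBot ℕ∞) = ringKrullDim A ∧
      (∀ r ∈ rs, r ∈ maximalIdeal A) ∧ IsWeaklyRegular A rs := by
  obtain ⟨S, hcard, hspan⟩ :=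
    Submodule.FG.exists_span_finset_card_eq_spanFinrank
      (maximalIdeal A).fg_of_isNoetherianRing
  have hdim := IsRegularLocalRing.spanFinrank_maximalIdeal (R := A)
  obtain ⟨-, rs, hlen, h1, h2⟩ := isDomain_and_exists_isWeaklyRegular
    (maximalIdeal A).spanFinrank A S hcard.le hspan hdim.symm
  exact ⟨rs, by rw [hlen, hdim], h1, h2⟩

end

section

open RingTheory.Sequence Pointwise

/-! ### An acyclicity lemma -/

theorem QuotSMulTop.mk_eq_zero_iff {A : Type*} [CommRing A] {M : Type*} [AddCommGroup M]
    [Module A M] {x : A} {w : M} :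
    (Submodule.Quotient.mk w : QuotSMulTop x M) = 0 ↔ ∃ z, w = x • z := by
  rw [Submodule.Quotient.mk_eq_zero, Submodule.mem_smul_pointwise_iff_exists]
  exact ⟨fun ⟨z, _, h⟩ => ⟨z, h.symm⟩, fun ⟨z, h⟩ => ⟨z, trivial, h.symm⟩⟩

/-- Let `C` be a complex and `rs` a sequence of length `N` that is weakly regular on
`C 0, …, C (N - 1)` and on the cokernel `E` of `C (N + 1) → C N`. If powers of the elements
of `rs` annihilate each homology class at the places `1, …, N`, then `C` is exact there. -/
theorem exact_of_isWeaklyRegular {A : Type u} [CommRing A] (rs : List A) :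
    ∀ {C : ℕ → Type v} [∀ i, AddCommGroup (C i)] [∀ i, Module A (C i)]
      (d : ∀ i, C (i + 1) →ₗ[A] C i) (_ : ∀ i z, d i (d (i + 1) z) = 0)
      {E : Type v} [AddCommGroup E] [Module A E] (π : C rs.length →ₗ[A] E)
      (_ : Function.Surjective π) (_ : Function.Exact (d rs.length) π)
      (_ : ∀ i < rs.length, IsWeaklyRegular (C i) rs) (_ : IsWeaklyRegular E rs)
      (_ : ∀ y ∈ rs, ∀ i < rs.length, ∀ z, d i z = 0 → ∃ (N : ℕ) (w : C (i + 2)),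
        d (i + 1) w = y ^ N • z),
      ∀ i < rs.length, Function.Exact (d (i + 1)) (d i) := by
  induction rs with
  | nil => intro C _ _ d _ E _ _ π _ _ _ _ _ i hi; simp at hi
  | cons x rs ih =>
    intro C _ _ d hd E _ _ π hπ hex hreg hE hkill
    have hreg1 : ∀ i < rs.length + 1, IsSMulRegular (C i) x := fun i hi =>
      ((isWeaklyRegular_cons_iff _ _ _).mp (hreg i hi)).1
    -- Reduction modulo `x` is combined with dropping `C 0`: the sequence gets shorter by one and
    -- the place of the cokernel moves down by one, so the hypotheses match again.
    have key := ih (C := fun i => QuotSMulTop x (C (i + 1))) (fun i => QuotSMulTop.map x (d (i + 1)))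
      (by
        intro i z
        obtain ⟨z, rfl⟩ := Submodule.Quotient.mk_surjective _ z
        change (Submodule.Quotient.mk (d (i + 1) (d (i + 2) z)) : QuotSMulTop x (C (i + 1))) = 0
        rw [hd]; rfl)
      (E := QuotSMulTop x E) (QuotSMulTop.map x π) (QuotSMulTop.map_surjective x hπ)
      (QuotSMulTop.map_exact x hex hπ)
      (fun i hi => ((isWeaklyRegular_cons_iff _ _ _).mp (hreg (i + 1) (by simpa using hi))).2)
      ((isWeaklyRegular_cons_iff _ _ _).mp hE).2
      (by
        intro y hy i hi z hz
        obtain ⟨w, rfl⟩ := Submodule.Quotient.mk_surjective _ z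
        have hz' : (Submodule.Quotient.mk (d (i + 1) w) : QuotSMulTop x (C (i + 1))) = 0 := hz
        obtain ⟨z, hz⟩ := QuotSMulTop.mk_eq_zero_iff.mp hz'
        have hdz : d i z = 0 := by
          apply hreg1 i (by omega)
          change x • d i z = x • (0 : C i)
          rw [← map_smul, ← hz, hd, smul_zero]
        obtain ⟨N, u, hu⟩ := hkill y (List.mem_cons_of_mem _ hy) i (by simp; omega) z hdz
        -- A cycle modulo `x` is corrected to a true cycle: `d w = x z` with `z` a cycle, and `y^N z
        -- = d u`, so `y^N w - x u` is a cycle congruent to `y^N w`.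
        have hc : d (i + 1) (y ^ N • w - x • u) = 0 := by
          rw [map_sub, map_smul, map_smul, hz, hu, smul_comm, sub_self]
        obtain ⟨M, v, hv⟩ := hkill y (List.mem_cons_of_mem _ hy) (i + 1) (by simp; omega) _ hc
        refine ⟨M + N, Submodule.Quotient.mk v, ?_⟩
        change (Submodule.Quotient.mk (d (i + 2) v) : QuotSMulTop x (C (i + 2))) =
          y ^ (M + N) • Submodule.Quotient.mk w
        rw [← Submodule.Quotient.mk_smul, ← sub_eq_zero, ← Submodule.Quotient.mk_sub,
          QuotSMulTop.mk_eq_zero_iff]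
        refine ⟨-(y ^ M • u), ?_⟩
        rw [hv, smul_sub, smul_smul, ← pow_add, smul_comm (y ^ M) x, smul_neg]
        abel)
    intro i hi
    -- If `x z = d w`, then `w` is a cycle modulo `x`, hence `w` is a boundary plus `x` times
    -- something, and `x` can be cancelled.
    have step : ∀ z, d i z = 0 → (∃ w, d (i + 1) w = x • z) → ∃ w, d (i + 1) w = z := by
      rintro z hz ⟨w, hw⟩
      rcases Nat.lt_or_ge i rs.length with hlt | hge
      · have h1 : (Submodule.Quotient.mk (d (i + 1) w) : QuotSMulTop x (C (i + 1))) = 0 :=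
          QuotSMulTop.mk_eq_zero_iff.mpr ⟨z, hw⟩
        obtain ⟨v, hv⟩ := (key i hlt (Submodule.Quotient.mk w)).mp h1
        obtain ⟨v, rfl⟩ := Submodule.Quotient.mk_surjective _ v
        have hv' : (Submodule.Quotient.mk (d (i + 2) v) : QuotSMulTop x (C (i + 2))) =
          Submodule.Quotient.mk w := hv
        rw [← sub_eq_zero, ← Submodule.Quotient.mk_sub, QuotSMulTop.mk_eq_zero_iff] at hv'
        obtain ⟨t, ht⟩ := hv'
        refine ⟨-t, ?_⟩
        apply hreg1 (i + 1) (by omega)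
        change x • d (i + 1) (-t) = x • z
        rw [← map_smul, smul_neg, ← ht, neg_sub, map_sub, hd, sub_zero, hw]
      -- At the last place the shifted complex says nothing; regularity of `x` on the cokernel `E`
      -- takes over.
      · obtain rfl : i = rs.length := by simp at hi; omega
        have h1 : x • π z = 0 := by
          rw [← map_smul, ← hw]; exact hex.apply_apply_eq_zero w
        have h2 : π z = 0 := by
          apply ((isWeaklyRegular_cons_iff _ _ _).mp hE).1
          simpa using h1
        exact (hex z).mp h2
    have step' : ∀ N z, d i z = 0 → (∃ w, d (i + 1) w = x ^ N • z) → ∃ w, d (i + 1) w = z := by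
      intro N
      induction N with
      | zero => intro z _ h; simpa using h
      | succ N ihN =>
        rintro z hz ⟨w, hw⟩
        refine step z hz (ihN (x • z) (by rw [map_smul, hz, smul_zero]) ⟨w, ?_⟩)
        rw [hw, pow_succ, mul_smul]
    intro z
    constructor
    · intro hz
      obtain ⟨N, w, hw⟩ := hkill x List.mem_cons_self i hi z hz
      exact step' N z hz ⟨w, hw⟩
    · rintro ⟨w, rfl⟩
      exact hd i w

end

/-! ### Minors and ranks -/

section

variable {A : Type*} [CommRing A] {p q : Type*}

theorem det_mem_minorsIdeal (N : Matrix p q A) {t : ℕ} (u : Fin t → p) (v : Fin t → q) :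
    (N.submatrix u v).det ∈ minorsIdeal N t :=
  Ideal.subset_span ⟨u, v, rfl⟩

theorem minorsIdeal_eq_bot_iff (N : Matrix p q A) {t : ℕ} :
    minorsIdeal N t = ⊥ ↔ ∀ (u : Fin t → p) (v : Fin t → q), (N.submatrix u v).det = 0 := by
  rw [minorsIdeal, Ideal.span_eq_bot]
  exact ⟨fun h u v => h _ ⟨u, v, rfl⟩, by rintro h _ ⟨u, v, rfl⟩; exact h u v⟩

theorem minorsIdeal_eq_bot_of_card_lt [Fintype p] (N : Matrix p q A) {t : ℕ}
    (ht : Fintype.card p < t) : minorsIdeal N t = ⊥ := by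
  rw [minorsIdeal_eq_bot_iff]
  intro u v
  obtain ⟨i, j, hij, h⟩ := Fintype.exists_ne_map_eq_of_card_lt u (by simpa using ht)
  exact Matrix.det_zero_of_row_eq hij (by ext k; simp [h])

theorem bddAbove_minorsIdeal_ne_bot [Fintype p] (N : Matrix p q A) :
    BddAbove {t | minorsIdeal N t ≠ ⊥} :=
  ⟨Fintype.card p, fun t ht => by
    by_contra! h
    exact ht (minorsIdeal_eq_bot_of_card_lt N h)⟩

theorem minor_eq_zero_of_detRank_lt [Fintype p] (N : Matrix p q A) {t : ℕ} (ht : detRank N < t)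
    (u : Fin t → p) (v : Fin t → q) : (N.submatrix u v).det = 0 := by
  refine (minorsIdeal_eq_bot_iff N).mp ?_ u v
  by_contra h
  exact absurd (le_csSup (bddAbove_minorsIdeal_ne_bot N) h) (not_le.mpr ht)

theorem minorsIdeal_zero (N : Matrix p q A) : minorsIdeal N 0 = ⊤ := by
  rw [Ideal.eq_top_iff_one]
  have := det_mem_minorsIdeal N (t := 0) (fun i => i.elim0) (fun i => i.elim0)
  simpa using this

theorem exists_minor_ne_zero [Nontrivial A] [Fintype p] (N : Matrix p q A) :
    ∃ (u : Fin (detRank N) → p) (v : Fin (detRank N) → q), (N.submatrix u v).det ≠ 0 := by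
  have h : detRank N ∈ {t | minorsIdeal N t ≠ ⊥} :=
    Nat.sSup_mem ⟨0, by simp [minorsIdeal_zero]⟩ (bddAbove_minorsIdeal_ne_bot N)
  have h' : minorsIdeal N (detRank N) ≠ ⊥ := h
  rw [Ne, minorsIdeal_eq_bot_iff] at h'
  push Not at h'
  exact h'

theorem detRank_eq_zero_of_isEmpty [Nontrivial A] [Fintype p] [IsEmpty q] (N : Matrix p q A) :
    detRank N = 0 := by
  obtain ⟨-, v, -⟩ := exists_minor_ne_zero N
  by_contra h
  exact isEmptyElim (v ⟨0, Nat.pos_of_ne_zero h⟩)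

theorem injective_of_det_submatrix_ne_zero {N : Matrix p q A} {t : ℕ} {u : Fin t → p}
    {v : Fin t → q} (h : (N.submatrix u v).det ≠ 0) : Function.Injective u := by
  intro i j hij
  by_contra hne
  exact h (Matrix.det_zero_of_row_eq hne (by ext k; simp [hij]))

variable [Fintype q]

/-- Multilinear expansion along the columns of the product leaves a combination of minors of `N`. -/
theorem det_submatrix_mul_eq_zero {t : ℕ} {m : Type*} [Fintype m] [DecidableEq m]
    (hm : Fintype.card m = t) {N : Matrix p q A}
    (hN : ∀ (u : Fin t → p) (v : Fin t → q), (N.submatrix u v).det = 0) (u : m → p)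
    (Y : Matrix q m A) : (N.submatrix u id * Y).det = 0 := by
  let e := Fintype.equivFinOfCardEq hm
  have h0 : ∀ v : m → q, (N.submatrix u v).det = 0 := by
    intro v
    rw [← Matrix.det_submatrix_equiv_self e.symm, Matrix.submatrix_submatrix]
    exact hN _ _
  rw [← Matrix.det_transpose]
  have h1 : ((N.submatrix u id * Y)ᵀ : Matrix m m A) =
      fun i => ∑ j : q, Y j i • (fun k => N (u k) j) := by
    ext i k
    simp [Matrix.mul_apply, mul_comm]
  have h2 := (Matrix.detRowAlternating (R := A) (n := m)).toMultilinearMap.map_sum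
    (fun i (j : q) => Y j i • (fun k => N (u k) j))
  rw [h1]
  refine h2.trans (Finset.sum_eq_zero fun r _ => ?_)
  have h3 := (Matrix.detRowAlternating (R := A) (n := m)).toMultilinearMap.map_smul_univ
    (fun i => Y (r i) i) (fun i k => N (u k) (r i))
  refine h3.trans ?_
  have h4 : (Matrix.detRowAlternating (R := A) (n := m)).toMultilinearMap
      (fun i k => N (u k) (r i)) = (N.submatrix u r)ᵀ.det := rfl
  rw [h4, Matrix.det_transpose, h0, smul_zero]

/-- If all minors of size `r + 1` vanish, a vector in the image whose coordinates in the rows of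
an `r × r` minor vanish is annihilated by that minor. -/
theorem det_smul_mulVec_eq_zero {r : ℕ} {N : Matrix p q A}
    (hN : ∀ (u : Fin (r + 1) → p) (v : Fin (r + 1) → q), (N.submatrix u v).det = 0)
    (u : Fin r → p) (v : Fin r → q) {y : q → A} (hy : ∀ i, (N.mulVec y) (u i) = 0) :
    (N.submatrix u v).det • N.mulVec y = 0 := by
  classical
  ext k
  -- The columns of `Y` are the unit vectors at `v` and the vector `y`, so `N Y` in the rows `u, k`
  -- is block triangular. Its determinant is the minor times the coordinate `k` of `N y`, and it is
  -- a combination of minors of size `r + 1`.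
  let Y : Matrix q (Fin r ⊕ Unit) A :=
    Matrix.of fun j => Sum.elim (fun i => if j = v i then 1 else 0) fun _ => y j
  let w : Fin r ⊕ Unit → p := Sum.elim u fun _ => k
  have h := det_submatrix_mul_eq_zero (m := Fin r ⊕ Unit) (by simp) hN w Y
  have h1 : N.submatrix w id * Y =
      Matrix.fromBlocks (N.submatrix u v) 0 (Matrix.of fun _ i => N k (v i))
        (Matrix.of fun _ _ => N.mulVec y k) := by
    ext i j
    rcases i with i | i <;> rcases j with j | j
    · simp [Matrix.mul_apply, w, Y]
    · simpa [Matrix.mul_apply, Matrix.mulVec, dotProduct, w, Y] using hy i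
    · simp [Matrix.mul_apply, w, Y]
    · simp [Matrix.mul_apply, Matrix.mulVec, dotProduct, w, Y]
  rw [h1, Matrix.det_fromBlocks_zero₁₂] at h
  simpa [Matrix.det_unique] using h

/-- The combination of columns `v` of `N` with coefficients from Cramer's rule for the rows `u`. -/
theorem mulVec_sum_single_cramer [DecidableEq q] {r : ℕ} (N : Matrix p q A)
    (u : Fin r → p) (v : Fin r → q) (x : p → A) (i : Fin r) :
    (N.mulVec (∑ j, (N.submatrix u v).cramer (x ∘ u) j • Pi.single (v j) 1)) (u i) =
      (N.submatrix u v).det * x (u i) := by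
  have h := congrFun (Matrix.mulVec_cramer (N.submatrix u v) (x ∘ u)) i
  simp only [Pi.smul_apply, Function.comp_apply, smul_eq_mul] at h
  rw [← h]
  rw [Matrix.mulVec_sum, Finset.sum_apply, Matrix.mulVec, dotProduct]
  refine Finset.sum_congr rfl fun j _ => ?_
  rw [Matrix.mulVec_smul, Matrix.mulVec_single_one]
  simp [mul_comm]

/-- A unit minor of maximal size makes the cokernel free. -/
theorem exists_exact_of_isUnit_minor [Nontrivial A] {r : ℕ} {N : Matrix p q A} [DecidableEq q]
    (hN : ∀ (u : Fin (r + 1) → p) (v : Fin (r + 1) → q), (N.submatrix u v).det = 0)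
    {u : Fin r → p} {v : Fin r → q} (h : IsUnit (N.submatrix u v).det) :
    ∃ π : (p → A) →ₗ[A] ({k // k ∉ Set.range u} → A), Function.Surjective π ∧
      Function.Exact N.mulVecLin π := by
  classical
  set U := N.submatrix u v with hU
  set c := U.det with hc
  have hu : Function.Injective u := injective_of_det_submatrix_ne_zero h.ne_zero
  let s : (p → A) →ₗ[A] (q → A) :=
    { toFun := fun x => ∑ j, U.cramer (x ∘ u) j • Pi.single (v j) 1
      map_add' := fun x y => by
        rw [show (x + y) ∘ u = x ∘ u + y ∘ u from rfl, map_add, ← Finset.sum_add_distrib]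
        exact Finset.sum_congr rfl fun j _ => by rw [Pi.add_apply, add_smul]
      map_smul' := fun a x => by
        rw [show (a • x) ∘ u = a • (x ∘ u) from rfl, map_smul, RingHom.id_apply, Finset.smul_sum]
        exact Finset.sum_congr rfl fun j _ => by rw [Pi.smul_apply, smul_smul, smul_eq_mul] }
  have hs : ∀ x i, (N.mulVec (s x)) (u i) = c * x (u i) :=
    fun x i => mulVec_sum_single_cramer N u v x i
  -- By Cramer's rule `N (s x)` agrees with `c x` in the rows `u`. So `c x - N (s x)` lives in the
  -- other rows, and its vanishing means `x` is in the image, `c` being a unit.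
  let π : (p → A) →ₗ[A] ({k // k ∉ Set.range u} → A) :=
    (LinearMap.funLeft A A Subtype.val) ∘ₗ (c • LinearMap.id - N.mulVecLin ∘ₗ s)
  refine ⟨π, ?_, ?_⟩
  · intro z
    obtain ⟨c', hc'⟩ := h.exists_right_inv
    let x : p → A := fun k => if hk : k ∉ Set.range u then c' * z ⟨k, hk⟩ else 0
    have hxu : x ∘ u = 0 := by ext i; simp [x]
    have hsx : s x = 0 := by
      change ∑ j, U.cramer (x ∘ u) j • Pi.single (v j) 1 = (0 : q → A)
      rw [hxu, map_zero]; simp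
    refine ⟨x, ?_⟩
    ext ⟨k, hk⟩
    simp only [π, LinearMap.comp_apply, LinearMap.sub_apply, hsx, map_zero, sub_zero,
      LinearMap.smul_apply, LinearMap.id_apply, LinearMap.funLeft_apply, Pi.smul_apply, smul_eq_mul]
    simp only [x, hk, not_false_eq_true, dif_pos]
    rw [← mul_assoc, hc', one_mul]
  · intro x
    constructor
    · intro hx
      have hx' : c • x - N.mulVec (s x) = 0 := by
        ext k
        by_cases hk : k ∈ Set.range u
        · obtain ⟨i, rfl⟩ := hk
          simp [hs]
        · exact congrFun hx ⟨k, hk⟩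
      obtain ⟨c', hc'⟩ := h.exists_left_inv
      refine ⟨c' • s x, ?_⟩
      rw [map_smul, Matrix.mulVecLin_apply, ← sub_eq_zero.mp hx', smul_smul, hc', one_smul]
    · rintro ⟨y, rfl⟩
      have h1 := det_smul_mulVec_eq_zero hN u v (y := c • y - s (N.mulVec y)) (fun i => by
        rw [Matrix.mulVec_sub, Matrix.mulVec_smul, Pi.sub_apply, hs]; simp)
      have h2 : N.mulVec (c • y - s (N.mulVec y)) = 0 := (h.smul_eq_zero).mp h1
      rw [Matrix.mulVec_sub, Matrix.mulVec_smul] at h2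
      ext ⟨k, hk⟩
      exact congrFun h2 k

/-- Multiplication by a nonzero maximal minor embeds the image of `N` into the span of the columns
of that minor. -/
theorem detRank_eq_rank [IsDomain A] [Fintype p] (N : Matrix p q A) : detRank N = N.rank := by
  classical
  obtain ⟨u, v, h⟩ := exists_minor_ne_zero N
  apply le_antisymm
  · have h1 := Matrix.rank_of_det_ne_zero h
    rw [Fintype.card_fin] at h1
    exact h1 ▸ Matrix.rank_submatrix_le N u v
  · let c := (N.submatrix u v).det
    let W : Submodule A (p → A) := Submodule.span A (Set.range fun j => N.mulVec (Pi.single (v j) 1))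
    have hW : ∀ x ∈ LinearMap.range N.mulVecLin, c • x ∈ W := by
      rintro _ ⟨y, rfl⟩
      have h1 := det_smul_mulVec_eq_zero (fun u v => minor_eq_zero_of_detRank_lt N
        (Nat.lt_succ_self _) u v) u v
        (y := c • y - ∑ j, (N.submatrix u v).cramer (N.mulVec y ∘ u) j • Pi.single (v j) 1)
        (fun i => by
          rw [Matrix.mulVec_sub, Matrix.mulVec_smul, Pi.sub_apply, mulVec_sum_single_cramer]; simp [c])
      have h2 := (smul_eq_zero_iff_right h).mp h1
      rw [Matrix.mulVec_sub, Matrix.mulVec_smul, sub_eq_zero] at h2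
      rw [Matrix.mulVecLin_apply, h2, Matrix.mulVec_sum]
      refine Submodule.sum_mem _ fun j _ => ?_
      rw [Matrix.mulVec_smul]
      exact Submodule.smul_mem _ _ (Submodule.subset_span ⟨j, rfl⟩)
    let f : LinearMap.range N.mulVecLin →ₗ[A] W :=
      ((LinearMap.lsmul A (p → A) c) ∘ₗ (LinearMap.range N.mulVecLin).subtype).codRestrict W
        (fun x => hW x x.2)
    have hf : Function.Injective f := by
      intro x y hxy
      have h1 : c • (x : p → A) = c • (y : p → A) := congrArg Subtype.val hxy
      exact Subtype.ext (smul_right_injective _ h h1)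
    have : Module.Finite A W := Module.Finite.span_of_finite A (Set.finite_range _)
    have h1 := LinearMap.finrank_le_finrank_of_injective hf
    have h2 : Module.finrank A W ≤ detRank N := by
      have := finrank_range_le_card (R := A) (fun j => N.mulVec (Pi.single (v j) 1))
      rwa [Fintype.card_fin] at this
    exact h1.trans h2

/-- A presentation matrix split by `σ` and `β` has the expected rank. -/
theorem rank_add_card_of_split [IsDomain A] [Fintype p] [DecidableEq p] {Z : Type*} [Fintype Z]
    [DecidableEq Z] {N : Matrix p q A} {π : Matrix Z p A} {σ : Matrix p Z A} {β : Matrix q p A}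
    (h1 : σ * π + N * β = 1) (h2 : π * σ = 1) (h3 : π * N = 0) :
    N.rank + Fintype.card Z = Fintype.card p := by
  have hker : LinearMap.ker π.mulVecLin = LinearMap.range N.mulVecLin := by
    ext x
    rw [LinearMap.mem_ker, Matrix.mulVecLin_apply]
    constructor
    · intro hx
      refine ⟨β.mulVec x, ?_⟩
      have := congrArg (fun M => Matrix.mulVec M x) h1
      simpa [Matrix.add_mulVec, ← Matrix.mulVec_mulVec, hx] using this
    · rintro ⟨y, rfl⟩
      rw [Matrix.mulVecLin_apply, Matrix.mulVec_mulVec, h3, Matrix.zero_mulVec]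
  have hrange : LinearMap.range π.mulVecLin = ⊤ := by
    rw [LinearMap.range_eq_top]
    intro z
    exact ⟨σ.mulVec z, by rw [Matrix.mulVecLin_apply, Matrix.mulVec_mulVec, h2, Matrix.one_mulVec]⟩
  have := (LinearMap.ker π.mulVecLin).finrank_quotient_add_finrank
  rw [π.mulVecLin.quotKerEquivRange.finrank_eq, hker, hrange, finrank_top, Module.finrank_fintype_fun_eq_card,
    Module.finrank_fintype_fun_eq_card] at this
  rw [Matrix.rank]; omega

/-- Over a local domain, a matrix with free cokernel has a unit minor of maximal size. -/
theorem exists_isUnit_minor_of_free [IsDomain A] [IsLocalRing A] [Fintype p] (N : Matrix p q A)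
    [Module.Free A ((p → A) ⧸ LinearMap.range N.mulVecLin)] :
    ∃ (u : Fin (detRank N) → p) (v : Fin (detRank N) → q), IsUnit (N.submatrix u v).det := by
  classical
  let b := Module.Free.chooseBasis A ((p → A) ⧸ LinearMap.range N.mulVecLin)
  let Z := Module.Free.ChooseBasisIndex A ((p → A) ⧸ LinearMap.range N.mulVecLin)
  let π' : (p → A) →ₗ[A] (Z → A) := b.equivFun.toLinearMap ∘ₗ (LinearMap.range N.mulVecLin).mkQ
  have hπ' : Function.Surjective π' := b.equivFun.surjective.comp (Submodule.mkQ_surjective _)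
  have hker : ∀ x, π' x = 0 ↔ ∃ y, N.mulVec y = x := by
    intro x
    simp only [π', LinearMap.comp_apply, LinearEquiv.coe_coe, LinearEquiv.map_eq_zero_iff,
      Submodule.mkQ_apply, Submodule.Quotient.mk_eq_zero, LinearMap.mem_range,
      Matrix.mulVecLin_apply]
  obtain ⟨σ', hσ'⟩ := Module.projective_lifting_property π' LinearMap.id hπ'
  have hβ : ∀ k : p, ∃ y, N.mulVec y = Pi.single k 1 - σ' (π' (Pi.single k 1)) := by
    intro k
    rw [← hker, map_sub, sub_eq_zero]
    exact (LinearMap.congr_fun hσ' (π' (Pi.single k 1))).symm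
  choose β' hβ' using hβ
  let π := LinearMap.toMatrix' π'
  let σ := LinearMap.toMatrix' σ'
  let β : Matrix q p A := Matrix.of fun j k => β' k j
  have h1 : σ * π + N * β = 1 := by
    apply Matrix.toLin'.injective
    refine LinearMap.pi_ext' fun k => LinearMap.ext_ring ?_
    have hβk : β.mulVec (Pi.single k 1) = β' k := by ext j; simp [β]
    simp [σ, π, Matrix.toLin'_mul, hβk, hβ']
  have h2 : π * σ = 1 := by
    rw [← LinearMap.toMatrix'_comp, hσ', LinearMap.toMatrix'_id]
  have h3 : π * N = 0 := by
    apply Matrix.toLin'.injective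
    refine LinearMap.ext fun y => ?_
    have := (hker (N.mulVec y)).mpr ⟨y, rfl⟩
    simpa [π, Matrix.toLin'_mul] using this
  -- The splitting identities survive reduction to the residue field, so `N` has the same rank
  -- there. A maximal minor that is nonzero in the residue field is a unit.
  let f := IsLocalRing.residue A
  have h1' : σ.map f * π.map f + N.map f * β.map f = 1 := by
    rw [← Matrix.map_mul, ← Matrix.map_mul, ← Matrix.map_add f (map_add f), h1]; simp
  have h2' : π.map f * σ.map f = 1 := by rw [← Matrix.map_mul, h2]; simp
  have h3' : π.map f * N.map f = 0 := by rw [← Matrix.map_mul, h3]; simp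
  have e1 := rank_add_card_of_split h1 h2 h3
  have e2 := rank_add_card_of_split h1' h2' h3'
  have e3 : detRank (N.map f) = detRank N := by
    rw [detRank_eq_rank, detRank_eq_rank]; omega
  obtain ⟨u, v, h⟩ : ∃ (u : Fin (detRank N) → p) (v : Fin (detRank N) → q),
      ((N.map f).submatrix u v).det ≠ 0 := e3 ▸ exists_minor_ne_zero (N.map f)
  refine ⟨u, v, ?_⟩
  rw [Matrix.submatrix_map, ← RingHom.mapMatrix_apply, ← RingHom.map_det] at h
  exact (IsLocalRing.residue_ne_zero_iff_isUnit _).mp h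

theorem detRank_add_detRank_of_exact [IsDomain A] [Fintype p] {o : Type*} [Fintype o]
    {N : Matrix p q A} {N' : Matrix q o A} (h : Function.Exact N'.mulVecLin N.mulVecLin) :
    detRank N' + detRank N = Fintype.card q := by
  have := (LinearMap.ker N.mulVecLin).finrank_quotient_add_finrank
  rw [N.mulVecLin.quotKerEquivRange.finrank_eq, LinearMap.exact_iff.mp h,
    Module.finrank_fintype_fun_eq_card] at this
  rw [detRank_eq_rank, detRank_eq_rank, Matrix.rank, Matrix.rank, ← this, add_comm]

theorem detRank_add_finrank_quotient_range [IsDomain A] [Fintype p] (N : Matrix p q A) :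
    detRank N + Module.finrank A ((p → A) ⧸ LinearMap.range N.mulVecLin) = Fintype.card p := by
  have := (LinearMap.range N.mulVecLin).finrank_quotient_add_finrank
  rw [Module.finrank_fintype_fun_eq_card] at this
  rw [detRank_eq_rank, Matrix.rank, ← this, add_comm]

end

/-! ### Minors and exactness under ring maps and localization -/

section

variable {A B : Type*} [CommRing A] [CommRing B] {p q o : Type*}

theorem detRank_map_of_injective (N : Matrix p q A) {f : A →+* B} (hf : Function.Injective f) :
    detRank (N.map f) = detRank N := by
  have : ∀ t, minorsIdeal (N.map f) t = ⊥ ↔ minorsIdeal N t = ⊥ := by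
    intro t
    rw [minorsIdeal_eq_bot_iff, minorsIdeal_eq_bot_iff]
    refine forall_congr' fun u => forall_congr' fun v => ?_
    rw [Matrix.submatrix_map, ← RingHom.mapMatrix_apply, ← RingHom.map_det, map_eq_zero_iff f hf]
  simp only [detRank, ne_eq, this]

theorem mulVec_map_comp [Fintype q] (N : Matrix p q A) (f : A →+* B) (x : q → A) :
    (N.map f).mulVec (f ∘ x) = f ∘ N.mulVec x := by
  ext i
  exact (RingHom.map_mulVec f N x i).symm

variable [Algebra A B]

/-- Clearing denominators of a vector. -/
theorem exists_smul_eq_algebraMap_comp [Finite q] (M : Submonoid A) [IsLocalization M B]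
    (y : q → B) : ∃ (s : M) (x : q → A), algebraMap A B s • y = algebraMap A B ∘ x := by
  obtain ⟨s, hs⟩ := IsLocalization.exist_integer_multiples_of_finite M y
  choose x hx using hs
  exact ⟨s, x, funext fun i => by simp [hx, Algebra.smul_def]⟩

theorem exact_mulVecLin_map [Fintype q] [Fintype o] {N : Matrix p q A} {N' : Matrix q o A}
    (h : Function.Exact N'.mulVecLin N.mulVecLin) (M : Submonoid A) [IsLocalization M B]
    (hinj : Function.Injective (algebraMap A B)) :
    Function.Exact (N'.map (algebraMap A B)).mulVecLin (N.map (algebraMap A B)).mulVecLin := by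
  classical
  intro y
  simp only [Matrix.mulVecLin_apply, Set.mem_range]
  constructor
  · intro hy
    obtain ⟨s, x, hx⟩ := exists_smul_eq_algebraMap_comp M y
    have h1 : N.mulVec x = 0 := by
      have h2 : algebraMap A B ∘ N.mulVec x = 0 := by
        rw [← mulVec_map_comp, ← hx, Matrix.mulVec_smul, hy, smul_zero]
      exact funext fun i => hinj (by simpa using congrFun h2 i)
    obtain ⟨w, hw⟩ := (h x).mp h1
    obtain ⟨c, hc⟩ := (IsLocalization.map_units B s).exists_left_inv
    refine ⟨c • algebraMap A B ∘ w, ?_⟩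
    rw [Matrix.mulVec_smul, mulVec_map_comp, ← Matrix.mulVecLin_apply, hw, ← hx, smul_smul, hc,
      one_smul]
  · rintro ⟨z, rfl⟩
    obtain ⟨s, x, hx⟩ := exists_smul_eq_algebraMap_comp M z
    refine ((IsLocalization.map_units B s).smul_eq_zero).mp ?_
    rw [← Matrix.mulVec_smul, ← Matrix.mulVec_smul, hx, mulVec_map_comp, mulVec_map_comp]
    have := (h (N'.mulVec x)).mpr ⟨x, rfl⟩
    rw [Matrix.mulVecLin_apply] at this
    rw [this]
    ext i
    simp

end

/-! ### The Koszul complex -/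

/-- The sign with which `e_j` enters `e_J`. -/
def koszulSign {n : ℕ} (J : Finset (Fin n)) (j : Fin n) : ℤ := (-1) ^ (J.filter (· < j)).card

theorem koszulSign_mul_self {n : ℕ} (J : Finset (Fin n)) (j : Fin n) :
    koszulSign J j * koszulSign J j = 1 := by
  rw [koszulSign, ← pow_add, ← two_mul, pow_mul]; simp

theorem koszulSign_insert_self {n : ℕ} (J : Finset (Fin n)) (j : Fin n) :
    koszulSign (insert j J) j = koszulSign J j := by
  rw [koszulSign, Finset.filter_insert, if_neg (lt_irrefl _), koszulSign]

theorem koszulSign_insert {n : ℕ} {J : Finset (Fin n)} {i : Fin n} (hi : i ∉ J) (j : Fin n) :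
    koszulSign (insert i J) j = (if i < j then -1 else 1) * koszulSign J j := by
  rw [koszulSign, Finset.filter_insert]
  split_ifs with h
  · rw [Finset.card_insert_of_notMem (by simp [hi]), pow_succ', koszulSign]
  · rw [one_mul, koszulSign]

theorem koszulSign_mul_insert {n : ℕ} {J : Finset (Fin n)} {i j : Fin n} (hi : i ∉ J) (hj : j ∉ J)
    (hij : i ≠ j) :
    koszulSign J j * koszulSign (insert j J) i = -(koszulSign J i * koszulSign (insert i J) j) := by
  rw [koszulSign_insert hi, koszulSign_insert hj]
  rcases lt_or_gt_of_ne hij with h | h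
  · rw [if_pos h, if_neg h.not_gt]; ring
  · rw [if_neg h.not_gt, if_pos h]; ring

section

variable {B : Type*} [CommRing B] {n : ℕ}

/-- The total Koszul differential of a family `l`, on the exterior algebra with basis the
subsets of `Fin n`. -/
def koszulD (l : Fin n → B) : (Finset (Fin n) → B) →ₗ[B] (Finset (Fin n) → B) :=
  LinearMap.pi fun J => ∑ j, if j ∈ J then 0 else
    ((koszulSign J j : B) * l j) • LinearMap.proj (insert j J)

theorem koszulD_apply (l : Fin n → B) (b : Finset (Fin n) → B) (J : Finset (Fin n)) :
    koszulD l b J = ∑ j, if j ∈ J then 0 else (koszulSign J j : B) * l j * b (insert j J) := by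
  simp only [koszulD, LinearMap.pi_apply, LinearMap.sum_apply]
  exact Finset.sum_congr rfl fun j _ => by split_ifs <;> simp

/-- The terms removing `j` and then `i` cancel those removing `i` and then `j`, by
`koszulSign_mul_insert`. -/
theorem koszulD_koszulD (l : Fin n → B) (b : Finset (Fin n) → B) :
    koszulD l (koszulD l b) = 0 := by
  ext J
  have h : koszulD l (koszulD l b) J = ∑ x : Fin n × Fin n,
      if x.1 ∈ J ∨ x.2 ∈ insert x.1 J then 0 else
        ((koszulSign J x.1 * koszulSign (insert x.1 J) x.2 : ℤ) : B) * l x.1 * l x.2 *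
          b (insert x.2 (insert x.1 J)) := by
    rw [Fintype.sum_prod_type, koszulD_apply]
    refine Finset.sum_congr rfl fun j _ => ?_
    by_cases hj : j ∈ J
    · simp [hj]
    · rw [if_neg hj, koszulD_apply, Finset.mul_sum]
      refine Finset.sum_congr rfl fun i _ => ?_
      simp only [hj, false_or]
      split_ifs
      · simp
      · push_cast; ring
  rw [h]
  refine Finset.sum_involution (fun x _ => x.swap) ?_ ?_ (fun _ _ => Finset.mem_univ _)
    (fun _ _ => Prod.swap_swap _)
  · rintro ⟨j, i⟩ -
    simp only [Prod.fst_swap, Prod.snd_swap, Finset.mem_insert]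
    by_cases hc : j ∈ J ∨ i = j ∨ i ∈ J
    · rw [if_pos hc, if_pos (by tauto), add_zero]
    · rw [if_neg hc, if_neg (by tauto)]
      push Not at hc
      rw [koszulSign_mul_insert hc.2.2 hc.1 hc.2.1, Finset.insert_comm i j J]
      push_cast; ring
  · rintro ⟨j, i⟩ - hne heq
    simp only [Prod.swap_prod_mk, Prod.mk.injEq] at heq
    exact hne (if_pos (by simp [heq.1]))

/-- Exterior multiplication by the `i`-th basis vector. -/
def koszulH (i : Fin n) (b : Finset (Fin n) → B) : Finset (Fin n) → B :=
  fun J => if i ∈ J then (koszulSign J i : B) * b (J.erase i) else 0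

/-- Contraction with `l` is an antiderivation, so exterior multiplication by `e_i` is a homotopy
from multiplication by `l i` to zero. Hence the ideal of the `l i` annihilates Koszul homology. -/
theorem koszulD_koszulH (l : Fin n → B) (i : Fin n) (b : Finset (Fin n) → B) :
    koszulD l (koszulH i b) + koszulH i (koszulD l b) = l i • b := by
  ext J
  rw [Pi.add_apply, Pi.smul_apply, smul_eq_mul, koszulD_apply]
  by_cases hi : i ∈ J
  · obtain ⟨J, hJ, rfl⟩ : ∃ J', i ∉ J' ∧ insert i J' = J :=
      ⟨J.erase i, Finset.notMem_erase _ _, Finset.insert_erase hi⟩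
    rw [koszulH, if_pos hi, Finset.erase_insert hJ, koszulD_apply, Finset.mul_sum,
      ← Finset.sum_add_distrib, Finset.sum_eq_single i]
    · rw [if_pos (Finset.mem_insert_self _ _), if_neg hJ, koszulSign_insert_self, zero_add,
        ← mul_assoc, ← mul_assoc, ← Int.cast_mul, koszulSign_mul_self, Int.cast_one, one_mul]
    · intro j _ hj
      by_cases hjJ : j ∈ J
      · simp [hjJ]
      · rw [if_neg (by simp [hj, hjJ]), if_neg hjJ, koszulH, if_pos (by simp),
          Finset.insert_comm, Finset.erase_insert (by simp [hJ, hj.symm]), koszulSign_insert_self, koszulSign_insert_self]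
        have h2 : (koszulSign (insert i J) j : B) * koszulSign (insert j J) i =
            -(koszulSign J i * koszulSign J j) := by
          have : koszulSign (insert i J) j * koszulSign (insert j J) i =
              -(koszulSign J i * koszulSign J j) := by
            rw [koszulSign_insert hJ, koszulSign_insert hjJ]
            rcases lt_or_gt_of_ne hj with h | h
            · rw [if_neg h.not_gt, if_pos h]; ring
            · rw [if_pos h, if_neg h.not_gt]; ring
          exact_mod_cast congrArg (Int.cast : ℤ → B) this
        linear_combination (l j * b (insert j J)) * h2
    · simp
  · rw [koszulH, if_neg hi, add_zero, Finset.sum_eq_single i]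
    · rw [if_neg hi, koszulH, if_pos (Finset.mem_insert_self _ _), Finset.erase_insert hi,
        koszulSign_insert_self]
      have : (koszulSign J i : B) * koszulSign J i = 1 := by
        exact_mod_cast congrArg (Int.cast : ℤ → B) (koszulSign_mul_self J i)
      linear_combination (l i * b J) * this
    · intro j _ hj
      split_ifs with hjJ
      · rfl
      · rw [koszulH, if_neg (by simp [hi, hj.symm]), mul_zero]
    · simp

theorem exists_koszulD_eq_smul (l : Fin n → B) {y : B} (hy : y ∈ Ideal.span (Set.range l))
    {b : Finset (Fin n) → B} (hb : koszulD l b = 0) : ∃ c, koszulD l c = y • b := by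
  induction hy using Submodule.span_induction with
  | mem y hy =>
    obtain ⟨i, rfl⟩ := hy
    refine ⟨koszulH i b, ?_⟩
    have h := koszulD_koszulH l i b
    rw [hb] at h
    rw [← h, left_eq_add]
    ext J
    simp [koszulH]
  | zero => exact ⟨0, by simp⟩
  | add y z _ _ hy hz =>
    obtain ⟨c, hc⟩ := hy
    obtain ⟨c', hc'⟩ := hz
    exact ⟨c + c', by rw [map_add, hc, hc', add_smul]⟩
  | smul r y _ hy =>
    obtain ⟨c, hc⟩ := hy
    exact ⟨r • c, by rw [map_smul, hc, smul_eq_mul, mul_smul]⟩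

/-- The subsets of size `t`. -/
abbrev SubsetOfCard (n t : ℕ) : Type := {J : Finset (Fin n) // J.card = t}

/-- Extension by zero from subsets of size `t`. -/
def extendByZero (B : Type*) [CommRing B] (n t : ℕ) :
    (SubsetOfCard n t → B) →ₗ[B] (Finset (Fin n) → B) :=
  LinearMap.pi fun J => if h : J.card = t then LinearMap.proj ⟨J, h⟩ else 0

theorem extendByZero_apply_mk {t : ℕ} (b : SubsetOfCard n t → B) (J : SubsetOfCard n t) :
    extendByZero B n t b J = b J := by
  simp [extendByZero, J.2]

theorem extendByZero_apply_of_ne {t : ℕ} (b : SubsetOfCard n t → B) {J : Finset (Fin n)}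
    (h : J.card ≠ t) : extendByZero B n t b J = 0 := by
  simp [extendByZero, h]

theorem extendByZero_restrict {t : ℕ} {b : Finset (Fin n) → B}
    (hb : ∀ J : Finset (Fin n), J.card ≠ t → b J = 0) :
    extendByZero B n t (fun J => b J) = b := by
  ext J
  by_cases h : J.card = t
  · exact extendByZero_apply_mk _ ⟨J, h⟩
  · rw [extendByZero_apply_of_ne _ h, hb J h]

theorem koszulD_apply_eq_zero {t : ℕ} (l : Fin n → B) {b : Finset (Fin n) → B}
    (hb : ∀ J : Finset (Fin n), J.card ≠ t + 1 → b J = 0) (J : Finset (Fin n)) (hJ : J.card ≠ t) :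
    koszulD l b J = 0 := by
  rw [koszulD_apply]
  refine Finset.sum_eq_zero fun j _ => ?_
  split_ifs with h
  · rfl
  · rw [hb _ (by rw [Finset.card_insert_of_notMem h]; omega), mul_zero]

/-- The degree `t` part of the Koszul differential. -/
def koszulDPart (l : Fin n → B) (t : ℕ) :
    (SubsetOfCard n (t + 1) → B) →ₗ[B] (SubsetOfCard n t → B) :=
  LinearMap.funLeft B B Subtype.val ∘ₗ koszulD l ∘ₗ extendByZero B n (t + 1)

theorem extendByZero_koszulDPart (l : Fin n → B) (t : ℕ) (b : SubsetOfCard n (t + 1) → B) :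
    extendByZero B n t (koszulDPart l t b) = koszulD l (extendByZero B n (t + 1) b) :=
  extendByZero_restrict (koszulD_apply_eq_zero l fun _ h => extendByZero_apply_of_ne b h)

theorem extendByZero_injective (t : ℕ) : Function.Injective (extendByZero B n t) := by
  intro b c h
  ext J
  rw [← extendByZero_apply_mk b, h, extendByZero_apply_mk]

/-- The acyclicity lemma applied to the graded pieces, with homology killed already by first powers.
The piece of degree `n + 1` is zero, so the piece of degree `n` is its own cokernel and the
projection to it is the identity. -/
theorem exists_koszulD_eq_of_isWeaklyRegular (l : Fin n → B) {rs : List B}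
    (hlen : rs.length = n) (hrs : RingTheory.Sequence.IsWeaklyRegular B rs)
    (hmem : ∀ y ∈ rs, y ∈ Ideal.span (Set.range l)) {t : ℕ} {b : Finset (Fin n) → B}
    (hb : ∀ J : Finset (Fin n), J.card ≠ t + 1 → b J = 0) (hz : koszulD l b = 0) :
    ∃ c, koszulD l c = b := by
  rcases lt_or_ge t n with ht | ht
  · have hsub : Subsingleton (SubsetOfCard n (rs.length + 1) → B) := by
      have : IsEmpty (SubsetOfCard n (rs.length + 1)) := ⟨fun J => by
        have := J.1.card_le_univ
        rw [J.2, Fintype.card_fin] at this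
        omega⟩
      infer_instance
    have key := exact_of_isWeaklyRegular rs (C := fun t => SubsetOfCard n t → B)
      (koszulDPart l) (fun i z => extendByZero_injective i (by
        rw [extendByZero_koszulDPart, extendByZero_koszulDPart, koszulD_koszulD, map_zero]))
      LinearMap.id Function.surjective_id (fun x => by
        simp only [LinearMap.id_coe, id_eq, Set.mem_range]
        exact ⟨fun h => ⟨0, by rw [map_zero, h]⟩, by
          rintro ⟨y, rfl⟩; rw [Subsingleton.elim y 0, map_zero]⟩)
      (fun i _ => isWeaklyRegular_of_flat hrs) (isWeaklyRegular_of_flat hrs)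
      (fun y hy i hi z hz => by
        have hz' : koszulD l (extendByZero B n (i + 1) z) = 0 := by
          rw [← extendByZero_koszulDPart, hz, map_zero]
        obtain ⟨c, hc⟩ := exists_koszulD_eq_smul l (hmem y hy) hz'
        refine ⟨1, fun J => c J, ?_⟩
        ext J
        have h1 := congrFun hc J
        rw [Pi.smul_apply, extendByZero_apply_mk, koszulD_apply] at h1
        rw [pow_one, Pi.smul_apply, ← h1]
        change koszulD l _ J = _
        rw [koszulD_apply]
        refine Finset.sum_congr rfl fun j _ => ?_
        split_ifs with hj
        · rfl
        · have := extendByZero_apply_mk (fun J : SubsetOfCard n (i + 1 + 1) => c J)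
            ⟨insert j J, by rw [Finset.card_insert_of_notMem hj, J.2]⟩
          exact congrArg _ this)
      t (hlen ▸ ht)
    have hz' : koszulDPart l t (fun J => b J) = 0 := by
      apply extendByZero_injective
      rw [extendByZero_koszulDPart, extendByZero_restrict hb, hz, map_zero]
    obtain ⟨c, hc⟩ := (key _).mp hz'
    refine ⟨extendByZero B n (t + 1 + 1) c, ?_⟩
    rw [← extendByZero_koszulDPart, hc, extendByZero_restrict hb]
  · refine ⟨0, ?_⟩
    rw [map_zero]
    ext J
    refine (hb J ?_).symm
    have := J.card_le_univ
    rw [Fintype.card_fin] at this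
    omega

end

/-! ### Strands -/

section

variable {S : Type*} [CommRing S] {n : ℕ} (l : Fin n → MvPolynomial (Fin n) S) (e : Fin n → ℕ)
  (k : ℕ)

/-- The basis element `x^m e_J` of a strand. -/
def KoszulIndex.mk {e : Fin n → ℕ} {k t : ℕ} (J : Finset (Fin n)) (m : Fin n →₀ ℕ)
    (h : J.card = t ∧ m.degree + ∑ j ∈ J, e j = k) : KoszulIndex e k t := ⟨(J, m), h⟩

/-- The inclusion of the strand of degree `k` into the Koszul complex. -/
def strandIncl (t : ℕ) :
    (KoszulIndex e k t → S) →ₗ[S] (Finset (Fin n) → MvPolynomial (Fin n) S) :=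
  LinearMap.pi fun J => ∑ p : KoszulIndex e k t, if p.1.1 = J then
    (monomial p.1.2) ∘ₗ LinearMap.proj p else 0

/-- The projection of the Koszul complex onto the strand of degree `k`. -/
def strandProj (t : ℕ) :
    (Finset (Fin n) → MvPolynomial (Fin n) S) →ₗ[S] (KoszulIndex e k t → S) :=
  LinearMap.pi fun p => lcoeff S p.1.2 ∘ₗ LinearMap.proj p.1.1

theorem strandProj_apply {t : ℕ} (b : Finset (Fin n) → MvPolynomial (Fin n) S)
    (p : KoszulIndex e k t) : strandProj e k t b p = coeff p.1.2 (b p.1.1) := rfl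

theorem strandIncl_apply {t : ℕ} (z : KoszulIndex e k t → S) (J : Finset (Fin n)) :
    strandIncl e k t z J = ∑ p : KoszulIndex e k t, if p.1.1 = J then monomial p.1.2 (z p) else 0 := by
  simp only [strandIncl, LinearMap.pi_apply, LinearMap.sum_apply]
  exact Finset.sum_congr rfl fun p _ => by split_ifs <;> simp

theorem coeff_strandIncl {t : ℕ} (z : KoszulIndex e k t → S) (J : Finset (Fin n))
    (m : Fin n →₀ ℕ) : coeff m (strandIncl e k t z J) =
      if h : J.card = t ∧ m.degree + ∑ j ∈ J, e j = k then z (.mk J m h) else 0 := by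
  classical
  rw [strandIncl_apply, coeff_sum]
  split_ifs with h
  · rw [Finset.sum_eq_single (.mk J m h)]
    · simp [KoszulIndex.mk]
    · intro p _ hp
      split_ifs with hJ
      · rw [coeff_monomial, if_neg]
        exact fun hm => hp (Subtype.ext (Prod.ext hJ hm))
      · simp
    · exact fun h' => absurd (Finset.mem_univ _) h'
  · refine Finset.sum_eq_zero fun p _ => ?_
    split_ifs with hJ
    · rw [coeff_monomial, if_neg]
      exact fun hm => h (hJ ▸ hm ▸ p.2)
    · simp

theorem strandProj_strandIncl {t : ℕ} (z : KoszulIndex e k t → S) :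
    strandProj e k t (strandIncl e k t z) = z := by
  ext p
  rw [strandProj_apply, coeff_strandIncl, dif_pos p.2]
  rfl

-- As `l j` is homogeneous of degree `e j`, the differential preserves the total `x`-degree and
-- commutes with truncation to a strand. A preimage found in the full complex can therefore be
-- truncated.
variable {e} in
theorem koszulD_strandIncl_strandProj (hl : ∀ j, (l j).IsHomogeneous (e j)) (t : ℕ)
    (b : Finset (Fin n) → MvPolynomial (Fin n) S) :
    koszulD l (strandIncl e k (t + 1) (strandProj e k (t + 1) b)) =
      strandIncl e k t (strandProj e k t (koszulD l b)) := by
  classical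
  ext J m
  rw [coeff_strandIncl, koszulD_apply, coeff_sum]
  have key : ∀ j, j ∉ J → coeff m ((koszulSign J j : MvPolynomial (Fin n) S) * l j *
      strandIncl e k (t + 1) (strandProj e k (t + 1) b) (insert j J)) =
      if J.card = t ∧ m.degree + ∑ j ∈ J, e j = k then
        coeff m ((koszulSign J j : MvPolynomial (Fin n) S) * l j * b (insert j J)) else 0 := by
    intro j hj
    have h1 : ∀ x : MvPolynomial (Fin n) S, (koszulSign J j : MvPolynomial (Fin n) S) * l j * x =
        C (koszulSign J j : S) * (l j * x) := fun x => by rw [mul_assoc]; simp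
    rw [h1, h1, coeff_C_mul, coeff_C_mul, coeff_mul, coeff_mul, ← mul_ite_zero]
    congr 1
    have h4 : ∀ x ∈ Finset.HasAntidiagonal.antidiagonal m, coeff x.1 (l j) *
        coeff x.2 (strandIncl e k (t + 1) (strandProj e k (t + 1) b) (insert j J)) =
        if J.card = t ∧ m.degree + ∑ j ∈ J, e j = k then
          coeff x.1 (l j) * coeff x.2 (b (insert j J)) else 0 := ?_
    · rw [Finset.sum_congr rfl h4]
      split_ifs <;> simp
    intro x hx
    rw [coeff_strandIncl]
    by_cases h0 : coeff x.1 (l j) = 0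
    · simp [h0]
    · have h2 : x.1.degree = e j := by
        rw [Finsupp.degree_eq_weight_one (R := ℕ)]
        exact hl j h0
      rw [Finset.HasAntidiagonal.mem_antidiagonal] at hx
      have h3 : m.degree = x.1.degree + x.2.degree := by rw [← hx, map_add]
      have h6 := Finset.card_insert_of_notMem hj
      have h7 := Finset.sum_insert (f := e) hj
      by_cases hc : J.card = t ∧ m.degree + ∑ j ∈ J, e j = k
      · rw [if_pos hc, dif_pos (by omega)]
        rfl
      · rw [if_neg hc, dif_neg (by omega), mul_zero]
  split_ifs with h
  · have h5 : strandProj e k t (koszulD l b) (.mk J m h) = coeff m (koszulD l b J) := rfl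
    rw [h5, koszulD_apply, coeff_sum]
    refine Finset.sum_congr rfl fun j _ => ?_
    split_ifs with hj
    · rfl
    · rw [key j hj, if_pos h]
  · refine Finset.sum_eq_zero fun j _ => ?_
    split_ifs with hj
    · simp
    · rw [key j hj, if_neg h]

theorem koszulMatrix_mulVec (t : ℕ) (z : KoszulIndex e k (t + 1) → S) :
    (koszulMatrix l e k t).mulVec z = strandProj e k t (koszulD l (strandIncl e k (t + 1) z)) := by
  classical
  ext q
  rw [strandProj_apply, koszulD_apply, coeff_sum, Matrix.mulVec, dotProduct]
  have h1 : ∀ j, coeff q.1.2 (if j ∈ q.1.1 then 0 else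
      (koszulSign q.1.1 j : MvPolynomial (Fin n) S) * l j *
        strandIncl e k (t + 1) z (insert j q.1.1)) =
      ∑ p : KoszulIndex e k (t + 1), if j ∈ p.1.1 ∧ q.1.1 = p.1.1.erase j then
        (-1) ^ (p.1.1.filter (· < j)).card * coeff q.1.2 (monomial p.1.2 1 * l j) * z p else 0 := by
    intro j
    split_ifs with hj
    · rw [coeff_zero]
      refine (Finset.sum_eq_zero fun p _ => if_neg ?_).symm
      rintro ⟨-, h⟩
      exact Finset.notMem_erase j p.1.1 (h ▸ hj)
    · rw [strandIncl_apply, Finset.mul_sum, coeff_sum]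
      refine Finset.sum_congr rfl fun p _ => ?_
      by_cases h : p.1.1 = insert j q.1.1
      · have h2 : (-1 : S) ^ (p.1.1.filter (· < j)).card = (koszulSign q.1.1 j : S) := by
          rw [h, ← koszulSign_insert_self, koszulSign]; push_cast; rfl
        rw [if_pos h, if_pos (by rw [h, Finset.erase_insert hj]; simp), h2]
        have h3 : (koszulSign q.1.1 j : MvPolynomial (Fin n) S) * l j * monomial p.1.2 (z p) =
            C (koszulSign q.1.1 j * z p) * (monomial p.1.2 1 * l j) := by
          rw [show monomial p.1.2 (z p) = C (z p) * monomial p.1.2 1 by simp [C_mul_monomial]]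
          simp only [map_mul, map_intCast]
          ring
        rw [h3, coeff_C_mul]; ring
      · rw [if_neg h, mul_zero, coeff_zero, if_neg]
        rintro ⟨h2, h3⟩
        exact h (by rw [h3, Finset.insert_erase h2])
  simp only [h1]
  rw [Finset.sum_comm]
  refine Finset.sum_congr rfl fun p _ => ?_
  rw [koszulMatrix, Finset.sum_mul, ← Finset.sum_filter_add_sum_filter_not Finset.univ (· ∈ p.1.1)]
  rw [Finset.sum_eq_zero (s := Finset.univ.filter (¬ · ∈ p.1.1)), add_zero]
  · rw [Finset.filter_mem_eq_inter, Finset.univ_inter]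
    refine Finset.sum_congr rfl fun j hj => ?_
    simp only [hj, true_and, ite_mul, zero_mul]
  · intro j hj
    exact if_neg fun h => (Finset.mem_filter.mp hj).2 h.1

variable {e} in
/-- The strands of the Koszul complex on `n` forms are exact in positive degrees if the ideal of the
forms contains a regular sequence of length `n`. -/
theorem exact_koszulMatrix (hl : ∀ j, (l j).IsHomogeneous (e j))
    {rs : List (MvPolynomial (Fin n) S)} (hlen : rs.length = n)
    (hrs : RingTheory.Sequence.IsWeaklyRegular (MvPolynomial (Fin n) S) rs)
    (hmem : ∀ y ∈ rs, y ∈ Ideal.span (Set.range l)) (t : ℕ) :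
    Function.Exact (koszulMatrix l e k (t + 1)).mulVecLin (koszulMatrix l e k t).mulVecLin := by
  intro z
  simp only [Matrix.mulVecLin_apply, Set.mem_range, koszulMatrix_mulVec]
  constructor
  · intro hz
    have hD : koszulD l (strandIncl e k (t + 1) z) = 0 := by
      have := koszulD_strandIncl_strandProj l k hl t (strandIncl e k (t + 1) z)
      rwa [strandProj_strandIncl, hz, map_zero] at this
    obtain ⟨c, hc⟩ := exists_koszulD_eq_of_isWeaklyRegular l hlen hrs hmem (t := t)
      (fun J hJ => by ext m; rw [coeff_strandIncl, dif_neg (fun h => hJ h.1), coeff_zero]) hD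
    refine ⟨strandProj e k (t + 1 + 1) c, ?_⟩
    rw [koszulD_strandIncl_strandProj l k hl, hc, strandProj_strandIncl, strandProj_strandIncl]
  · rintro ⟨w, rfl⟩
    rw [← koszulD_strandIncl_strandProj l k hl, koszulD_koszulD, map_zero]

theorem isEmpty_koszulIndex {t : ℕ} (ht : n < t) : IsEmpty (KoszulIndex e k t) := ⟨fun p => by
  have h := p.1.1.card_le_univ
  rw [p.2.1, Fintype.card_fin] at h
  omega⟩

end

section

open RingTheory.Sequence

/-! ### Regular sequences of linear forms -/

/-- Membership is tested on the monomials free of the variables in `s`. Multiplication by a further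
variable only shifts these monomials, which makes that variable regular on the quotient. -/
theorem mem_map_C_sup_span_X_iff {A τ : Type*} [CommRing A] {J : Ideal A} {s : Set τ}
    {f : MvPolynomial τ A} :
    f ∈ J.map (C : A →+* MvPolynomial τ A) ⊔ Ideal.span (X '' s) ↔
      ∀ m : τ →₀ ℕ, (∀ i ∈ s, m i = 0) → coeff m f ∈ J := by
  classical
  constructor
  · intro hf m hm
    obtain ⟨g, hg, h, hh, rfl⟩ := Submodule.mem_sup.mp hf
    rw [coeff_add]
    refine add_mem (mem_map_C_iff.mp hg m) ?_
    suffices coeff m h = 0 by rw [this]; exact zero_mem _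
    by_contra hne
    obtain ⟨i, hi, hi'⟩ := mem_ideal_span_X_image.mp hh m (mem_support_iff.mpr hne)
    exact hi' (hm i hi)
  · intro h
    rw [f.as_sum]
    refine sum_mem fun m _ => ?_
    by_cases hm : ∀ i ∈ s, m i = 0
    · refine Ideal.mem_sup_left ?_
      rw [← mul_one (coeff m f), ← C_mul_monomial]
      exact Ideal.mul_mem_right _ _ (Ideal.mem_map_of_mem _ (h m hm))
    · refine Ideal.mem_sup_right (mem_ideal_span_X_image.mpr fun m' hm' => ?_)
      rw [Finset.mem_singleton.mp (support_monomial_subset hm')]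
      push Not at hm
      exact hm

theorem isWeaklyRegular_map_C_append_X {A τ : Type*} [CommRing A] {rs : List A}
    (hrs : IsWeaklyRegular A rs) (us : List τ) (hus : us.Nodup) :
    IsWeaklyRegular (MvPolynomial τ A) (rs.map C ++ us.map X) := by
  classical
  induction us using List.reverseRecOn with
  | nil =>
    rw [List.map_nil, List.append_nil]
    exact (isWeaklyRegular_map_algebraMap_iff (MvPolynomial τ A) (MvPolynomial τ A) rs).mpr
      (isWeaklyRegular_of_flat hrs)
  | append_singleton us a ih =>
    rw [List.nodup_append] at hus
    have ha : a ∉ us := fun h => hus.2.2 a h a (by simp) rfl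
    rw [List.map_append, ← List.append_assoc, isWeaklyRegular_append_iff]
    refine ⟨ih hus.1, ?_⟩
    rw [List.map_singleton, isWeaklyRegular_singleton_iff, isSMulRegular_iff_right_eq_zero_of_smul]
    intro x hx
    obtain ⟨f, rfl⟩ := Submodule.Quotient.mk_surjective _ x
    have hideal : Ideal.ofList (rs.map C ++ us.map X : List (MvPolynomial τ A)) =
        (Ideal.ofList rs).map C ⊔ Ideal.span (X '' {i | i ∈ us}) := by
      rw [Ideal.ofList_append, Ideal.map_ofList]
      congr 1
      exact congrArg Ideal.span (by ext; simp)
    rw [← Submodule.Quotient.mk_smul, Submodule.Quotient.mk_eq_zero, smul_eq_mul,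
      Ideal.mul_top, hideal, mem_map_C_sup_span_X_iff] at hx
    rw [Submodule.Quotient.mk_eq_zero, smul_eq_mul, Ideal.mul_top, hideal,
      mem_map_C_sup_span_X_iff]
    intro m hm
    have := hx (Finsupp.single a 1 + m) (fun i hi => by
      rw [Finsupp.add_apply, hm i hi, Finsupp.single_eq_of_ne (by rintro rfl; exact ha hi)])
    rwa [smul_eq_mul, coeff_X_mul] at this

theorem _root_.RingEquiv.isWeaklyRegular_map {A B : Type*} [CommRing A] [CommRing B] (e : A ≃+* B)
    {rs : List A} (h : IsWeaklyRegular A rs) : IsWeaklyRegular B (rs.map e) := by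
  refine (AddEquiv.isWeaklyRegular_congr (e := e.toAddEquiv) ?_).mp h
  rw [List.forall₂_map_right_iff]
  exact List.forall₂_same.mpr fun r _ x => by simp

/-- The kernels of the powers of `g` stabilize at some `N`. Writing an element of the kernel as `g^N
y` puts `y` in the kernel of `g^(N+1)`, hence of `g^N`. -/
theorem bijective_of_surjective_of_isNoetherianRing {A : Type*} [CommRing A] [IsNoetherianRing A]
    (g : A →+* A) (hg : Function.Surjective g) : Function.Bijective g := by
  refine ⟨?_, hg⟩
  have hmono : Monotone fun i : ℕ => RingHom.ker (g ^ i) := by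
    refine monotone_nat_of_le_succ fun i x hx => ?_
    rw [RingHom.mem_ker] at hx ⊢
    rw [pow_succ', RingHom.mul_def, RingHom.comp_apply, hx, map_zero]
  obtain ⟨N, hN⟩ := monotone_stabilizes_iff_noetherian.mpr ‹IsNoetherianRing A› ⟨_, hmono⟩
  have hsurj : ∀ i : ℕ, Function.Surjective (g ^ i) := by
    intro i
    induction i with
    | zero => exact Function.surjective_id
    | succ i ih => rw [pow_succ']; exact hg.comp ih
  rw [injective_iff_map_eq_zero]
  intro x hx
  obtain ⟨y, rfl⟩ := hsurj N x
  have h1 : y ∈ RingHom.ker (g ^ (N + 1)) := by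
    rw [RingHom.mem_ker, pow_succ', RingHom.mul_def, RingHom.comp_apply, hx]
  have h2 : RingHom.ker (g ^ N) = RingHom.ker (g ^ (N + 1)) := hN (N + 1) (Nat.le_succ N)
  rwa [← h2, RingHom.mem_ker] at h1

/-- The linear forms given by the columns `v` of a matrix with an invertible minor on these columns
form a regular sequence on the polynomial ring, also after a regular sequence of constants. -/
theorem isWeaklyRegular_map_C_append_linearForms {A τ σ : Type*} [CommRing A] [IsNoetherianRing A]
    [Fintype τ] (φ : Matrix τ σ A) {ρ : ℕ} {u : Fin ρ → τ} {v : Fin ρ → σ}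
    (hdet : IsUnit (φ.submatrix u v).det) {rs : List A} (hrs : IsWeaklyRegular A rs) :
    IsWeaklyRegular (MvPolynomial τ A)
      (rs.map C ++ List.ofFn fun i => ∑ k, X k * C (φ k (v i))) := by
  classical
  rcases subsingleton_or_nontrivial A with hA | hA
  · have := (MvPolynomial.C_injective τ A).subsingleton
    exact ⟨fun i _ x y _ => Subsingleton.elim _ _⟩
  have hu : Function.Injective u := injective_of_det_submatrix_ne_zero hdet.ne_zero
  let L : Fin ρ → MvPolynomial τ A := fun i => ∑ k, X k * C (φ k (v i))
  -- Substitute the forms for the variables `X (u i)` and fix the others. Cramer's rule recovers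
  -- each `X (u a)`, so the substitution is surjective, hence an automorphism; it carries a sequence
  -- of variables to the forms and fixes constants.
  let y : τ → MvPolynomial τ A := fun k => if h : ∃ i, u i = k then L h.choose else X k
  have hyu : ∀ i, y (u i) = L i := by
    intro i
    have h : ∃ j, u j = u i := ⟨i, rfl⟩
    have : h.choose = i := hu h.choose_spec
    simp only [y, dif_pos h, this]
  have hyk : ∀ k, k ∉ Set.range u → y k = X k := fun k hk => dif_neg hk
  let g : MvPolynomial τ A →ₐ[A] MvPolynomial τ A := aeval y
  have hgL : ∀ i, L i ∈ g.range := fun i => ⟨X (u i), by simp [g, hyu]⟩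
  have hgk : ∀ k, k ∉ Set.range u → X k ∈ g.range := fun k hk => ⟨X k, by simp [g, hyk k hk]⟩
  have hsum : ∀ b, ∑ c, X (u c) * C (φ (u c) (v b)) ∈ g.range := by
    intro b
    have h1 : L b = ∑ c, X (u c) * C (φ (u c) (v b)) +
        ∑ k ∈ Finset.univ.filter (· ∉ Set.range u), X k * C (φ k (v b)) := by
      change ∑ k, X k * C (φ k (v b)) = _
      rw [← Finset.sum_filter_add_sum_filter_not Finset.univ (· ∈ Set.range u)]
      congr 1
      rw [← Finset.sum_image (f := fun k => X k * C (φ k (v b))) (s := Finset.univ) (g := u)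
        (fun _ _ _ _ h => hu h)]
      refine Finset.sum_congr ?_ fun _ _ => rfl
      ext k; simp
    rw [eq_sub_of_add_eq h1.symm]
    refine sub_mem (hgL b) (sum_mem fun k hk => ?_)
    exact mul_mem (hgk k (Finset.mem_filter.mp hk).2) (g.range.algebraMap_mem _)
  have hgu : ∀ a, X (u a) ∈ g.range := by
    intro a
    obtain ⟨c', hc'⟩ := hdet.exists_right_inv
    have h1 : X (u a) = C c' * ∑ b, C ((φ.submatrix u v).adjugate b a) *
        ∑ c, X (u c) * C (φ (u c) (v b)) := by
      have h2 : ∀ c, ∑ b, φ (u c) (v b) * (φ.submatrix u v).adjugate b a =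
          if c = a then (φ.submatrix u v).det else 0 := by
        intro c
        have := congrFun (congrFun (Matrix.mul_adjugate (φ.submatrix u v)) c) a
        simpa [Matrix.mul_apply, Matrix.one_apply] using this
      have h3 : ∑ b, C ((φ.submatrix u v).adjugate b a) *
          ∑ c, X (u c) * C (φ (u c) (v b)) = ∑ c, X (u c) *
            C (∑ b, φ (u c) (v b) * (φ.submatrix u v).adjugate b a) := by
        simp only [Finset.mul_sum, map_sum]
        rw [Finset.sum_comm]
        refine Finset.sum_congr rfl fun c _ => Finset.sum_congr rfl fun b _ => ?_
        rw [map_mul]; ring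
      rw [h3]
      simp only [h2]
      rw [Finset.sum_eq_single a (fun c _ hc => by simp [hc]) (by simp), if_pos rfl,
        mul_left_comm, ← map_mul, mul_comm c', hc', map_one, mul_one]
    rw [h1]
    exact mul_mem (g.range.algebraMap_mem _) (sum_mem fun b _ =>
      mul_mem (g.range.algebraMap_mem _) (hsum b))
  have hsurj : Function.Surjective g := by
    rw [← AlgHom.range_eq_top, eq_top_iff, ← adjoin_range_X, Algebra.adjoin_le_iff]
    rintro _ ⟨k, rfl⟩
    by_cases hk : k ∈ Set.range u
    · obtain ⟨a, rfl⟩ := hk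
      exact hgu a
    · exact hgk k hk
  have hbij := bijective_of_surjective_of_isNoetherianRing g.toRingHom hsurj
  have h := (RingEquiv.ofBijective g.toRingHom hbij).isWeaklyRegular_map
    (isWeaklyRegular_map_C_append_X hrs (List.ofFn u) (List.nodup_ofFn.mpr hu))
  have h1 : (rs.map C).map (RingEquiv.ofBijective g.toRingHom hbij) = rs.map C := by
    rw [List.map_map]
    exact List.map_congr_left fun r _ => by simp [g]
  have h2 : ((List.ofFn u).map X).map (RingEquiv.ofBijective g.toRingHom hbij) = List.ofFn L := by
    rw [List.map_map, List.map_ofFn]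
    congr 1
    ext1 i
    simp [g, hyu]
  rwa [List.map_append, h1, h2] at h

/-- `T` is a further localization of `A'`, hence flat over it, and flat base change keeps weakly
regular sequences. -/
theorem exists_ringHom_localization {B : Type*} [CommRing B] (M N : Submonoid B) (hMN : M ≤ N)
    (A' T : Type*) [CommRing A'] [CommRing T] [Algebra B A'] [Algebra B T] [IsLocalization M A']
    [IsLocalization N T] : ∃ g : A' →+* T, (∀ b, g (algebraMap B A' b) = algebraMap B T b) ∧
      ∀ rs : List A', IsWeaklyRegular A' rs → IsWeaklyRegular T (rs.map g) := by
  let _ := IsLocalization.localizationAlgebraOfSubmonoidLe A' T M N hMN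
  have : IsScalarTower B A' T :=
    IsLocalization.localization_isScalarTower_of_submonoid_le A' T M N hMN
  have := IsLocalization.isLocalization_of_submonoid_le A' T M N hMN
  have : Module.Flat A' T := IsLocalization.flat T (N.map (algebraMap B A'))
  exact ⟨algebraMap A' T, fun b => (IsScalarTower.algebraMap_apply B A' T b).symm,
    fun rs hrs => (isWeaklyRegular_map_algebraMap_iff T T rs).mpr (isWeaklyRegular_of_flat hrs)⟩

/-- A regular sequence in the local ring at `p` and a minor outside `p` give a regular sequence
of maximal ideal elements at every prime over `p` that contains the linear forms. -/
theorem exists_isWeaklyRegular_linearForms {R τ σ : Type*} [CommRing R] [IsNoetherianRing R]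
    [Fintype τ] (φ : Matrix τ σ R) {P : Ideal (MvPolynomial τ R)} [P.IsPrime]
    (hP : ∀ j, ∑ k, X k * C (φ k j) ∈ P) {p : Ideal R} [p.IsPrime] (hp : p = P.comap C)
    {ρ : ℕ} {u : Fin ρ → τ} {v : Fin ρ → σ} (hdet : (φ.submatrix u v).det ∉ p)
    {rs : List (Localization.AtPrime p)} (hrs : IsWeaklyRegular (Localization.AtPrime p) rs)
    (hmem : ∀ r ∈ rs, r ∈ IsLocalRing.maximalIdeal (Localization.AtPrime p)) :
    ∃ rs' : List (Localization.AtPrime P), rs'.length = rs.length + ρ ∧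
      IsWeaklyRegular (Localization.AtPrime P) rs' ∧
      ∀ r ∈ rs', r ∈ IsLocalRing.maximalIdeal (Localization.AtPrime P) := by
  -- Constants outside `p` remain outside `P`, so the local ring at `P` is a localization of
  -- `R_p[T]`, where the minor is invertible.
  have hle : p.primeCompl.map (C : R →+* MvPolynomial τ R) ≤ P.primeCompl := by
    rintro _ ⟨r, hr, rfl⟩
    exact fun h => hr (hp ▸ h)
  let A := Localization.AtPrime p
  let _ : Algebra (MvPolynomial τ R) (MvPolynomial τ A) := algebraMvPolynomial
  have halg : algebraMap (MvPolynomial τ R) (MvPolynomial τ A) = map (algebraMap R A) := rfl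
  obtain ⟨g, hg, hg'⟩ := exists_ringHom_localization (p.primeCompl.map C) P.primeCompl hle
    (MvPolynomial τ A) (Localization.AtPrime P)
  have hunit : IsUnit ((φ.map (algebraMap R A)).submatrix u v).det := by
    rw [Matrix.submatrix_map, ← RingHom.mapMatrix_apply, ← RingHom.map_det]
    exact IsLocalization.map_units A (⟨_, hdet⟩ : p.primeCompl)
  have h := isWeaklyRegular_map_C_append_linearForms (φ.map (algebraMap R A)) hunit hrs
  refine ⟨_, by simp, hg' _ h, ?_⟩
  intro r hr
  rw [List.map_append, List.map_map, List.map_ofFn, List.mem_append] at hr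
  rcases hr with hr | hr
  · obtain ⟨a, ha, rfl⟩ := List.mem_map.mp hr
    obtain ⟨x, s, rfl⟩ := IsLocalization.exists_mk'_eq p.primeCompl a
    have hx : x ∈ p := (IsLocalization.AtPrime.mk'_mem_maximal_iff A p x s).mp (hmem _ ha)
    have h1 : algebraMap R A s * IsLocalization.mk' A x s = algebraMap R A x :=
      IsLocalization.mk'_spec' A x s
    have h2 := congrArg (fun z => g (C z)) h1
    have h3 : ∀ z : R, g (C (algebraMap R A z)) =
        algebraMap (MvPolynomial τ R) (Localization.AtPrime P) (C z) := by
      intro z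
      rw [← hg, halg, map_C]
    simp only [map_mul, h3] at h2
    have h4 : algebraMap (MvPolynomial τ R) (Localization.AtPrime P) (C x) ∈
        IsLocalRing.maximalIdeal (Localization.AtPrime P) :=
      (IsLocalization.AtPrime.to_map_mem_maximal_iff _ P _).mpr (hp.le hx)
    rw [← h2] at h4
    refine ((Ideal.IsPrime.mem_or_mem inferInstance h4).resolve_left fun h5 => ?_)
    exact s.2 (hp ▸ ((IsLocalization.AtPrime.to_map_mem_maximal_iff _ P _).mp h5 :))
  · obtain ⟨i, rfl⟩ := List.mem_ofFn.mp hr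
    have h3 : ∑ k, X k * C ((φ.map (algebraMap R A)) k (v i)) =
        algebraMap (MvPolynomial τ R) (MvPolynomial τ A) (∑ k, X k * C (φ k (v i))) := by
      rw [halg]
      simp
    rw [Function.comp_apply, h3, hg]
    exact (IsLocalization.AtPrime.to_map_mem_maximal_iff _ P _).mpr (hP _)

end

/-! ### A regular sequence of length `n` among the equations of the symmetric algebra -/

section

open RingTheory.Sequence

/-- If the image of a presentation needs few generators at `p`, then the presentation matrix has a
large minor outside `p`. -/
theorem exists_minor_notMem {R τ σ : Type*} [CommRing R] [IsDomain R] [Fintype τ] [Fintype σ]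
    {f : τ → R} {φ : Matrix τ σ R}
    (hex : Function.Exact φ.mulVecLin (Fintype.linearCombination R f)) (p : Ideal R) [p.IsPrime]
    (A : Type*) [CommRing A] [IsLocalRing A] [Algebra R A] [IsLocalization.AtPrime A p]
    (G : Finset A)
    (hG : Ideal.span (G : Set A) = (Ideal.span (Set.range f)).map (algebraMap R A)) :
    ∃ (ρ : ℕ) (u : Fin ρ → τ) (v : Fin ρ → σ), (φ.submatrix u v).det ∉ p ∧
      Fintype.card τ ≤ ρ + G.card := by
  classical
  let N : Matrix Unit τ R := Matrix.of fun _ i => f i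
  have hinj : Function.Injective (algebraMap R A) :=
    IsLocalization.injective A p.primeCompl_le_nonZeroDivisors
  have hN : Function.Exact φ.mulVecLin N.mulVecLin := by
    intro y
    rw [← hex y, Fintype.linearCombination_apply, funext_iff]
    simp [N, Matrix.mulVec, dotProduct, mul_comm]
  have hN' := exact_mulVecLin_map (B := A) hN p.primeCompl hinj
  have hker : ∀ y : τ → A, ∑ k, y k * algebraMap R A (f k) = 0 →
      ∃ z, (φ.map (algebraMap R A)).mulVec z = y := by
    intro y hy
    refine (hN' y).mp ?_
    ext
    simpa [N, Matrix.mulVec, dotProduct, mul_comm] using hy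
  have hspan : Ideal.span (G : Set A) = Ideal.span (Set.range fun k => algebraMap R A (f k)) := by
    rw [hG, Ideal.map_span, ← Set.range_comp]; rfl
  have hc : ∀ g : G, ∃ c : τ → A, ∑ k, c k * algebraMap R A (f k) = g := fun g =>
    (Ideal.mem_span_range_iff_exists_fun).mp (hspan ▸ Ideal.subset_span g.2)
  have hb : ∀ k, ∃ b : G → A, ∑ g, b g * (g : A) = algebraMap R A (f k) := by
    intro k
    have : algebraMap R A (f k) ∈ Ideal.span (Set.range (Subtype.val : G → A)) := by
      rw [Subtype.range_coe_subtype, Finset.setOfPred_mem, hspan]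
      exact Ideal.subset_span ⟨k, rfl⟩
    exact (Ideal.mem_span_range_iff_exists_fun).mp this
  choose c hc using hc
  choose b hb using hb
  -- Rewriting `f k` through the generators `G` and back gives a relation on the `f`'s, hence an
  -- element of the image of `φ`. Over the residue field the columns of `φ` and the `G.card` vectors
  -- `c g` therefore span everything, which bounds the rank of `φ` below.
  have hy : ∀ k, ∃ z, (φ.map (algebraMap R A)).mulVec z = Pi.single k 1 - ∑ g, b k g • c g := by
    intro k
    refine hker _ ?_
    have h1 : ∑ x, (∑ g, b k g * c g x) * algebraMap R A (f x) =
        ∑ g, b k g * ∑ x, c g x * algebraMap R A (f x) := by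
      simp only [Finset.sum_mul, Finset.mul_sum, mul_assoc]
      exact Finset.sum_comm
    simp only [hc, hb] at h1
    simp only [Pi.sub_apply, Finset.sum_apply, Pi.smul_apply, smul_eq_mul, sub_mul,
      Finset.sum_sub_distrib, h1]
    simp [Pi.single_apply]
  choose y hy using hy
  let r := IsLocalRing.residue A
  let κ := IsLocalRing.ResidueField A
  let ψ : Matrix τ σ κ := (φ.map (algebraMap R A)).map r
  have hψ : ∀ k, Pi.single k 1 = ψ.mulVec (r ∘ y k) + ∑ g, r (b k g) • (r ∘ c g) := by
    intro k
    rw [mulVec_map_comp, hy]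
    ext j
    simp [Pi.single_apply, apply_ite r]
  have htop : LinearMap.range ψ.mulVecLin ⊔ Submodule.span κ (Set.range fun g => r ∘ c g) = ⊤ := by
    rw [eq_top_iff, ← (Pi.basisFun κ τ).span_eq, Submodule.span_le]
    rintro _ ⟨k, rfl⟩
    rw [Pi.basisFun_apply, hψ]
    exact Submodule.add_mem_sup ⟨_, rfl⟩
      (Submodule.sum_mem _ fun g _ => Submodule.smul_mem _ _ (Submodule.subset_span ⟨g, rfl⟩))
  have h1 := Submodule.finrank_add_le_finrank_add_finrank (LinearMap.range ψ.mulVecLin)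
    (Submodule.span κ (Set.range fun g => r ∘ c g))
  have h2 := finrank_range_le_card (R := κ) (fun g => r ∘ c g)
  rw [htop, finrank_top, Module.finrank_fintype_fun_eq_card] at h1
  obtain ⟨u, v, h⟩ := exists_minor_ne_zero ψ
  refine ⟨detRank ψ, u, v, fun hmem => h ?_, ?_⟩
  · rw [Matrix.submatrix_map, Matrix.submatrix_map, ← RingHom.mapMatrix_apply,
      ← RingHom.mapMatrix_apply, ← RingHom.map_det, ← RingHom.map_det,
      IsLocalRing.residue_eq_zero_iff]
    exact (IsLocalization.AtPrime.to_map_mem_maximal_iff A p _).mpr hmem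
  · rw [detRank_eq_rank, Matrix.rank]
    rw [Fintype.card_coe] at h2
    exact h1.trans (Nat.add_le_add_left h2 _)

/-- The ideal of the equations of the symmetric algebra contains a regular sequence of length `n`
under the condition `G_n` on the numbers of generators. -/
theorem exists_isWeaklyRegular_symEquation {K : Type u} [Field K] {n : ℕ}
    {f : Fin (n + 1) → MvPolynomial (Fin n) K}
    {φ : Matrix (Fin (n + 1)) (Fin n) (MvPolynomial (Fin n) K)}
    (hpres : Function.Exact (Matrix.mulVecLin φ)
      (Fintype.linearCombination (MvPolynomial (Fin n) K) f))
    (hG : ∀ (p : Ideal (MvPolynomial (Fin n) K)) [p.IsPrime], Ideal.span (Set.range f) ≤ p →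
      p ≠ Ideal.span (Set.range X) →
      (((((Ideal.span (Set.range f)).map (algebraMap (MvPolynomial (Fin n) K)
        (Localization.AtPrime p))).spanFinrank : ℕ) : ℕ∞) : WithBot ℕ∞) ≤
          ringKrullDim (Localization.AtPrime p)) :
    ∃ rs : List (MvPolynomial (Fin n) (MvPolynomial (Fin (n + 1)) K)), rs.length = n ∧
      IsWeaklyRegular (MvPolynomial (Fin n) (MvPolynomial (Fin (n + 1)) K)) rs ∧
      ∀ y ∈ rs, y ∈ Ideal.span (Set.range (symEquation φ)) := by
  let R := MvPolynomial (Fin n) K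
  let L : Fin n → MvPolynomial (Fin (n + 1)) R := fun j => ∑ k, X k * C (φ k j)
  obtain ⟨rs, hlen, hrs, hmem⟩ := exists_isWeaklyRegular_of_forall_associatedPrimes
    (Ideal.span (Set.range L)) n (by
    intro x hx hxL hlt P hP hLP
    have hPp : P.IsPrime := hP.isPrime
    have hPL : ∀ j, L j ∈ P := fun j => hLP (Ideal.subset_span ⟨j, rfl⟩)
    -- The depth at `P` is `x.length < n`, so no regular sequence at `p` and minor outside `p` may
    -- together reach `n`. Both cases below do reach it.
    have hfin : ∀ {p : Ideal R} [p.IsPrime] (_ : p = P.comap C) {ρ : ℕ} {u : Fin ρ → Fin (n + 1)}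
        {v : Fin ρ → Fin n} (_ : (φ.submatrix u v).det ∉ p) {s : List (Localization.AtPrime p)}
        (_ : IsWeaklyRegular (Localization.AtPrime p) s)
        (_ : ∀ r ∈ s, r ∈ IsLocalRing.maximalIdeal (Localization.AtPrime p)),
        s.length + ρ < n := by
      intro p _ hp ρ u v hdet s hs hs'
      obtain ⟨s', hlen, h1, h2⟩ := exists_isWeaklyRegular_linearForms φ hPL hp hdet hs hs'
      have := length_le_of_mem_associatedPrimes hx hP h2 h1
      omega
    obtain ⟨p, hp⟩ : ∃ p : Ideal R, p = P.comap C := ⟨_, rfl⟩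
    have hpp : p.IsPrime := hp ▸ inferInstance
    by_cases hpX : p = Ideal.span (Set.range X)
    -- Over the origin the variables give length `n` with the empty minor; no bound on generators is
    -- needed there.
    · have hX : IsWeaklyRegular R ((List.finRange n).map X : List R) := by
        simpa using isWeaklyRegular_map_C_append_X (IsWeaklyRegular.nil K K) (List.finRange n)
          (List.nodup_finRange n)
      have h1 := IsWeaklyRegular.of_isLocalization (Localization.AtPrime p) p.primeCompl hX
      have h2 := hfin hp (ρ := 0) (u := Fin.elim0) (v := Fin.elim0)
        (by rw [Matrix.det_isEmpty]; exact p.one_notMem) h1 (by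
          intro r hr
          simp only [List.map_map, List.mem_map, Function.comp_apply] at hr
          obtain ⟨i, -, rfl⟩ := hr
          refine (IsLocalization.AtPrime.to_map_mem_maximal_iff _ p _).mpr ?_
          rw [hpX]
          exact Ideal.subset_span ⟨i, rfl⟩)
      simp at h2
    · obtain ⟨s, hs, hs1, hs2⟩ :=
        exists_isWeaklyRegular_of_isRegularLocalRing (Localization.AtPrime p)
      let J := (Ideal.span (Set.range f)).map (algebraMap R (Localization.AtPrime p))
      -- A bound of `dim R_p + 1` generators suffices, since there are `n + 1` forms `f i`. It also
      -- covers `I ⊄ p`, where the unit ideal needs one generator even if `dim R_p = 0`.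
      obtain ⟨G, hGcard, hGspan⟩ : ∃ G : Finset (Localization.AtPrime p), G.card ≤ s.length + 1 ∧
          Ideal.span (G : Set (Localization.AtPrime p)) = J := by
        by_cases hI : Ideal.span (Set.range f) ≤ p
        · obtain ⟨G, h1, h2⟩ := Submodule.FG.exists_span_finset_card_eq_spanFinrank
            (J.fg_of_isNoetherianRing)
          refine ⟨G, ?_, h2⟩
          have h3 := hG p hI hpX
          rw [← hs] at h3
          have h4 : J.spanFinrank ≤ s.length := by exact_mod_cast h3
          omega
        · refine ⟨{1}, by simp, ?_⟩
          obtain ⟨a, ha, hap⟩ := SetLike.not_le_iff_exists.mp hI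
          rw [Finset.coe_singleton, Ideal.span_singleton_one, eq_comm, Ideal.eq_top_iff_one]
          refine (J.eq_top_of_isUnit_mem (Ideal.mem_map_of_mem _ ha) ?_) ▸ trivial
          exact IsLocalization.map_units _ (⟨a, hap⟩ : p.primeCompl)
      obtain ⟨ρ, u, v, hdet, hcard⟩ := exists_minor_notMem hpres p _ G hGspan
      rw [Fintype.card_fin] at hcard
      have := hfin hp hdet hs2 hs1
      omega)
  let e := commAlgEquiv K (Fin (n + 1)) (Fin n)
  refine ⟨rs.map e, by simp [hlen], e.toRingEquiv.isWeaklyRegular_map hrs, ?_⟩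
  intro y hy
  obtain ⟨z, hz, rfl⟩ := List.mem_map.mp hy
  have h1 := Ideal.mem_map_of_mem e (hmem z hz)
  rw [Ideal.map_span, ← Set.range_comp] at h1
  convert h1 using 3
  ext1 j
  simp [L, e, symEquation, commAlgEquiv_C, commAlgEquiv_X]

end

/-! ### The symmetric algebra -/

section

variable {K : Type*} [Field K] {n m : ℕ} {f : Fin m → MvPolynomial (Fin n) K}

theorem toSym_C_X (i : Fin m) : toSym f (C (X i)) =
    SymmetricAlgebra.ι (MvPolynomial (Fin n) K) (Ideal.span (Set.range f))
      ⟨f i, Ideal.subset_span ⟨i, rfl⟩⟩ := by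
  simp [toSym]

theorem toSym_map_C (r : MvPolynomial (Fin n) K) : toSym f (map C r) =
    algebraMap (MvPolynomial (Fin n) K)
      (SymmetricAlgebra (MvPolynomial (Fin n) K) (Ideal.span (Set.range f))) r := by
  have : (toSym f).comp (map C) = algebraMap (MvPolynomial (Fin n) K)
      (SymmetricAlgebra (MvPolynomial (Fin n) K) (Ideal.span (Set.range f))) := by
    apply MvPolynomial.ringHom_ext
    · intro a; simp [toSym]
    · intro i; simp [toSym]
  exact RingHom.congr_fun this r

/-- The images of the `T_i` satisfy the relations `φ` since the equations go to zero, so they define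
a linear map on `I`, which extends to the symmetric algebra. Taking the quotient by the equations as
`Q` shows that these generate the kernel of `toSym f`. -/
theorem exists_comp_toSym_eq {φ : Matrix (Fin m) (Fin n) (MvPolynomial (Fin n) K)}
    (hpres : Function.Exact (Matrix.mulVecLin φ)
      (Fintype.linearCombination (MvPolynomial (Fin n) K) f)) {Q : Type*} [CommRing Q]
    (h : MvPolynomial (Fin n) (MvPolynomial (Fin m) K) →+* Q)
    (hh : ∀ j, h (symEquation φ j) = 0) :
    ∃ g : SymmetricAlgebra (MvPolynomial (Fin n) K) (Ideal.span (Set.range f)) →+* Q,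
      g.comp (toSym f) = h := by
  classical
  let R := MvPolynomial (Fin n) K
  let B := MvPolynomial (Fin n) (MvPolynomial (Fin m) K)
  let I := Ideal.span (Set.range f)
  let _ : Algebra R Q := (h.comp (map C)).toAlgebra
  let T : (Fin m → R) →ₗ[R] Q :=
    Fintype.linearCombination R fun i => h (C (X i))
  let q : (Fin m → R) →ₗ[R] I := (Fintype.linearCombination R f).codRestrict I fun y => by
    rw [Fintype.linearCombination_apply]
    exact sum_mem fun i _ => Ideal.mul_mem_left _ _ (Ideal.subset_span ⟨i, rfl⟩)
  have hq : Function.Surjective q := by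
    rintro ⟨x, hx⟩
    obtain ⟨c, hc⟩ := Ideal.mem_span_range_iff_exists_fun.mp hx
    exact ⟨c, Subtype.ext hc⟩
  have hT : LinearMap.ker q ≤ LinearMap.ker T := by
    intro y hy
    have h1 : Fintype.linearCombination R f y = 0 := congrArg Subtype.val hy
    obtain ⟨z, rfl⟩ := (hpres y).mp h1
    rw [LinearMap.mem_ker, Fintype.linearCombination_apply]
    have h2 : ∑ i, (φ.mulVecLin z) i • h (C (X i)) =
        h (∑ j, map C (z j) * symEquation φ j) := by
      have h3 : ∀ i, (φ.mulVecLin z) i • h (C (X i)) =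
          h (map C (∑ j, φ i j * z j) * C (X i)) := fun i => by
        rw [map_mul, Algebra.smul_def]; rfl
      rw [Finset.sum_congr rfl fun i _ => h3 i, ← map_sum]
      congr 1
      simp only [map_sum, map_mul, symEquation, Finset.mul_sum, Finset.sum_mul]
      rw [Finset.sum_comm]
      refine Finset.sum_congr rfl fun j _ => Finset.sum_congr rfl fun i _ => ?_
      ring
    rw [h2, map_sum]
    exact Finset.sum_eq_zero fun j _ => by rw [map_mul, hh, mul_zero]
  let g' : I →ₗ[R] Q :=
    (LinearMap.ker q).liftQ T hT ∘ₗ (q.quotKerEquivOfSurjective hq).symm.toLinearMap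
  have hg' : ∀ i, g' ⟨f i, Ideal.subset_span ⟨i, rfl⟩⟩ = h (C (X i)) := by
    intro i
    have h1 : (⟨f i, Ideal.subset_span ⟨i, rfl⟩⟩ : I) =
        q.quotKerEquivOfSurjective hq (Submodule.Quotient.mk (Pi.single i 1)) := by
      refine Subtype.ext ?_
      change f i = Fintype.linearCombination R f (Pi.single i 1)
      simp
    simp only [g', LinearMap.comp_apply, h1, LinearEquiv.coe_coe, LinearEquiv.symm_apply_apply,
      Submodule.liftQ_apply]
    simp [T]
  let g : SymmetricAlgebra R I →ₐ[R] Q := SymmetricAlgebra.lift g'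
  refine ⟨g.toRingHom, ?_⟩
  apply MvPolynomial.ringHom_ext
  · intro s
    have : (g.toRingHom.comp (toSym f)).comp C = (h).comp C := by
      apply MvPolynomial.ringHom_ext
      · intro a
        have h1 : (C (C a) : B) = map C (C a : R) := by simp
        have h2 : toSym f (C (C a)) = algebraMap R (SymmetricAlgebra R I) (C a) := by rw [h1, toSym_map_C]
        refine (congrArg g h2).trans ((g.commutes (C a)).trans ?_)
        exact (congrArg h h1).symm
      · intro i
        refine (congrArg g (toSym_C_X i)).trans ?_
        exact (SymmetricAlgebra.lift_ι_apply ..).trans (hg' i)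
    exact RingHom.congr_fun this s
  · intro j
    have h1 : (X j : B) = map C (X j : R) := by simp
    have h2 : toSym f (X j) = algebraMap R (SymmetricAlgebra R I) (X j) := by rw [h1, toSym_map_C]
    refine (congrArg g h2).trans ((g.commutes (X j)).trans ?_)
    exact (congrArg h h1).symm

theorem ker_toSym {φ : Matrix (Fin m) (Fin n) (MvPolynomial (Fin n) K)}
    (hpres : Function.Exact (Matrix.mulVecLin φ)
      (Fintype.linearCombination (MvPolynomial (Fin n) K) f)) :
    RingHom.ker (toSym f) = Ideal.span (Set.range (symEquation φ)) := by
  classical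
  let R := MvPolynomial (Fin n) K
  let I := Ideal.span (Set.range f)
  apply le_antisymm
  · have h0 : ∀ j, Ideal.Quotient.mk (Ideal.span (Set.range (symEquation φ))) (symEquation φ j) = 0 :=
      fun j => Ideal.Quotient.eq_zero_iff_mem.mpr (Ideal.subset_span (Set.mem_range_self j))
    obtain ⟨g, hg⟩ := exists_comp_toSym_eq hpres
      (Q := _ ⧸ Ideal.span (Set.range (symEquation φ))) (Ideal.Quotient.mk _) h0
    intro x hx
    rw [← Ideal.Quotient.eq_zero_iff_mem, ← hg, RingHom.comp_apply, RingHom.mem_ker.mp hx, map_zero]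
  · rw [Ideal.span_le]
    rintro _ ⟨j, rfl⟩
    rw [SetLike.mem_coe, RingHom.mem_ker]
    have h1 : Fintype.linearCombination R f (φ.mulVecLin (Pi.single j 1)) = 0 :=
      (hpres _).mpr ⟨_, rfl⟩
    rw [Matrix.mulVecLin_apply, Matrix.mulVec_single_one, Fintype.linearCombination_apply] at h1
    have h2 : ∑ i, φ i j • (⟨f i, Ideal.subset_span ⟨i, rfl⟩⟩ : I) = 0 :=
      Subtype.ext (by rw [AddSubmonoidClass.coe_finsetSum]; exact h1)
    simp only [symEquation, map_sum, map_mul, toSym_C_X, toSym_map_C]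
    have h3 := congrArg (SymmetricAlgebra.ι R I) h2
    rw [map_sum, map_zero] at h3
    rw [← h3]
    refine Finset.sum_congr rfl fun i _ => ?_
    rw [map_smul, Algebra.smul_def, mul_comm]

end

/-- The cokernel of the last differential in a strand of the Koszul complex. -/
theorem nonempty_cokernel_equiv_degreePart {S : Type*} [CommRing S] {n : ℕ}
    {l : Fin n → MvPolynomial (Fin n) S} {e : Fin n → ℕ} (hl : ∀ j, (l j).IsHomogeneous (e j))
    (k : ℕ) :
    Nonempty (((KoszulIndex e k 0 → S) ⧸ LinearMap.range (koszulMatrix l e k 0).mulVecLin) ≃ₗ[S]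
      DegreePart (Ideal.span (Set.range l)) k) := by
  classical
  let J := Ideal.span (Set.range l)
  have hempty : ∀ p : KoszulIndex e k 0, p.1.1 = ∅ := fun p => Finset.card_eq_zero.mp p.2.1
  have hdeg : ∀ p : KoszulIndex e k 0, p.1.2.degree = k := fun p => by
    have := p.2.2
    rwa [hempty p, Finset.sum_empty, add_zero] at this
  have hhom : ∀ z : KoszulIndex e k 0 → S,
      strandIncl e k 0 z ∅ ∈ homogeneousSubmodule (Fin n) S k := by
    intro z
    rw [strandIncl_apply]
    refine sum_mem fun p _ => ?_
    rw [if_pos (hempty p)]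
    exact isHomogeneous_monomial _ (hdeg p)
  let i : (KoszulIndex e k 0 → S) →ₗ[S] homogeneousSubmodule (Fin n) S k :=
    (LinearMap.proj ∅ ∘ₗ strandIncl e k 0).codRestrict _ hhom
  let Θ : (KoszulIndex e k 0 → S) →ₗ[S] DegreePart J k :=
    (Submodule.comap (homogeneousSubmodule (Fin n) S k).subtype (J.restrictScalars S)).mkQ ∘ₗ i
  have hmem : ∀ z, Θ z = 0 ↔ strandIncl e k 0 z ∅ ∈ J := by
    intro z
    exact Submodule.Quotient.mk_eq_zero _
  have hsurj : Function.Surjective Θ := by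
    refine (Submodule.mkQ_surjective _).comp ?_
    rintro ⟨h, hh⟩
    refine ⟨strandProj e k 0 fun _ => h, Subtype.ext ?_⟩
    change strandIncl e k 0 (strandProj e k 0 fun _ => h) ∅ = h
    ext m
    rw [coeff_strandIncl]
    split_ifs with hm
    · rfl
    · by_contra hne
      refine hm ⟨rfl, ?_⟩
      rw [Finset.sum_empty, add_zero, Finsupp.degree_eq_weight_one (R := ℕ)]
      exact hh (Ne.symm hne)
  have hD : ∀ b : Finset (Fin n) → MvPolynomial (Fin n) S, koszulD l b ∅ = ∑ j, l j * b {j} := by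
    intro b
    rw [koszulD_apply]
    exact Finset.sum_congr rfl fun j _ => by simp [koszulSign]
  have hker : LinearMap.ker Θ = LinearMap.range (koszulMatrix l e k 0).mulVecLin := by
    ext z
    rw [LinearMap.mem_ker, hmem, LinearMap.mem_range]
    simp only [Matrix.mulVecLin_apply, koszulMatrix_mulVec]
    constructor
    · intro hz
      obtain ⟨c, hc⟩ := Ideal.mem_span_range_iff_exists_fun.mp hz
      -- Only the values `c j` at singletons enter the differential at `∅`. The `c j` need not be
      -- homogeneous; projecting to the strand repairs that.
      let b : Finset (Fin n) → MvPolynomial (Fin n) S := fun J => ∑ j ∈ J, c j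
      have hb : koszulD l b ∅ = strandIncl e k 0 z ∅ := by
        rw [hD, ← hc]
        exact Finset.sum_congr rfl fun j _ => by simp [b, mul_comm]
      refine ⟨strandProj e k 1 b, ?_⟩
      rw [koszulD_strandIncl_strandProj l k hl, strandProj_strandIncl]
      ext p
      have := strandProj_strandIncl e k z
      rw [← this, strandProj_apply, strandProj_apply, hempty p, hb]
    · rintro ⟨w, rfl⟩
      rw [← koszulD_strandIncl_strandProj l k hl, strandProj_strandIncl, hD]
      exact sum_mem fun j _ => Ideal.mul_mem_right _ _ (Ideal.subset_span ⟨j, rfl⟩)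
  exact ⟨(Submodule.quotEquivOfEq _ _ hker.symm).trans (Θ.quotKerEquivOfSurjective hsurj)⟩

theorem isHomogeneous_symEquation {K : Type*} [Field K] {n m : ℕ} {e : Fin n → ℕ}
    {φ : Matrix (Fin m) (Fin n) (MvPolynomial (Fin n) K)}
    (hφ : ∀ i j, (φ i j).IsHomogeneous (e j)) (j : Fin n) :
    (symEquation φ j).IsHomogeneous (e j) := by
  refine IsHomogeneous.sum _ _ _ fun i _ => ?_
  have := (isHomogeneous_C (Fin n) (X i : MvPolynomial (Fin m) K)).mul
    ((hφ i j).map (C : K →+* MvPolynomial (Fin m) K))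
  rwa [zero_add] at this

section

open RingTheory.Sequence IsLocalRing

/-! ### Grades of the determinantal ideals of a resolution -/

/-- At a prime `P ⊇ I(α t)` with `depth S_P ≤ t + g`, the cokernel of `α t` becomes free, so a
maximal minor is a unit at `P`, which is absurd. The value `g = 0` asks nothing and gives the
Buchsbaum–Eisenbud bound; `g = 2` turns `(S_2)` into (b). -/
theorem le_grade_rankIdeal {S : Type u} [CommRing S] [IsDomain S] [IsNoetherianRing S]
    {ι : ℕ → Type} [∀ t, Fintype (ι t)] {α : ∀ t, Matrix (ι t) (ι (t + 1)) S}
    (hex : ∀ t, Function.Exact (α (t + 1)).mulVecLin (α t).mulVecLin) {n : ℕ}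
    (hempty : ∀ t, n < t → IsEmpty (ι t)) (g : ℕ)
    (hg : ∀ (P : Ideal S) [P.IsPrime] (rs : List (Localization.AtPrime P)),
      (∀ r ∈ rs, r ∈ maximalIdeal (Localization.AtPrime P)) →
      IsWeaklyRegular (Localization.AtPrime P) rs →
      ExtVanish (Localization.AtPrime P) ((ι 0 → Localization.AtPrime P) ⧸
        LinearMap.range ((α 0).map (algebraMap S (Localization.AtPrime P))).mulVecLin)
        (min g rs.length)) (t : ℕ) :
    ((t + 1 + g : ℕ) : ℕ∞) ≤ grade (rankIdeal (α t)) := by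
  obtain ⟨x, hlen, hx, hxI⟩ := exists_isWeaklyRegular_of_forall_associatedPrimes
    (rankIdeal (α t)) (t + 1 + g) (by
    intro x hx _ hlt P hP hle
    have hPp : P.IsPrime := hP.isPrime
    let A := Localization.AtPrime P
    have hinj : Function.Injective (algebraMap S A) :=
      IsLocalization.injective A P.primeCompl_le_nonZeroDivisors
    have hxP : ∀ a ∈ x, a ∈ P := fun a ha =>
      ofList_le_of_mem_associatedPrimes hP (Ideal.subset_span ha)
    have hmem := mem_maximalIdeal_of_mem_map hxP
    have hx' : IsWeaklyRegular A (x.map (algebraMap S A)) :=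
      IsWeaklyRegular.of_isLocalization A P.primeCompl hx
    have hfree := free_coker_of_extVanish (F := fun s => ι s → A)
      (fun s => ((α s).map (algebraMap S A)).mulVecLin)
      (fun s => exact_mulVecLin_map (hex s) P.primeCompl hinj)
      (n := n) (fun s hs => by have := hempty s hs; infer_instance)
      (D := x.length) (g := g) (t := t) (by simp) hx' hmem
      (not_extVanish_of_mem_associatedPrimes hx hP)
      (by simpa using hg P _ hmem hx') (by omega)
    obtain ⟨u, v, h⟩ : ∃ (u : Fin (detRank (α t)) → ι t) (v : Fin (detRank (α t)) → ι (t + 1)),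
        IsUnit (((α t).map (algebraMap S A)).submatrix u v).det :=
      detRank_map_of_injective (α t) hinj ▸ exists_isUnit_minor_of_free _
    rw [Matrix.submatrix_map, ← RingHom.mapMatrix_apply, ← RingHom.map_det,
      IsLocalization.AtPrime.isUnit_to_map_iff A P] at h
    exact h (hle (det_mem_minorsIdeal _ u v)))
  exact hlen ▸ le_gradeOn_of_isWeaklyRegular hx hxI

/-! ### Localized presentations and Serre's condition -/

theorem exists_surjective_exact_localizedModule {S : Type*} [CommRing S] {p q : Type*} [Fintype p]
    [Fintype q] {N : Matrix p q S} {M : Type*} [AddCommGroup M] [Module S M] {π : (p → S) →ₗ[S] M}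
    (hπ : Function.Surjective π) (hex : Function.Exact N.mulVecLin π) (W : Submonoid S) :
    ∃ π' : (p → Localization W) →ₗ[Localization W] LocalizedModule W M,
      Function.Surjective π' ∧
      Function.Exact (N.map (algebraMap S (Localization W))).mulVecLin π' := by
  classical
  let A := Localization W
  let i := LocalizedModule.mkLinearMap W M
  let π' : (p → A) →ₗ[A] LocalizedModule W M :=
    Fintype.linearCombination A fun k => i (π (Pi.single k 1))
  have h1 : ∀ x : p → S, π' (algebraMap S A ∘ x) = i (π x) := by
    intro x
    rw [Fintype.linearCombination_apply]
    conv_rhs => rw [pi_eq_sum_univ' x]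
    simp only [map_sum, map_smul, Function.comp_apply, algebraMap_smul]
  have hunit : ∀ s : W, IsUnit (algebraMap S A s) := IsLocalization.map_units A
  refine ⟨π', ?_, ?_⟩
  · intro m
    obtain ⟨⟨m, s⟩, rfl⟩ := IsLocalizedModule.mk'_surjective W i m
    obtain ⟨y, rfl⟩ := hπ m
    obtain ⟨c, hc⟩ := (hunit s).exists_left_inv
    refine ⟨c • algebraMap S A ∘ y, ?_⟩
    rw [map_smul, h1, Function.uncurry_apply_pair, eq_comm]
    have h2 : algebraMap S A s • IsLocalizedModule.mk' i (π y) s = i (π y) := by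
      rw [algebraMap_smul]; exact IsLocalizedModule.mk'_cancel' i (π y) s
    rw [← h2, smul_smul, hc, one_smul]
  · intro y
    obtain ⟨s, x, hx⟩ := exists_smul_eq_algebraMap_comp (B := A) W y
    simp only [Matrix.mulVecLin_apply, Set.mem_range]
    constructor
    · intro hy
      have h2 : i (π x) = 0 := by rw [← h1, ← hx, map_smul, hy, smul_zero]
      obtain ⟨c, hc⟩ := (IsLocalizedModule.eq_zero_iff W i).mp h2
      have hc' : π ((c : S) • x) = 0 := by rw [map_smul]; exact hc
      obtain ⟨w, hw⟩ := (hex _).mp hc'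
      obtain ⟨b, hb⟩ := (hunit (c * s)).exists_left_inv
      refine ⟨b • algebraMap S A ∘ w, ?_⟩
      have h3 : algebraMap S A ∘ ((c : S) • x) = algebraMap S A c • algebraMap S A ∘ x := by
        ext; simp
      rw [Matrix.mulVec_smul, mulVec_map_comp, ← Matrix.mulVecLin_apply, hw, h3, ← hx, smul_smul,
        smul_smul, mul_assoc, ← map_mul, ← Submonoid.coe_mul, hb, one_smul]
    · rintro ⟨z, rfl⟩
      obtain ⟨s, x, hx⟩ := exists_smul_eq_algebraMap_comp (B := A) W z
      refine ((hunit s).smul_eq_zero).mp ?_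
      rw [← map_smul, ← Matrix.mulVec_smul, hx, mulVec_map_comp, h1, ← Matrix.mulVecLin_apply,
        (hex _).mpr ⟨x, rfl⟩, map_zero]

/-- The element `m` with zero annihilator embeds `S_P` into `M_P`. So the dimension of `M_P` is at
least the length of every regular sequence at `P`, and the minimum in Serre's condition may be taken
against that length. -/
theorem extVanish_of_serreCondition {S : Type u} [CommRing S] [IsNoetherianRing S]
    {p q : Type} [Fintype p] [Fintype q] {N : Matrix p q S} {M : Type u} [AddCommGroup M]
    [Module S M] {π : (p → S) →ₗ[S] M} (hπ : Function.Surjective π)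
    (hex : Function.Exact N.mulVecLin π) {m : M} (hm : ∀ a : S, a • m = 0 → a = 0) {r : ℕ}
    (hM : SerreCondition S M r) (P : Ideal S) [P.IsPrime] (rs : List (Localization.AtPrime P))
    (hmem : ∀ r ∈ rs, r ∈ maximalIdeal (Localization.AtPrime P))
    (hrs : IsWeaklyRegular (Localization.AtPrime P) rs) :
    ExtVanish (Localization.AtPrime P) ((p → Localization.AtPrime P) ⧸
      LinearMap.range (N.map (algebraMap S (Localization.AtPrime P))).mulVecLin)
      (min r rs.length) := by
  let A := Localization.AtPrime P
  let MP := LocalizedModule P.primeCompl M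
  let i := LocalizedModule.mkLinearMap P.primeCompl M
  have hm' : ∀ a : A, a • i m = 0 → a = 0 := by
    intro a ha
    obtain ⟨b, s, rfl⟩ := IsLocalization.exists_mk'_eq P.primeCompl a
    have h1 : i (b • m) = 0 := by
      have h2 : algebraMap S A s • (IsLocalization.mk' A b s • i m) = 0 := by rw [ha, smul_zero]
      rwa [smul_smul, IsLocalization.mk'_spec', algebraMap_smul, ← map_smul] at h2
    obtain ⟨c, hc⟩ := (IsLocalizedModule.eq_zero_iff P.primeCompl i).mp h1
    rw [Submonoid.smul_def, smul_smul] at hc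
    rw [IsLocalization.mk'_eq_zero_iff]
    exact ⟨c, hm _ hc⟩
  obtain ⟨π', hπ', hex'⟩ := exists_surjective_exact_localizedModule hπ hex P.primeCompl
  have hfin : Module.Finite A MP := Module.Finite.of_surjective π' hπ'
  have hnt : Nontrivial MP := ⟨i m, 0, fun h => one_ne_zero (hm' 1 (by rw [h, smul_zero]))⟩
  have hreg : IsRegular A rs :=
    (IsLocalRing.isRegular_iff_isWeaklyRegular_of_subset_maximalIdeal hmem).mpr hrs
  have hdim : ((rs.length : ℕ∞) : WithBot ℕ∞) ≤ Module.supportDim A MP := by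
    have h1 := Module.supportDim_le_of_injective (LinearMap.toSpanSingleton A MP (i m))
      ((injective_iff_map_eq_zero _).mpr fun a ha => hm' a ha)
    rw [Module.supportDim_self_eq_ringKrullDim] at h1
    refine le_trans ?_ h1
    rw [← ringKrullDim_add_length_eq_ringKrullDim_of_isRegular rs hreg]
    have : Nontrivial (A ⧸ Ideal.ofList rs) := Ideal.Quotient.nontrivial_iff.mpr
      (ne_top_of_le_ne_top (maximalIdeal.isMaximal A).ne_top (Ideal.span_le.mpr hmem))
    have h2 := ringKrullDim_nonneg_of_nontrivial (R := A ⧸ Ideal.ofList rs)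
    exact le_add_of_nonneg_left h2
  have hdepth : ((min r rs.length : ℕ) : ℕ∞) ≤ depth A MP := by
    have h1 := le_trans (min_le_min_left ((r : ℕ∞) : WithBot ℕ∞) hdim) (hM P)
    rcases le_total r rs.length with h2 | h2
    · rw [min_eq_left h2]
      rw [min_eq_left (by exact_mod_cast h2)] at h1
      exact_mod_cast h1
    · rw [min_eq_right h2]
      rw [min_eq_right (by exact_mod_cast h2)] at h1
      exact_mod_cast h1
  obtain ⟨xs, hlen, hxs, hxmem⟩ := exists_isWeaklyRegular_of_le_gradeOn hdepth
  have h := ExtVanish.of_isWeaklyRegular hxmem hxs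
  rw [hlen] at h
  refine h.of_linearEquiv (LinearEquiv.symm ?_)
  exact (Submodule.quotEquivOfEq _ _ (LinearMap.exact_iff.mp hex').symm).trans
    (π'.quotKerEquivOfSurjective hπ')

end

/-! ### Alternating maps and orientations -/

section

variable {A : Type*} [CommRing A] {F G : Type*} [AddCommGroup F] [Module A F] [AddCommGroup G]
  [Module A G]

/-- Both sides are alternating in the rows of `M`, so they need only be compared on permutations of
the standard basis. -/
theorem alternatingMap_linearCombination {r : ℕ} (g : F [⋀^Fin r]→ₗ[A] G) (v : Fin r → F)
    (M : Matrix (Fin r) (Fin r) A) : g (fun i => ∑ j, M i j • v j) = M.det • g v := by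
  let L : (Fin r → A) →ₗ[A] F := Fintype.linearCombination A v
  have h : g.compLinearMap L =
      (LinearMap.toSpanSingleton A G (g v)).compAlternatingMap Matrix.detRowAlternating := by
    refine Module.Basis.ext_alternating (Pi.basisFun A (Fin r)) fun w hw => ?_
    let σ : Equiv.Perm (Fin r) := Equiv.ofBijective w (Finite.injective_iff_bijective.mp hw)
    have hv : ∀ i, L (Pi.basisFun A (Fin r) i) = v i := by intro i; simp [L]
    have h1 : (g.compLinearMap L) (Pi.basisFun A (Fin r) ∘ σ) = Equiv.Perm.sign σ • g v := by
      rw [AlternatingMap.map_perm]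
      congr 1
      exact congrArg g (funext hv)
    have h2 : Matrix.detRowAlternating (Pi.basisFun A (Fin r) ∘ σ) =
        Equiv.Perm.sign σ • (1 : A) := by
      rw [AlternatingMap.map_perm]
      congr 1
      rw [← Matrix.det_one (n := Fin r) (R := A)]
      change Matrix.det (fun i => Pi.basisFun A (Fin r) i) = _
      congr 1
      ext i j
      simp [Pi.single_apply, Matrix.one_apply, eq_comm]
    refine h1.trans ?_
    change _ = (Matrix.detRowAlternating (Pi.basisFun A (Fin r) ∘ σ)) • g v
    rw [h2]
    rcases Int.units_eq_one_or (Equiv.Perm.sign σ) with hs | hs <;> simp [hs]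
  have h3 := DFunLike.congr_fun h M
  have h4 : (g.compLinearMap L) M = g (fun i => ∑ j, M i j • v j) := rfl
  exact h4.symm.trans h3

/-- Every wedge of `f` vectors is a multiple of the wedge of the basis, so its value under `η`
generates the image of `η`, which is all of `A`. -/
theorem isUnit_orientation_basis {f : ℕ} (η : (⋀[A]^f F) ≃ₗ[A] A) (b : Module.Basis (Fin f) A F) :
    IsUnit (η (exteriorPower.ιMulti A f b)) := by
  have h1 : ∀ x : ⋀[A]^f F, η x ∈ Ideal.span {η (exteriorPower.ιMulti A f b)} := by
    intro x
    have hx : x ∈ Submodule.span A (Set.range (exteriorPower.ιMulti A f (M := F))) := by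
      rw [exteriorPower.ιMulti_span]; trivial
    induction hx using Submodule.span_induction with
    | mem x hx =>
      obtain ⟨V, rfl⟩ := hx
      have h2 := alternatingMap_linearCombination (exteriorPower.ιMulti A f) b
        (Matrix.of fun i j => b.repr (V i) j)
      simp only [Matrix.of_apply, b.sum_repr] at h2
      rw [h2, map_smul]
      exact Ideal.mul_mem_left _ _ (Ideal.mem_span_singleton_self _)
    | zero => rw [map_zero]; exact zero_mem _
    | add x y _ _ hx hy => rw [map_add]; exact add_mem hx hy
    | smul a x _ hx => rw [map_smul]; exact Ideal.mul_mem_left _ _ hx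
  have h2 := h1 (η.symm 1)
  rw [η.apply_symm_apply] at h2
  exact isUnit_of_dvd_one (Ideal.mem_span_singleton.mp h2)

theorem orientFun_ιMulti {f : ℕ} (η : (⋀[A]^f F) ≃ₗ[A] A) (V : Fin f → F) :
    orientFun η (ExteriorAlgebra.ιMulti A f V) = η (exteriorPower.ιMulti A f V) :=
  orientFun_apply η (exteriorPower.ιMulti A f V)

end

theorem exists_bijective_append {q : Type*} [Fintype q] {s s' : ℕ} (hs : s + s' = Fintype.card q)
    {u : Fin s → q} (hu : Function.Injective u) :
    ∃ z : Fin s' → q, Function.Bijective (Fin.append u z) := by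
  classical
  have hcard : Fintype.card {k // k ∉ Set.range u} = s' := by
    have h1 := Fintype.card_subtype_compl (fun k => k ∈ Set.range u)
    have h2 := Set.card_range_of_injective hu
    rw [Fintype.card_fin] at h2
    have h3 : Fintype.card {k // k ∈ Set.range u} = s := h2
    rw [h3] at h1
    omega
  let e := Fintype.equivFinOfCardEq hcard
  refine ⟨fun i => (e.symm i).1, ?_⟩
  rw [Fintype.bijective_iff_injective_and_card]
  refine ⟨Fin.append_injective_iff.mpr ⟨hu, Subtype.val_injective.comp e.symm.injective, ?_⟩,
    by simp [hs]⟩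
  intro i j h
  exact (e.symm j).2 ⟨i, h⟩

section

variable {A : Type*} [CommRing A] {q : Type*} [Fintype q] [DecidableEq q]

/-- The basis of standard vectors, in the order of a bijection. -/
def stdBasis (A : Type*) [CommRing A] {q : Type*} [Fintype q] [DecidableEq q] {f : ℕ}
    {y : Fin f → q} (hy : Function.Bijective y) : Module.Basis (Fin f) A (q → A) :=
  (Pi.basisFun A q).reindex (Equiv.ofBijective y hy).symm

theorem stdBasis_apply {f : ℕ} {y : Fin f → q} (hy : Function.Bijective y) (i : Fin f) :
    stdBasis A hy i = Pi.single (y i) 1 := by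
  simp [stdBasis]

theorem sum_smul_stdBasis {f : ℕ} {y : Fin f → q} (hy : Function.Bijective y) (x : q → A) :
    ∑ i, x (y i) • stdBasis A hy i = x := by
  have := (stdBasis A hy).sum_repr x
  simpa [stdBasis] using this

theorem orientFun_ιMulti_eq_det {f : ℕ} (η : (⋀[A]^f (q → A)) ≃ₗ[A] A) {y : Fin f → q}
    (hy : Function.Bijective y) (V : Fin f → q → A) :
    orientFun η (ExteriorAlgebra.ιMulti A f V) =
      (Matrix.of fun i j => V i (y j)).det * η (exteriorPower.ιMulti A f (stdBasis A hy)) := by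
  have h2 := alternatingMap_linearCombination (exteriorPower.ιMulti A f) (stdBasis A hy)
    (Matrix.of fun i j => V i (y j))
  simp only [Matrix.of_apply, sum_smul_stdBasis] at h2
  rw [orientFun_ιMulti, h2, map_smul, smul_eq_mul]

/-- Wedging with standard vectors gives a minor. -/
theorem exists_isUnit_orientFun_mul {f s s' : ℕ} (hs : s + s' = f) (η : (⋀[A]^f (q → A)) ≃ₗ[A] A)
    {u : Fin s → q} {z : Fin s' → q} (h : Function.Bijective (Fin.append u z)) :
    ∃ ε : A, IsUnit ε ∧ ∀ w : Fin s → q → A,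
      orientFun η (ExteriorAlgebra.ιMulti A s w *
        ExteriorAlgebra.ιMulti A s' fun i => Pi.single (z i) 1) =
      ε * (Matrix.of fun i j => w j (u i)).det := by
  subst hs
  refine ⟨_, isUnit_orientation_basis η (stdBasis A h), fun w => ?_⟩
  rw [ExteriorAlgebra.ιMulti_mul_ιMulti, orientFun_ιMulti_eq_det η h, mul_comm]
  congr 1
  obtain ⟨-, hz, huz⟩ := Fin.append_injective_iff.mp h.injective
  rw [← Matrix.det_submatrix_equiv_self finSumFinEquiv]
  have h1 : (Matrix.of fun i j => Fin.append w (fun i => Pi.single (z i) 1) i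
      (Fin.append u z j)).submatrix finSumFinEquiv finSumFinEquiv =
      Matrix.fromBlocks (Matrix.of fun i j => w j (u i))ᵀ (Matrix.of fun i j => w i (z j)) 0
        (1 : Matrix (Fin s') (Fin s') A) := by
    ext i j
    rcases i with i | i <;> rcases j with j | j
    · simp
    · simp
    · simp [huz j i]
    · simp [Pi.single_apply, Matrix.one_apply, hz.eq_iff, eq_comm]
  rw [h1, Matrix.det_fromBlocks_zero₂₁, Matrix.det_one, mul_one, Matrix.det_transpose]

/-- Cramer's rule modulo the columns `v` of a matrix. -/
theorem det_smul_eq_mulVec_add_sum {o : Type*} [Fintype o] [DecidableEq o] {s s' : ℕ}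
    (N : Matrix q o A) {u : Fin s → q} {z : Fin s' → q} (h : Function.Bijective (Fin.append u z))
    (v : Fin s → o) (x : q → A) :
    ∃ m : Fin s → A, ∃ m' : Fin s' → A, (N.submatrix u v).det • x =
      ∑ j, m j • N.col (v j) + ∑ i, m' i • Pi.single (z i) 1 := by
  set c := (N.submatrix u v).det with hc
  let m := (N.submatrix u v).cramer (x ∘ u)
  let y : q → A := ∑ j, m j • N.col (v j)
  have hy : y = N.mulVec (∑ j, m j • Pi.single (v j) 1) := by
    rw [Matrix.mulVec_sum]
    exact Finset.sum_congr rfl fun j _ => by rw [Matrix.mulVec_smul, Matrix.mulVec_single_one]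
  have hyu : ∀ i, y (u i) = c * x (u i) := by
    intro i
    rw [hy]
    exact mulVec_sum_single_cramer N u v x i
  refine ⟨m, fun i => (c • x - y) (z i), ?_⟩
  have h1 := sum_smul_stdBasis h (c • x - y)
  rw [Fin.sum_univ_add] at h1
  simp only [Fin.append_left, Fin.append_right, stdBasis_apply] at h1
  rw [Finset.sum_eq_zero (fun i _ => by
    rw [Pi.sub_apply, hyu, Pi.smul_apply, smul_eq_mul, sub_self, zero_smul]), zero_add] at h1
  rw [h1]
  exact (add_sub_cancel y (c • x)).symm

/-- An alternating map that kills the columns `v` of a matrix is, up to a minor on these columns,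
determined by one value. -/
theorem exists_forall_alternatingMap_eq {o : Type*} [Fintype o] [DecidableEq o] {s r : ℕ}
    (N : Matrix q o A) {u : Fin s → q} {z : Fin r → q} (h : Function.Bijective (Fin.append u z))
    (v : Fin s → o) (x : Fin r → q → A) :
    ∃ a : A, ∀ {G : Type*} [AddCommGroup G] [Module A G] (g : (q → A) [⋀^Fin r]→ₗ[A] G),
      (∀ (x : Fin r → q → A) i j, g (Function.update x i (N.col (v j))) = 0) →
      (N.submatrix u v).det ^ r • g x = a • g fun i => Pi.single (z i) 1 := by
  choose m m' hm using fun i => det_smul_eq_mulVec_add_sum N h v (x i)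
  -- The coefficient depends on `x` alone and not on `g`; this is what makes any two such maps
  -- proportional.
  refine ⟨(Matrix.of m').det, fun g hg => ?_⟩
  have h1 : (N.submatrix u v).det ^ r • g x = g fun i => (N.submatrix u v).det • x i := by
    rw [AlternatingMap.map_smul_univ]; simp
  have hsum : ∀ (x : Fin r → q → A) (i : Fin r) (m : Fin s → A),
      g (Function.update x i (∑ j, m j • N.col (v j))) = 0 := by
    intro x i m
    rw [AlternatingMap.map_update_sum]
    exact Finset.sum_eq_zero fun j _ => by rw [AlternatingMap.map_update_smul, hg, smul_zero]
  rw [h1, funext hm]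
  -- In the multilinear expansion each term containing a combination of the columns vanishes; only
  -- the term in the vectors `e_(z i)` is left.
  have h2 := g.map_add_univ (fun i => ∑ j, m i j • N.col (v j))
    (fun i => ∑ k, m' i k • (Pi.single (z k) 1 : q → A))
  refine h2.trans ?_
  rw [Finset.sum_eq_single ∅]
  · rw [Finset.piecewise_empty]
    exact alternatingMap_linearCombination g (fun k => Pi.single (z k) 1) (Matrix.of m')
  · intro t _ ht
    obtain ⟨i, hi⟩ := Finset.nonempty_iff_ne_empty.mpr ht
    rw [← Function.update_eq_self i (t.piecewise _ _), Finset.piecewise_eq_of_mem _ _ _ hi]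
    exact hsum _ _ _
  · simp

end

theorem free_exteriorAlgebra (A : Type*) [CommRing A] (q : Type*) [Fintype q] :
    Module.Free A (ExteriorAlgebra A (q → A)) :=
  .of_basis (((Pi.basisFun A q).reindex (Fintype.equivFin q)).ExteriorAlgebra)

theorem eq_zero_of_smul_eq_zero_exteriorAlgebra {A : Type*} [CommRing A] [IsDomain A] {q : Type*}
    [Fintype q] {c : A} (hc : c ≠ 0) {x : ExteriorAlgebra A (q → A)} (h : c • x = 0) : x = 0 := by
  have := free_exteriorAlgebra A q
  exact (smul_eq_zero.mp h).resolve_left hc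

/-! ### One step of the construction of the multipliers -/

/-- Every wedge of `s` columns of `N` is a multiple of `a`. -/
def DividesColumns {A : Type*} [CommRing A] {q o : Type*} (N : Matrix q o A) (s : ℕ)
    (a : ExteriorAlgebra A (q → A)) : Prop :=
  ∀ v : Fin s → o, ∃ b : A, ExteriorAlgebra.ιMulti A s (fun i => N.col (v i)) = b • a

section

variable {A : Type u} [CommRing A] {p q o : Type}

/-- The functional `x ↦ ω (a ∧ x)`. -/
def wedgeFunctional (ω : ExteriorAlgebra A (q → A) →ₗ[A] A) (a : ExteriorAlgebra A (q → A)) (r : ℕ) :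
    (⋀[A]^r (q → A)) →ₗ[A] A :=
  ω ∘ₗ LinearMap.mulLeft A a ∘ₗ (⋀[A]^r (q → A)).subtype

theorem wedgeFunctional_apply (ω : ExteriorAlgebra A (q → A) →ₗ[A] A)
    (a : ExteriorAlgebra A (q → A)) {r : ℕ} (x : ⋀[A]^r (q → A)) :
    wedgeFunctional ω a r x = ω (a * x) := rfl

variable [Fintype q] {r : ℕ}

theorem exteriorPower_map_mulVecLin_ιMulti (N : Matrix p q A) (x : Fin r → q → A) :
    exteriorPower.map r N.mulVecLin (exteriorPower.ιMulti A r x) =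
      exteriorPower.ιMulti A r (fun i => N.mulVec (x i)) :=
  exteriorPower.map_apply_ιMulti N.mulVecLin x

theorem coe_exteriorPower_map (N : Matrix p q A) (x : ⋀[A]^r (q → A)) :
    (exteriorPower.map r N.mulVecLin x : ExteriorAlgebra A (p → A)) =
      ExteriorAlgebra.map N.mulVecLin x := by
  have htop : x ∈ Submodule.span A (Set.range (exteriorPower.ιMulti A r (M := q → A))) := by
    rw [exteriorPower.ιMulti_span]; trivial
  induction htop using Submodule.span_induction with
  | mem x hx =>
    obtain ⟨x, rfl⟩ := hx
    rw [exteriorPower_map_mulVecLin_ιMulti, exteriorPower.ιMulti_apply_coe,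
      exteriorPower.ιMulti_apply_coe, ExteriorAlgebra.map_apply_ιMulti]
    rfl
  | zero => simp
  | add y y' _ _ hy hy' => simp only [map_add, Submodule.coe_add, hy, hy']
  | smul b y _ hy => simp only [map_smul, Submodule.coe_smul, hy]

variable [DecidableEq q]

theorem map_ιMulti_single (N : Matrix p q A) (v : Fin r → q) :
    ExteriorAlgebra.map N.mulVecLin (ExteriorAlgebra.ιMulti A r fun i => Pi.single (v i) 1) =
      ExteriorAlgebra.ιMulti A r fun i => N.col (v i) := by
  rw [ExteriorAlgebra.map_apply_ιMulti]
  congr 1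
  ext1 i
  exact Matrix.mulVec_single_one N (v i)

theorem dividesColumns_of_map_eq {N : Matrix p q A} {a' : ExteriorAlgebra A (p → A)}
    {l : ExteriorAlgebra A (q → A) → A}
    (h : ∀ x ∈ ⋀[A]^r (q → A), ExteriorAlgebra.map N.mulVecLin x = l x • a') :
    DividesColumns N r a' := fun v =>
  ⟨_, (map_ιMulti_single N v).symm.trans
    (h _ (exteriorPower.ιMulti A r fun i => Pi.single (v i) 1).2)⟩

variable {N' : Matrix q o A} {s f : ℕ} {η : (⋀[A]^f (q → A)) ≃ₗ[A] A}
  {a : ExteriorAlgebra A (q → A)}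

/-- Wedging with the unit vectors complementary to the rows `u` turns the wedge of the columns `v`,
a multiple of `a`, into the minor up to a unit. -/
theorem minorsIdeal_le_range_wedgeFunctional (hs : s + r = f) (hf : f = Fintype.card q)
    (ha : DividesColumns N' s a) :
    minorsIdeal N' s ≤ LinearMap.range (wedgeFunctional (orientFun η) a r) := by
  rcases subsingleton_or_nontrivial A with hA | hA
  · intro x _
    rw [Subsingleton.elim x 0]
    exact zero_mem _
  rw [minorsIdeal, Ideal.span_le]
  rintro _ ⟨u, v, rfl⟩
  by_cases h0 : (N'.submatrix u v).det = 0
  · rw [h0]; exact zero_mem _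
  obtain ⟨z, hz⟩ := exists_bijective_append (hs.trans hf) (injective_of_det_submatrix_ne_zero h0)
  obtain ⟨ε, hε, h⟩ := exists_isUnit_orientFun_mul hs η hz
  obtain ⟨b, hb⟩ := ha v
  obtain ⟨c, hc⟩ := hε.exists_left_inv
  refine ⟨(c * b) • exteriorPower.ιMulti A r fun i => Pi.single (z i) 1, ?_⟩
  have h1 := h fun i => N'.col (v i)
  rw [hb, smul_mul_assoc, map_smul, smul_eq_mul] at h1
  rw [map_smul, smul_eq_mul, wedgeFunctional_apply, exteriorPower.ιMulti_apply_coe, mul_assoc, h1,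
    ← mul_assoc, hc, one_mul]
  rfl

/-- A nonzero multiple of `a` is the wedge of the columns `v`, and column `v j` then occurs twice.
-/
theorem orientFun_mul_update_eq_zero [IsDomain A] (hs : s + r = f) (hf : f = Fintype.card q)
    (ha : DividesColumns N' s a) {u : Fin s → q} {v : Fin s → o}
    (h0 : (N'.submatrix u v).det ≠ 0) (x : Fin r → q → A) (i : Fin r) (j : Fin s) :
    orientFun η (a * ExteriorAlgebra.ιMulti A r (Function.update x i (N'.col (v j)))) = 0 := by
  obtain ⟨z, hz⟩ := exists_bijective_append (hs.trans hf) (injective_of_det_submatrix_ne_zero h0)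
  obtain ⟨ε, hε, h⟩ := exists_isUnit_orientFun_mul hs η hz
  obtain ⟨b, hb⟩ := ha v
  have h1 := h fun i => N'.col (v i)
  rw [hb, smul_mul_assoc, map_smul, smul_eq_mul] at h1
  have hb0 : b ≠ 0 := by
    rintro rfl
    rw [zero_mul] at h1
    exact (mul_ne_zero hε.ne_zero h0) h1.symm
  refine (mul_eq_zero_iff_left hb0).mp ?_
  rw [← smul_eq_mul, ← map_smul, ← smul_mul_assoc, ← hb, ExteriorAlgebra.ιMulti_mul_ιMulti,
    ExteriorAlgebra.ιMulti_eq_zero_of_not_inj, map_zero]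
  intro hinj
  exact (Fin.append_injective_iff.mp hinj).2.2 j i (by simp)

theorem exists_wedgeFunctional_ne_zero [IsDomain A] (hs : s + r = f) (hf : f = Fintype.card q)
    (ha : DividesColumns N' s a) (hN' : minorsIdeal N' s ≠ ⊥) :
    ∃ x, wedgeFunctional (orientFun η) a r x ≠ 0 := by
  by_contra! h
  refine hN' (le_bot_iff.mp ?_)
  refine (minorsIdeal_le_range_wedgeFunctional hs hf ha (η := η)).trans ?_
  rintro _ ⟨x, rfl⟩
  exact h x

variable [Fintype p]

theorem multiplier_unique [IsDomain A] (hs : s + r = f) (hf : f = Fintype.card q)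
    (ha : DividesColumns N' s a) (hN' : minorsIdeal N' s ≠ ⊥) {N : Matrix p q A}
    {a' a'' : ExteriorAlgebra A (p → A)}
    (h' : ∀ x ∈ ⋀[A]^r (q → A), ExteriorAlgebra.map N.mulVecLin x = orientFun η (a * x) • a')
    (h'' : ∀ x ∈ ⋀[A]^r (q → A), ExteriorAlgebra.map N.mulVecLin x = orientFun η (a * x) • a'') :
    a' = a'' := by
  obtain ⟨x, hx⟩ := exists_wedgeFunctional_ne_zero hs hf ha hN' (η := η)
  refine sub_eq_zero.mp (eq_zero_of_smul_eq_zero_exteriorAlgebra hx ?_)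
  rw [smul_sub, sub_eq_zero]
  exact (h' x x.2).symm.trans (h'' x x.2)

variable [Fintype o] [DecidableEq o]

/-- Both `x ↦ η(a ∧ x)` and `⋀^r N` are alternating and kill the columns `v` of `N'`, the latter
because `N N' = 0`. Up to the same power of a minor both are then given by the same coefficient
times one value, so they are proportional. -/
theorem orientFun_smul_ιMulti_comm [IsDomain A] (hs : s + r = f) (hf : f = Fintype.card q)
    (ha : DividesColumns N' s a) (hN' : minorsIdeal N' s ≠ ⊥) {N : Matrix p q A}
    (hNN : N * N' = 0) (x x' : Fin r → q → A) :
    orientFun η (a * ExteriorAlgebra.ιMulti A r x) •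
        exteriorPower.ιMulti A r (fun i => N.mulVec (x' i)) =
      orientFun η (a * ExteriorAlgebra.ιMulti A r x') •
        exteriorPower.ιMulti A r (fun i => N.mulVec (x i)) := by
  rw [Ne, minorsIdeal_eq_bot_iff] at hN'
  push Not at hN'
  obtain ⟨u, v, h0⟩ := hN'
  obtain ⟨z, hz⟩ := exists_bijective_append (hs.trans hf) (injective_of_det_submatrix_ne_zero h0)
  let l : (q → A) [⋀^Fin r]→ₗ[A] A :=
    (orientFun η ∘ₗ LinearMap.mulLeft A a).compAlternatingMap (ExteriorAlgebra.ιMulti A r)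
  let g : (q → A) [⋀^Fin r]→ₗ[A] (⋀[A]^r (p → A)) :=
    (exteriorPower.ιMulti A r).compLinearMap N.mulVecLin
  have hl : ∀ (x : Fin r → q → A) i j, l (Function.update x i (N'.col (v j))) = 0 :=
    fun x i j => orientFun_mul_update_eq_zero hs hf ha h0 x i j
  have hg : ∀ (x : Fin r → q → A) i j, g (Function.update x i (N'.col (v j))) = 0 := by
    intro x i j
    change exteriorPower.ιMulti A r (fun k => N.mulVecLin (Function.update x i _ k)) = 0
    refine AlternatingMap.map_coord_zero _ i ?_
    rw [Function.update_self, ← Matrix.mulVec_single_one, Matrix.mulVecLin_apply,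
      Matrix.mulVec_mulVec, hNN, Matrix.zero_mulVec]
  set c := (N'.submatrix u v).det ^ r
  have hc : c ≠ 0 := pow_ne_zero _ h0
  obtain ⟨b, hb⟩ := exists_forall_alternatingMap_eq.{u, 0, 0, u} N' hz v x
  obtain ⟨b', hb'⟩ := exists_forall_alternatingMap_eq.{u, 0, 0, u} N' hz v x'
  have h1 := hb l hl
  have h2 := hb g hg
  have h1' := hb' l hl
  have h2' := hb' g hg
  have h3 : (c * c) • (l x • g x') = (c * c) • (l x' • g x) := by
    have e1 : (c * c) • (l x • g x') = (c • l x) • (c • g x') := by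
      rw [smul_eq_mul, smul_smul, smul_smul]; congr 1; ring
    have e2 : (c * c) • (l x' • g x) = (c • l x') • (c • g x) := by
      rw [smul_eq_mul, smul_smul, smul_smul]; congr 1; ring
    rw [e1, e2, h1, h2, h1', h2', smul_smul, smul_smul]
    congr 1
    rw [smul_eq_mul, smul_eq_mul]; ring
  exact smul_right_injective _ (mul_ne_zero hc hc) h3

theorem wedgeFunctional_smul_map_comm [IsDomain A] (hs : s + r = f) (hf : f = Fintype.card q)
    (ha : DividesColumns N' s a) (hN' : minorsIdeal N' s ≠ ⊥) {N : Matrix p q A}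
    (hNN : N * N' = 0) (x x' : ⋀[A]^r (q → A)) :
    wedgeFunctional (orientFun η) a r x • exteriorPower.map r N.mulVecLin x' =
      wedgeFunctional (orientFun η) a r x' • exteriorPower.map r N.mulVecLin x := by
  have htop : ∀ y : ⋀[A]^r (q → A),
      y ∈ Submodule.span A (Set.range (exteriorPower.ιMulti A r (M := q → A))) := fun y => by
    rw [exteriorPower.ιMulti_span]; trivial
  induction htop x using Submodule.span_induction with
  | mem x hx =>
    obtain ⟨x, rfl⟩ := hx
    induction htop x' using Submodule.span_induction with
    | mem x' hx' =>
      obtain ⟨x', rfl⟩ := hx'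
      rw [exteriorPower_map_mulVecLin_ιMulti, exteriorPower_map_mulVecLin_ιMulti]
      exact orientFun_smul_ιMulti_comm hs hf ha hN' hNN x x'
    | zero => simp
    | add y y' _ _ hy hy' => simp only [map_add, smul_add, add_smul, hy, hy']
    | smul b y _ hy => rw [map_smul, map_smul, smul_comm, hy, smul_assoc]
  | zero => simp
  | add y y' _ _ hy hy' => simp only [map_add, smul_add, add_smul, hy, hy']
  | smul b y _ hy => rw [map_smul, map_smul, smul_assoc, hy, smul_comm]

open RingTheory.Sequence in
/-- The Buchsbaum-Eisenbud factorization. -/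
theorem exists_multiplier [IsDomain A] (hs : s + r = f) (hf : f = Fintype.card q)
    (ha : DividesColumns N' s a) (hgrade : (2 : ℕ∞) ≤ grade (minorsIdeal N' s))
    {N : Matrix p q A} (hNN : N * N' = 0) (hN' : minorsIdeal N' s ≠ ⊥) :
    ∃ a' ∈ ⋀[A]^r (p → A), ∀ x ∈ ⋀[A]^r (q → A),
      ExteriorAlgebra.map N.mulVecLin x = orientFun η (a * x) • a' := by
  obtain ⟨rs, hlen, hrs, hmem⟩ := exists_isWeaklyRegular_of_le_gradeOn (G := 2) hgrade
  obtain ⟨b, c, rfl⟩ := List.length_eq_two.mp hlen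
  let l := wedgeFunctional (orientFun η) a r
  let g := exteriorPower.map r N.mulVecLin
  obtain ⟨x, hx⟩ := minorsIdeal_le_range_wedgeFunctional hs hf ha (η := η) (hmem b (by simp))
  obtain ⟨y, hy⟩ := minorsIdeal_le_range_wedgeFunctional hs hf ha (η := η) (hmem c (by simp))
  have h1 := isWeaklyRegular_of_flat hrs (F := ⋀[A]^r (p → A))
  rw [isWeaklyRegular_cons_iff, isWeaklyRegular_singleton_iff] at h1
  -- With `b = l x` and `c = l y`, proportionality reads `c g(x) = b g(y)`. Regularity of `b, c`
  -- makes `g x` divisible by `b`, and the quotient is the multiplier.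
  have h2 : c • g x = b • g y := by
    rw [← hx, ← hy]
    exact wedgeFunctional_smul_map_comm hs hf ha hN' hNN y x
  have h3 : (Submodule.Quotient.mk (g x) : QuotSMulTop b (⋀[A]^r (p → A))) = 0 := by
    refine h1.2.right_eq_zero_of_smul ?_
    rw [← Submodule.Quotient.mk_smul, h2]
    exact (QuotSMulTop.mk_eq_zero_iff).mpr ⟨g y, rfl⟩
  obtain ⟨a', ha'⟩ := (QuotSMulTop.mk_eq_zero_iff).mp h3
  refine ⟨a', a'.2, fun w hw => ?_⟩
  have h4 : g ⟨w, hw⟩ = l ⟨w, hw⟩ • a' := by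
    refine h1.1 ?_
    have h5 := wedgeFunctional_smul_map_comm hs hf ha hN' hNN (η := η) x ⟨w, hw⟩
    rw [hx] at h5
    change b • g ⟨w, hw⟩ = b • (l ⟨w, hw⟩ • a')
    rw [smul_comm b, ← ha']
    exact h5
  have h6 := congrArg Subtype.val h4
  rw [coe_exteriorPower_map] at h6
  exact h6

end

/-! ### The family of multipliers -/

section

variable {A : Type u} [CommRing A] [IsDomain A] {ι : ℕ → Type} [∀ t, Fintype (ι t)] {n : ℕ}
  {α : ∀ t, Matrix (ι t) (ι (t + 1)) A}
  {η : ∀ t, (⋀[A]^(Fintype.card (ι t)) (ι t → A)) ≃ₗ[A] A}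

theorem minorsIdeal_detRank_ne_bot {p q : Type*} [Fintype p] (N : Matrix p q A) :
    minorsIdeal N (detRank N) ≠ ⊥ := by
  obtain ⟨u, v, h⟩ := exists_minor_ne_zero N
  exact fun h' => h ((minorsIdeal_eq_bot_iff N).mp h' u v)

theorem dividesColumns_one {t : ℕ} (h : IsEmpty (ι (t + 1))) :
    DividesColumns (α t) (detRank (α t)) 1 := by
  rw [detRank_eq_zero_of_isEmpty]
  exact fun v => ⟨1, by simp⟩

theorem IsMultiplierFamily.dividesColumns (hempty : ∀ t, n < t → IsEmpty (ι t))
    {a : ∀ t, ExteriorAlgebra A (ι t → A)} (ha : IsMultiplierFamily n α η a) (t : ℕ) :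
    DividesColumns (α t) (detRank (α t)) (a t) := by
  classical
  rcases lt_or_ge t n with ht | ht
  · exact dividesColumns_of_map_eq (ha.factor t ht)
  · rw [ha.eq_one t ht]
    exact dividesColumns_one (hempty _ (by omega))

theorem isMultiplierFamily_unique (hempty : ∀ t, n < t → IsEmpty (ι t))
    (hex : ∀ t, Function.Exact (α (t + 1)).mulVecLin (α t).mulVecLin)
    {a a' : ∀ t, ExteriorAlgebra A (ι t → A)} (ha : IsMultiplierFamily n α η a)
    (ha' : IsMultiplierFamily n α η a') : a = a' := by
  classical
  have key : ∀ j t, n ≤ t + j → a t = a' t := by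
    intro j
    induction j with
    | zero => exact fun t ht => (ha.eq_one t ht).trans (ha'.eq_one t ht).symm
    | succ j ih =>
      intro t ht
      rcases lt_or_ge t n with htn | htn
      · have h1 := ih (t + 1) (by omega)
        refine multiplier_unique (detRank_add_detRank_of_exact (hex t)) rfl
          (ha.dividesColumns hempty (t + 1)) (minorsIdeal_detRank_ne_bot _) (ha.factor t htn) ?_
        rw [h1]
        exact ha'.factor t htn
      · exact (ha.eq_one t htn).trans (ha'.eq_one t htn).symm
  exact funext fun t => key n t (by omega)

theorem exists_isMultiplierFamily (hempty : ∀ t, n < t → IsEmpty (ι t))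
    (hex : ∀ t, Function.Exact (α (t + 1)).mulVecLin (α t).mulVecLin)
    (hgrade : ∀ t, ((t + 1 : ℕ) : ℕ∞) ≤ grade (rankIdeal (α t))) :
    ∃ a, IsMultiplierFamily n α η a := by
  classical
  -- Construction from the top down: after `j` steps the factorizations with `t ≥ n - j` hold. The
  -- entries not yet built are placeholders, and `0` serves since it lies in every exterior power.
  have key : ∀ j, ∃ a : ∀ t, ExteriorAlgebra A (ι t → A),
      (∀ t, a t ∈ ⋀[A]^(detRank (α t)) (ι t → A)) ∧ (∀ t, n ≤ t → a t = 1) ∧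
      ∀ t, n ≤ t + j → t < n → ∀ x ∈ ⋀[A]^(detRank (α t)) (ι (t + 1) → A),
        ExteriorAlgebra.map (Matrix.mulVecLin (α t)) x =
          orientFun (η (t + 1)) (a (t + 1) * x) • a t := by
    intro j
    induction j with
    | zero =>
      refine ⟨fun t => if n ≤ t then 1 else 0, fun t => ?_, fun t ht => if_pos ht,
        fun t ht htn => absurd ht (by omega)⟩
      dsimp only
      split_ifs with ht
      · have := hempty (t + 1) (by omega)
        rw [detRank_eq_zero_of_isEmpty]
        have h1 := (exteriorPower.ιMulti A 0 (Fin.elim0 : Fin 0 → ι t → A)).2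
        rwa [exteriorPower.ιMulti_apply_coe, ExteriorAlgebra.ιMulti_zero_apply] at h1
      · exact zero_mem _
    | succ j ih =>
      obtain ⟨a, h1, h2, h3⟩ := ih
      rcases lt_or_ge j n with hj | hj
      · obtain ⟨t, rfl⟩ : ∃ t, n = t + (j + 1) := ⟨n - (j + 1), by omega⟩
        have hdiv : DividesColumns (α (t + 1)) (detRank (α (t + 1))) (a (t + 1)) := by
          rcases Nat.eq_zero_or_pos j with rfl | hj0
          · rw [h2 (t + 1) (by omega)]
            exact dividesColumns_one (hempty _ (by omega))
          · exact dividesColumns_of_map_eq (h3 (t + 1) (by omega) (by omega))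
        have hNN : α t * α (t + 1) = 0 := by
          apply Matrix.toLin'.injective
          rw [Matrix.toLin'_mul, map_zero]
          exact (hex t).linearMap_comp_eq_zero
        obtain ⟨b, hb, hb'⟩ := exists_multiplier (detRank_add_detRank_of_exact (hex t)) rfl hdiv
          (η := η (t + 1)) (le_trans (by exact_mod_cast (by omega : 2 ≤ t + 1 + 1)) (hgrade (t + 1)))
          hNN (minorsIdeal_detRank_ne_bot _)
        refine ⟨Function.update a t b, fun i => ?_, fun i hi => ?_, fun i hi hin => ?_⟩
        · rcases eq_or_ne i t with rfl | hi
          · rwa [Function.update_self]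
          · rw [Function.update_of_ne hi]; exact h1 i
        · rw [Function.update_of_ne (by omega)]; exact h2 i hi
        · rw [Function.update_of_ne (by omega : i + 1 ≠ t)]
          rcases eq_or_ne i t with rfl | hit
          · rwa [Function.update_self]
          · rw [Function.update_of_ne hit]; exact h3 i (by omega) hin
      · exact ⟨a, h1, h2, fun t _ htn => h3 t (by omega) htn⟩
  obtain ⟨a, h1, h2, h3⟩ := key n
  exact ⟨a, ⟨h1, h2, fun t ht => h3 t (by omega) ht⟩⟩

end

/-! ### Degrees of the multipliers -/

section

variable {K : Type u} [Field K] {τ : Type}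

theorem homogeneousComponent_mul_of_isHomogeneous {p q : MvPolynomial τ K} {a : ℕ}
    (hp : p.IsHomogeneous a) (e : ℕ) :
    homogeneousComponent (a + e) (p * q) = p * homogeneousComponent e q := by
  conv_lhs => rw [← sum_homogeneousComponent q, Finset.mul_sum, map_sum]
  have h : ∀ i, homogeneousComponent (a + e) (p * homogeneousComponent i q) =
      if i = e then p * homogeneousComponent e q else 0 := by
    intro i
    rw [homogeneousComponent_of_mem (hp.mul (homogeneousComponent_isHomogeneous i q))]
    by_cases hi : i = e
    · rw [if_pos hi, if_pos (by omega), hi]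
    · rw [if_neg hi, if_neg (by omega)]
  rw [Finset.sum_congr rfl fun i _ => h i, Finset.sum_ite_eq']
  split_ifs with he
  · rfl
  · rw [homogeneousComponent_eq_zero _ _ (by simpa using he), mul_zero]

/-- Multiplication by the nonzero form `p` shifts homogeneous components injectively, so a component
of `q` in a wrong degree would survive in `p * q`. -/
theorem exists_isHomogeneous_of_mul {p q : MvPolynomial τ K} {a m : ℕ} (hp : p.IsHomogeneous a)
    (hpq : (p * q).IsHomogeneous m) (h0 : p * q ≠ 0) : ∃ b, a + b = m ∧ q.IsHomogeneous b := by
  have hp0 : p ≠ 0 := left_ne_zero_of_mul h0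
  have h1 : ∀ e, a + e ≠ m → homogeneousComponent e q = 0 := by
    intro e he
    have h2 := homogeneousComponent_mul_of_isHomogeneous (q := q) hp e
    rw [homogeneousComponent_of_mem hpq, if_neg he] at h2
    exact (mul_eq_zero.mp h2.symm).resolve_left hp0
  have h2 : ∃ e, homogeneousComponent e q ≠ 0 := by
    by_contra! h
    refine right_ne_zero_of_mul h0 ?_
    rw [← sum_homogeneousComponent q]
    exact Finset.sum_eq_zero fun i _ => h i
  obtain ⟨e, he⟩ := h2
  have hem : a + e = m := by_contra fun h => he (h1 e h)
  refine ⟨e, hem, ?_⟩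
  have h3 : q = homogeneousComponent e q := by
    conv_lhs => rw [← sum_homogeneousComponent q]
    refine Finset.sum_eq_single e (fun i _ hi => h1 i (by omega)) fun h => ?_
    exact homogeneousComponent_eq_zero _ _ (by simpa using h)
  rw [h3]
  exact homogeneousComponent_isHomogeneous e q

theorem isHomogeneous_zero_of_isUnit {p : MvPolynomial τ K} (hp : IsUnit p) : p.IsHomogeneous 0 := by
  obtain ⟨c, -, rfl⟩ := MvPolynomial.isUnit_iff_eq_C_of_isReduced.mp hp
  exact isHomogeneous_C _ c

theorem isHomogeneous_det {r : ℕ} {M : Matrix (Fin r) (Fin r) (MvPolynomial τ K)} {d : Fin r → ℕ}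
    (h : ∀ i j, (M i j).IsHomogeneous (d i)) : M.det.IsHomogeneous (∑ i, d i) := by
  rw [← Matrix.det_transpose, Matrix.det_apply]
  refine IsHomogeneous.sum _ _ _ fun σ _ => ?_
  have h1 : (∏ i, Mᵀ (σ i) i).IsHomogeneous (∑ i, d i) :=
    IsHomogeneous.prod _ _ _ fun i _ => h i (σ i)
  rcases Int.units_eq_one_or (Equiv.Perm.sign σ) with hs | hs
  · simpa [hs] using h1
  · simpa [hs] using h1.neg

variable {q : Type} [Fintype q] [DecidableEq q]

theorem isHomogeneous_orientFun_ιMulti {f f' : ℕ} (hf : f = Fintype.card q) (hff : f' = f)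
    (η : (⋀[MvPolynomial τ K]^f (q → MvPolynomial τ K)) ≃ₗ[MvPolynomial τ K] MvPolynomial τ K)
    {V : Fin f' → q → MvPolynomial τ K} {d : Fin f' → ℕ}
    (hV : ∀ i k, (V i k).IsHomogeneous (d i)) :
    (orientFun η (ExteriorAlgebra.ιMulti _ f' V)).IsHomogeneous (∑ i, d i) := by
  subst hff
  obtain ⟨y, hy⟩ : ∃ y : Fin f' → q, Function.Bijective y :=
    ⟨_, (Fintype.equivFinOfCardEq hf.symm).symm.bijective⟩
  rw [orientFun_ιMulti_eq_det η hy]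
  exact (isHomogeneous_det fun i j => hV i (y j)).mul
    (isHomogeneous_zero_of_isUnit (isUnit_orientation_basis η _))

theorem isHomogeneous_orientFun_mul_mul {f m₁ r m₂ e : ℕ} (hf : f = Fintype.card q)
    (hm : m₁ + r + m₂ = f)
    (η : (⋀[MvPolynomial τ K]^f (q → MvPolynomial τ K)) ≃ₗ[MvPolynomial τ K] MvPolynomial τ K)
    (w₁ : Fin m₁ → q) (w₂ : Fin m₂ → q) {V : Fin r → q → MvPolynomial τ K}
    (hV : ∀ i k, (V i k).IsHomogeneous e) :
    (orientFun η (ExteriorAlgebra.ιMulti _ m₁ (fun i => Pi.single (w₁ i) 1) *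
      ExteriorAlgebra.ιMulti _ r V *
      ExteriorAlgebra.ιMulti _ m₂ fun i => Pi.single (w₂ i) 1)).IsHomogeneous (r * e) := by
  rw [ExteriorAlgebra.ιMulti_mul_ιMulti, ExteriorAlgebra.ιMulti_mul_ιMulti]
  have hsingle : ∀ k k' : q, ((Pi.single k 1 : q → MvPolynomial τ K) k').IsHomogeneous 0 := by
    intro k k'
    rw [Pi.single_apply]
    split_ifs
    · exact isHomogeneous_one _ _
    · exact isHomogeneous_zero _ _ _
  have h := isHomogeneous_orientFun_ιMulti hf hm η
    (V := Fin.append (Fin.append (fun i => Pi.single (w₁ i) 1) V) fun i => Pi.single (w₂ i) 1)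
    (d := Fin.append (Fin.append (fun _ => 0) fun _ => e) fun _ => 0) (by
      intro i k
      refine Fin.addCases (fun i => ?_) (fun i => ?_) i
      · rw [Fin.append_left, Fin.append_left]
        refine Fin.addCases (fun i => ?_) (fun i => ?_) i
        · rw [Fin.append_left, Fin.append_left]; exact hsingle _ _
        · rw [Fin.append_right, Fin.append_right]; exact hV _ _
      · rw [Fin.append_right, Fin.append_right]; exact hsingle _ _)
  simpa [Fin.sum_univ_add] using h

variable {ι : ℕ → Type} [∀ t, Fintype (ι t)] [∀ t, DecidableEq (ι t)] {n : ℕ}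
  {α : ∀ t, Matrix (ι t) (ι (t + 1)) (MvPolynomial τ K)}
  {η : ∀ t, (⋀[MvPolynomial τ K]^(Fintype.card (ι t)) (ι t → MvPolynomial τ K)) ≃ₗ[MvPolynomial τ K]
    MvPolynomial τ K}

/-- Coefficients of `a t` are read off by wedging with unit vectors on both sides. The factorization
multiplies each of them by one coefficient `b` of `a (t + 1)`, of degree `s'` by induction, and
gives a form of degree `r`, since the entries of `α t` are linear. So the degree is `r - s'`, and a
nonvanishing coefficient shows that this is a natural number. -/
theorem IsMultiplierFamily.exists_isHomogeneous
    (hex : ∀ t, Function.Exact (α (t + 1)).mulVecLin (α t).mulVecLin)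
    (hempty : ∀ t, n < t → IsEmpty (ι t))
    (hα : ∀ t i j, (α t i j).IsHomogeneous 1)
    {a : ∀ t, ExteriorAlgebra (MvPolynomial τ K) (ι t → MvPolynomial τ K)}
    (ha : IsMultiplierFamily n α η a) (j : ℕ) : ∀ t, t + j = n →
    ∃ s : ℕ, (s : ℤ) = ∑ i ∈ Finset.range j, (-1) ^ i * (detRank (α (t + i)) : ℤ) ∧
      ∀ (m₁ m₂ : ℕ) (w₁ : Fin m₁ → ι t) (w₂ : Fin m₂ → ι t),
        m₁ + detRank (α t) + m₂ = Fintype.card (ι t) →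
        (orientFun (η t) (ExteriorAlgebra.ιMulti _ m₁ (fun i => Pi.single (w₁ i) 1) * a t *
          ExteriorAlgebra.ιMulti _ m₂ fun i => Pi.single (w₂ i) 1)).IsHomogeneous s := by
  induction j with
  | zero =>
    intro t ht
    refine ⟨0, by simp, fun m₁ m₂ w₁ w₂ hm => ?_⟩
    have := hempty (t + 1) (by omega)
    rw [detRank_eq_zero_of_isEmpty] at hm
    rw [ha.eq_one t (by omega)]
    have h1 := isHomogeneous_orientFun_mul_mul (r := 0) (e := 0) rfl hm (η t) w₁ w₂
      (V := Fin.elim0) (fun i => i.elim0)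
    simpa using h1
  | succ j ih =>
    intro t ht
    obtain ⟨s', hs', hhom⟩ := ih (t + 1) (by omega)
    have hcard := detRank_add_detRank_of_exact (hex t)
    have hminor := exists_minor_ne_zero (α t)
    set r := detRank (α t) with hrdef
    obtain ⟨u, v, h0⟩ := hminor
    have hle : r ≤ Fintype.card (ι t) := by
      simpa using Fintype.card_le_of_injective u (injective_of_det_submatrix_ne_zero h0)
    let b := orientFun (η (t + 1)) (a (t + 1) *
      ExteriorAlgebra.ιMulti _ r fun i => Pi.single (v i) 1)
    have hb : b.IsHomogeneous s' := by
      have := hhom 0 r Fin.elim0 v (by omega)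
      simpa using this
    have hW : ExteriorAlgebra.ιMulti (MvPolynomial τ K) r (fun i => (α t).col (v i)) = b • a t := by
      rw [← map_ιMulti_single]
      exact ha.factor t (by omega) _ (exteriorPower.ιMulti _ r fun i => Pi.single (v i) 1).2
    have hmul : ∀ x y, b * orientFun (η t) (x * a t * y) = orientFun (η t) (x *
        ExteriorAlgebra.ιMulti (MvPolynomial τ K) r (fun i => (α t).col (v i)) * y) := by
      intro x y
      rw [hW, mul_smul_comm, smul_mul_assoc, map_smul, smul_eq_mul]
    have hdeg : ∀ (m₁ m₂ : ℕ) (w₁ : Fin m₁ → ι t) (w₂ : Fin m₂ → ι t),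
        m₁ + r + m₂ = Fintype.card (ι t) →
        (b * orientFun (η t) (ExteriorAlgebra.ιMulti _ m₁ (fun i => Pi.single (w₁ i) 1) * a t *
          ExteriorAlgebra.ιMulti _ m₂ fun i => Pi.single (w₂ i) 1)).IsHomogeneous r := by
      intro m₁ m₂ w₁ w₂ hm
      rw [hmul]
      have := isHomogeneous_orientFun_mul_mul (e := 1) rfl hm (η t) w₁ w₂
        (V := fun i => (α t).col (v i)) fun i k => hα t k (v i)
      rwa [mul_one] at this
    obtain ⟨m, hm⟩ := Nat.exists_eq_add_of_le hle
    obtain ⟨z, hz⟩ := exists_bijective_append hm.symm (injective_of_det_submatrix_ne_zero h0)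
    obtain ⟨ε, hε, h⟩ := exists_isUnit_orientFun_mul hm.symm (η t) hz
    have hne : b * orientFun (η t) (a t *
        ExteriorAlgebra.ιMulti _ m fun i => Pi.single (z i) 1) ≠ 0 := by
      have h1 := hmul 1 (ExteriorAlgebra.ιMulti _ m fun i => Pi.single (z i) 1)
      rw [one_mul, one_mul, h] at h1
      rw [h1]
      exact mul_ne_zero hε.ne_zero h0
    obtain ⟨s, hs, -⟩ := exists_isHomogeneous_of_mul hb
      (by simpa using hdeg 0 m Fin.elim0 z (by omega)) hne
    refine ⟨s, ?_, fun m₁ m₂ w₁ w₂ hm' => ?_⟩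
    · rw [Finset.sum_range_succ']
      have h1 : ∑ i ∈ Finset.range j, (-1 : ℤ) ^ (i + 1) * (detRank (α (t + (i + 1))) : ℤ) =
          -∑ i ∈ Finset.range j, (-1) ^ i * (detRank (α (t + 1 + i)) : ℤ) := by
        rw [← Finset.sum_neg_distrib]
        refine Finset.sum_congr rfl fun i _ => ?_
        rw [show t + (i + 1) = t + 1 + i by omega, pow_succ]
        ring
      rw [h1, ← hs', add_zero, pow_zero, one_mul, ← hrdef]
      omega
    · by_cases h1 : b * orientFun (η t) (ExteriorAlgebra.ιMulti _ m₁
          (fun i => Pi.single (w₁ i) 1) * a t *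
          ExteriorAlgebra.ιMulti _ m₂ fun i => Pi.single (w₂ i) 1) = 0
      · rw [(mul_eq_zero.mp h1).resolve_left (left_ne_zero_of_mul hne)]
        exact isHomogeneous_zero _ _ _
      · obtain ⟨s₂, h2, h3⟩ := exists_isHomogeneous_of_mul hb (hdeg m₁ m₂ w₁ w₂ hm') h1
        rwa [show s = s₂ by omega]

end

theorem isHomogeneous_koszulMatrix_symEquation {K : Type u} [Field K] {n m : ℕ}
    (φ : Matrix (Fin m) (Fin n) (MvPolynomial (Fin n) K)) (e : Fin n → ℕ) (k t : ℕ)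
    (i : KoszulIndex e k t) (j : KoszulIndex e k (t + 1)) :
    (koszulMatrix (symEquation φ) e k t i j).IsHomogeneous 1 := by
  rw [koszulMatrix]
  refine IsHomogeneous.sum _ _ _ fun c _ => ?_
  split_ifs
  · have h1 : ∀ x : Fin n →₀ ℕ, (coeff x (symEquation φ c)).IsHomogeneous 1 := by
      intro x
      rw [symEquation, coeff_sum]
      refine IsHomogeneous.sum _ _ _ fun i _ => ?_
      rw [coeff_C_mul, coeff_map]
      exact (isHomogeneous_X K i).mul (isHomogeneous_C _ _)
    rw [coeff_monomial_mul', one_mul]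
    have h2 : ((-1 : MvPolynomial (Fin m) K) ^ (j.1.1.filter (· < c)).card).IsHomogeneous 0 := by
      have := ((isHomogeneous_one (Fin m) K).neg).pow (j.1.1.filter (· < c)).card
      rwa [zero_mul] at this
    have h3 : (if j.1.2 ≤ i.1.2 then coeff (i.1.2 - j.1.2) (symEquation φ c) else 0).IsHomogeneous
        1 := by
      split_ifs
      · exact h1 _
      · exact isHomogeneous_zero _ _ _
    have h4 := h2.mul h3
    rwa [zero_add] at h4
  · exact isHomogeneous_zero _ _ _

section

open RingTheory.Sequence

/-! ### Acyclicity by grades -/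

/-- A power of each element of `I(N'')` multiplies `ker N` into the range of `N'` if this holds for
the minors. -/
theorem exists_pow_smul_of_mem_minorsIdeal {A : Type*} [CommRing A] {p q o p' q' : Type*}
    [Fintype q] [Fintype o] {N : Matrix p q A} {N' : Matrix q o A} {N'' : Matrix p' q' A} {t : ℕ}
    (h : ∀ (u : Fin t → p') (v : Fin t → q') (z : q → A), N.mulVec z = 0 →
      ∃ (k : ℕ) (w : o → A), N'.mulVec w = (N''.submatrix u v).det ^ k • z)
    {y : A} (hy : y ∈ minorsIdeal N'' t) {z : q → A} (hz : N.mulVec z = 0) :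
    ∃ (k : ℕ) (w : o → A), N'.mulVec w = y ^ k • z := by
  let J : Ideal A := Submodule.comap (LinearMap.toSpanSingleton A (q → A) z)
    (LinearMap.range N'.mulVecLin)
  have hle : minorsIdeal N'' t ≤ J.radical := by
    rw [minorsIdeal, Ideal.span_le]
    rintro _ ⟨u, v, rfl⟩
    exact h u v z hz
  exact hle hy

/-- Let `D` be a complex of finite free modules over a domain that is exact from the third place on.
If `I(D 2)` supports its homology at the first two places and the grade of `I(D (t + 2))` is at
least `t + 3`, then `D` is exact at these places, too. -/
theorem exact_of_le_grade_rankIdeal {A : Type u} [CommRing A] [IsDomain A] {κ : ℕ → Type}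
    [∀ t, Fintype (κ t)] [∀ t, DecidableEq (κ t)] {D : ∀ t, Matrix (κ t) (κ (t + 1)) A}
    (hD : ∀ t, D t * D (t + 1) = 0)
    (hex : ∀ t, Function.Exact (D (t + 3)).mulVecLin (D (t + 2)).mulVecLin) {n : ℕ}
    (hempty : IsEmpty (κ (n + 3)))
    (hgrade : ∀ t, t < n → ((t + 3 : ℕ) : ℕ∞) ≤ grade (rankIdeal (D (t + 2))))
    (hbase : ∀ y ∈ rankIdeal (D 2), ∀ i, i < 2 → ∀ z, (D i).mulVec z = 0 →
      ∃ (k : ℕ) (w : κ (i + 2) → A), (D (i + 1)).mulVec w = y ^ k • z) :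
    ∀ i, i < 2 → Function.Exact (D (i + 1)).mulVecLin (D i).mulVecLin := by
  have hDz : ∀ t x, (D t).mulVec ((D (t + 1)).mulVec x) = 0 := by
    intro t x
    rw [Matrix.mulVec_mulVec, hD, Matrix.zero_mulVec]
  -- The ideal whose elements have powers killing the homology is moved up the complex, from `I(D
  -- 2)` to `I(D (n + 2))`. The last is the unit ideal, because the source of `D (n + 2)` is zero.
  have key : ∀ j, j ≤ n → ∀ y ∈ rankIdeal (D (j + 2)), ∀ i, i < 2 → ∀ z, (D i).mulVec z = 0 →
      ∃ (k : ℕ) (w : κ (i + 2) → A), (D (i + 1)).mulVec w = y ^ k • z := by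
    intro j
    induction j with
    | zero => intro _; exact hbase
    | succ j ih =>
      intro hj y hy i hi z hz
      refine exists_pow_smul_of_mem_minorsIdeal (fun u v z hz => ?_) hy hz
      set c := ((D (j + 1 + 2)).submatrix u v).det with hc
      by_cases hc0 : c = 0
      · exact ⟨1, 0, by rw [hc0]; simp⟩
      -- Inverting a maximal minor of `D (j + 3)` makes its cokernel free. A regular sequence of
      -- length `j + 3` in `I(D (j + 2))` then meets the hypotheses of `exact_of_isWeaklyRegular`,
      -- so the homology vanishes after inverting `c`.
      let B := Localization.Away c
      have hM : Submonoid.powers c ≤ nonZeroDivisors A :=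
        powers_le_nonZeroDivisors_of_noZeroDivisors hc0
      have hinj : Function.Injective (algebraMap A B) := IsLocalization.injective B hM
      have hBdom : IsDomain B := IsLocalization.isDomain_of_le_nonZeroDivisors B hM
      obtain ⟨rs, hlen, hrs, hmem⟩ := exists_isWeaklyRegular_of_le_gradeOn (hgrade j (by omega))
      have hrs' : IsWeaklyRegular B (rs.map (algebraMap A B)) :=
        IsWeaklyRegular.of_isLocalization B (Submonoid.powers c) hrs
      have hdet : ∀ {s : ℕ} (u : Fin s → κ (j + 3)) (v : Fin s → κ (j + 4)),
          (((D (j + 3)).map (algebraMap A B)).submatrix u v).det =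
            algebraMap A B ((D (j + 3)).submatrix u v).det := by
        intro s u v
        rw [Matrix.submatrix_map, ← RingHom.mapMatrix_apply, ← RingHom.map_det]
      have hπ : ∀ m, m = j + 3 → ∃ π : (κ m → B) →ₗ[B] ({k // k ∉ Set.range u} → B),
          Function.Surjective π ∧ Function.Exact ((D m).map (algebraMap A B)).mulVecLin π := by
        rintro m rfl
        refine exists_exact_of_isUnit_minor (u := u) (v := v) (fun u v => ?_) ?_
        · rw [hdet, minor_eq_zero_of_detRank_lt _ (Nat.lt_succ_self _) u v, map_zero]
        · rw [hdet]
          exact IsLocalization.Away.algebraMap_isUnit c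
      have hlen' : (rs.map (algebraMap A B)).length = j + 3 := by simpa using hlen
      obtain ⟨π, hsurj, hπex⟩ := hπ _ hlen'
      have hcomp : ∀ t x, ((D t).map (algebraMap A B)).mulVec
          (((D (t + 1)).map (algebraMap A B)).mulVec x) = 0 := by
        intro t x
        rw [Matrix.mulVec_mulVec, ← Matrix.map_mul, hD]
        simp
      have hexact := exact_of_isWeaklyRegular (rs.map (algebraMap A B)) (C := fun t => κ t → B)
        (fun t => ((D t).map (algebraMap A B)).mulVecLin) (fun t x => hcomp t x)
        π hsurj hπex (fun _ _ => isWeaklyRegular_of_flat hrs') (isWeaklyRegular_of_flat hrs') (by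
          intro y hy s _ x hx
          rcases Nat.lt_or_ge s 2 with hs | hs
          · obtain ⟨y, hy', rfl⟩ := List.mem_map.mp hy
            obtain ⟨a, x', hx'⟩ := exists_smul_eq_algebraMap_comp (B := B) (Submonoid.powers c) x
            have h1 : (D s).mulVec x' = 0 := by
              have h2 : algebraMap A B ∘ (D s).mulVec x' = 0 := by
                rw [← mulVec_map_comp, ← hx', Matrix.mulVec_smul, ← Matrix.mulVecLin_apply, hx,
                  smul_zero]
              exact funext fun i => hinj (by simpa using congrFun h2 i)
            obtain ⟨N, w, hw⟩ := ih (by omega) y (hmem y hy') s hs x' h1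
            obtain ⟨b, hb⟩ := (IsLocalization.map_units B a).exists_left_inv
            refine ⟨N, b • algebraMap A B ∘ w, ?_⟩
            have h3 : algebraMap A B ∘ (y ^ N • x') = algebraMap A B y ^ N • algebraMap A B ∘ x' := by
              ext; simp
            rw [Matrix.mulVecLin_apply, Matrix.mulVec_smul, mulVec_map_comp, hw, h3, ← hx',
              smul_comm b, smul_smul b, hb, one_smul]
          · obtain ⟨s, rfl⟩ := Nat.exists_eq_add_of_le' hs
            obtain ⟨w, hw⟩ := (exact_mulVecLin_map (hex s) (Submonoid.powers c) hinj x).mp hx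
            exact ⟨0, w, by simpa using hw⟩)
      have h1 : ((D i).map (algebraMap A B)).mulVec (algebraMap A B ∘ z) = 0 := by
        rw [mulVec_map_comp, hz]
        ext; simp
      obtain ⟨w, hw⟩ := (hexact i (by omega) _).mp h1
      obtain ⟨⟨_, k, rfl⟩, w', hw'⟩ :=
        exists_smul_eq_algebraMap_comp (B := B) (Submonoid.powers c) w
      refine ⟨k, w', ?_⟩
      have h2 : algebraMap A B ∘ (D (i + 1)).mulVec w' = algebraMap A B ∘ (c ^ k • z) := by
        rw [← mulVec_map_comp, ← hw', Matrix.mulVec_smul, ← Matrix.mulVecLin_apply, hw]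
        ext; simp
      exact funext fun s => hinj (congrFun h2 s)
  intro i hi z
  have := hempty
  have h1 : (1 : A) ∈ rankIdeal (D (n + 2)) := by
    rw [rankIdeal, detRank_eq_zero_of_isEmpty, minorsIdeal_zero]
    trivial
  constructor
  · intro hz
    obtain ⟨k, w, hw⟩ := key n le_rfl 1 h1 i hi z hz
    exact ⟨w, by simpa using hw⟩
  · rintro ⟨w, rfl⟩
    exact hDz i w

end

/-! ### The bilinear form of a multiplier of corank two -/

section

variable {A : Type u} [CommRing A]

theorem ι_mul_ιMulti {F : Type*} [AddCommGroup F] [Module A F] (x : F) {r : ℕ} (V : Fin r → F) :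
    ExteriorAlgebra.ι A x * ExteriorAlgebra.ιMulti A r V =
      (-1) ^ r * (ExteriorAlgebra.ιMulti A r V * ExteriorAlgebra.ι A x) := by
  induction r with
  | zero => simp
  | succ r ih =>
    have h1 : ExteriorAlgebra.ι A x * ExteriorAlgebra.ι A (V 0) =
        -(ExteriorAlgebra.ι A (V 0) * ExteriorAlgebra.ι A x) :=
      eq_neg_of_add_eq_zero_left (ExteriorAlgebra.ι_add_mul_swap x (V 0))
    have h2 : Commute ((-1 : ExteriorAlgebra A F) ^ r) (ExteriorAlgebra.ι A (V 0)) :=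
      (Commute.neg_one_left _).pow_left r
    rw [ExteriorAlgebra.ιMulti_succ_apply, ← mul_assoc, h1, neg_mul, mul_assoc, ih, ← mul_assoc,
      ← h2.eq, pow_succ]
    simp [mul_assoc]

theorem ι_mul_of_mem {F : Type*} [AddCommGroup F] [Module A F] (x : F) {r : ℕ}
    {a : ExteriorAlgebra A F} (ha : a ∈ ⋀[A]^r F) :
    ExteriorAlgebra.ι A x * a = (-1) ^ r * (a * ExteriorAlgebra.ι A x) := by
  have h : a ∈ Submodule.span A (Set.range (ExteriorAlgebra.ιMulti A r (M := F))) := by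
    rwa [ExteriorAlgebra.ιMulti_span_fixedDegree]
  clear ha
  induction h using Submodule.span_induction with
  | mem a h =>
    obtain ⟨V, rfl⟩ := h
    exact ι_mul_ιMulti x V
  | zero => simp
  | add a b _ _ ha hb => simp only [mul_add, add_mul, ha, hb]
  | smul c a _ ha => rw [mul_smul_comm, ha, smul_mul_assoc, mul_smul_comm]

/-- The bilinear form `(x, y) ↦ ω (x ∧ a ∧ y)`. -/
def wedgeForm {F : Type*} [AddCommGroup F] [Module A F] (ω : ExteriorAlgebra A F →ₗ[A] A)
    (a : ExteriorAlgebra A F) : F →ₗ[A] F →ₗ[A] A :=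
  LinearMap.mk₂ A (fun x y => ω (ExteriorAlgebra.ι A x * a * ExteriorAlgebra.ι A y))
    (by intros; simp [add_mul]) (by intros; simp) (by intros; simp [mul_add]) (by intros; simp)

theorem wedgeForm_apply {F : Type*} [AddCommGroup F] [Module A F]
    (ω : ExteriorAlgebra A F →ₗ[A] A) (a : ExteriorAlgebra A F) (x y : F) :
    wedgeForm ω a x y = ω (ExteriorAlgebra.ι A x * a * ExteriorAlgebra.ι A y) := rfl

/-- Moving `x` past `a` costs the sign `(-1)^r` and shows that the form is alternating. -/
theorem wedgeForm_eq_of_mem {F : Type*} [AddCommGroup F] [Module A F]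
    (ω : ExteriorAlgebra A F →ₗ[A] A) {a : ExteriorAlgebra A F} {r : ℕ} (ha : a ∈ ⋀[A]^r F)
    (x y : F) :
    wedgeForm ω a x y = (-1) ^ r * ω (a * ExteriorAlgebra.ιMulti A 2 ![x, y]) := by
  have h : ((-1 : ExteriorAlgebra A F) ^ r) = algebraMap A _ ((-1) ^ r) := by simp
  rw [wedgeForm_apply, ι_mul_of_mem x ha, h, mul_assoc, ← Algebra.smul_def, map_smul, smul_eq_mul]
  congr 2
  rw [ExteriorAlgebra.ιMulti_succ_apply, ExteriorAlgebra.ιMulti_succ_apply]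
  simp [mul_assoc]

theorem wedgeForm_swap {F : Type*} [AddCommGroup F] [Module A F]
    (ω : ExteriorAlgebra A F →ₗ[A] A) {a : ExteriorAlgebra A F} {r : ℕ} (ha : a ∈ ⋀[A]^r F)
    (x y : F) : wedgeForm ω a x y = -wedgeForm ω a y x := by
  have h := (ExteriorAlgebra.ιMulti A 2).map_swap ![y, x] (i := 0) (j := 1) (by decide)
  have h1 : ![y, x] ∘ Equiv.swap (0 : Fin 2) 1 = ![x, y] := by
    ext i
    fin_cases i <;> simp
  rw [h1] at h
  rw [wedgeForm_eq_of_mem _ ha, wedgeForm_eq_of_mem _ ha, h, mul_neg, map_neg, mul_neg]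

theorem wedgeForm_self {F : Type*} [AddCommGroup F] [Module A F]
    (ω : ExteriorAlgebra A F →ₗ[A] A) {a : ExteriorAlgebra A F} {r : ℕ} (ha : a ∈ ⋀[A]^r F)
    (x : F) : wedgeForm ω a x x = 0 := by
  rw [wedgeForm_eq_of_mem _ ha, ExteriorAlgebra.ιMulti_eq_zero_of_not_inj, mul_zero, map_zero,
    mul_zero]
  intro hinj
  exact absurd (hinj (a₁ := 0) (a₂ := 1) rfl) (by decide)

theorem exists_det_smul_mulVec_eq_sum {p q : Type*} [Fintype q] {N : Matrix p q A} {r : ℕ}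
    (hN : ∀ (u : Fin (r + 1) → p) (v : Fin (r + 1) → q), (N.submatrix u v).det = 0)
    (u : Fin r → p) (v : Fin r → q) (h : (N.submatrix u v).det ∈ nonZeroDivisors A) (y : q → A) :
    ∃ m : Fin r → A, (N.submatrix u v).det • N.mulVec y = ∑ j, m j • N.col (v j) := by
  classical
  have h1 := det_smul_mulVec_eq_zero hN u v
    (y := (N.submatrix u v).det • y -
      ∑ j, (N.submatrix u v).cramer (N.mulVec y ∘ u) j • Pi.single (v j) 1)
    (fun i => by
      rw [Matrix.mulVec_sub, Matrix.mulVec_smul, Pi.sub_apply, mulVec_sum_single_cramer]; simp)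
  have h2 : N.mulVec ((N.submatrix u v).det • y -
      ∑ j, (N.submatrix u v).cramer (N.mulVec y ∘ u) j • Pi.single (v j) 1) = 0 :=
    funext fun i => (mem_nonZeroDivisors_iff.mp h).1 _ (congrFun h1 i)
  rw [Matrix.mulVec_sub, Matrix.mulVec_smul, sub_eq_zero] at h2
  refine ⟨(N.submatrix u v).cramer (N.mulVec y ∘ u), ?_⟩
  rw [h2, Matrix.mulVec_sum]
  exact Finset.sum_congr rfl fun j _ => by rw [Matrix.mulVec_smul, Matrix.mulVec_single_one]

variable {p q : Type} [Fintype p] [DecidableEq p]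
  {N : Matrix p q A} {a : ExteriorAlgebra A (p → A)} {f r : ℕ} {η : (⋀[A]^f (p → A)) ≃ₗ[A] A}

theorem exists_isUnit_wedgeForm (hs : r + 2 = f) (ha : a ∈ ⋀[A]^r (p → A))
    (hdiv : DividesColumns N r a) {u : Fin r → p} (v : Fin r → q) {z : Fin 2 → p}
    (hz : Function.Bijective (Fin.append u z)) :
    ∃ b ε : A, IsUnit ε ∧ b * wedgeForm (orientFun η) a (Pi.single (z 0) 1) (Pi.single (z 1) 1) =
      ε * (N.submatrix u v).det := by
  obtain ⟨ε, hε, h⟩ := exists_isUnit_orientFun_mul hs η hz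
  obtain ⟨b, hb⟩ := hdiv v
  refine ⟨b, (-1) ^ r * ε, (isUnit_one.neg.pow r).mul hε, ?_⟩
  have h1 := h fun i => N.col (v i)
  rw [hb, smul_mul_assoc, map_smul, smul_eq_mul] at h1
  have h2 : (fun i => Pi.single (z i) 1 : Fin 2 → p → A) =
      ![Pi.single (z 0) 1, Pi.single (z 1) 1] := by
    ext i j
    fin_cases i <;> rfl
  rw [h2] at h1
  rw [wedgeForm_eq_of_mem _ ha, mul_left_comm, h1, mul_assoc]
  rfl

theorem wedgeForm_col_right [IsDomain A] (hs : r + 2 = f) (hf : f = Fintype.card p) (ha : a ∈ ⋀[A]^r (p → A))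
    (hdiv : DividesColumns N r a) {u : Fin r → p} {v : Fin r → q}
    (h0 : (N.submatrix u v).det ≠ 0) (x : p → A) (j : Fin r) :
    wedgeForm (orientFun η) a x (N.col (v j)) = 0 := by
  have h := orientFun_mul_update_eq_zero (η := η) hs hf hdiv h0 ![x, x] 1 j
  have h1 : Function.update ![x, x] 1 (N.col (v j)) = ![x, N.col (v j)] := by
    ext i j
    fin_cases i <;> simp
  rw [h1] at h
  rw [wedgeForm_eq_of_mem _ ha, h, mul_zero]

variable [Fintype q] [DecidableEq q]

/-- Up to a nonzero minor every element of the image is a combination of the columns of that minor,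
which the form kills. -/
theorem wedgeForm_mulVec_right [IsDomain A] (hs : r + 2 = f) (hf : f = Fintype.card p)
    (ha : a ∈ ⋀[A]^r (p → A)) (hdiv : DividesColumns N r a) (hr : r = detRank N) (x : p → A)
    (y : q → A) : wedgeForm (orientFun η) a x (N.mulVec y) = 0 := by
  subst hr
  obtain ⟨u, v, h0⟩ := exists_minor_ne_zero N
  obtain ⟨m, hm⟩ := exists_det_smul_mulVec_eq_sum
    (fun u v => minor_eq_zero_of_detRank_lt N (Nat.lt_succ_self _) u v) u v
    (mem_nonZeroDivisors_of_ne_zero h0) y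
  refine (mul_eq_zero_iff_left h0).mp ?_
  rw [← smul_eq_mul, ← map_smul, hm, map_sum]
  refine Finset.sum_eq_zero fun j _ => ?_
  rw [map_smul, wedgeForm_col_right hs hf ha hdiv h0, smul_zero]

/-- A functional that vanishes on the image of `N` is represented by the form, up to a minor. -/
theorem exists_wedgeForm_eq_det_smul [IsDomain A] (hs : r + 2 = f) (hf : f = Fintype.card p)
    (ha : a ∈ ⋀[A]^r (p → A)) (hdiv : DividesColumns N r a) {u : Fin r → p} {v : Fin r → q}
    (h0 : (N.submatrix u v).det ≠ 0) {g : (p → A) →ₗ[A] A} (hg : ∀ y, g (N.mulVec y) = 0) :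
    ∃ x, wedgeForm (orientFun η) a x = (N.submatrix u v).det • g := by
  obtain ⟨z, hz⟩ := exists_bijective_append (hs.trans hf) (injective_of_det_submatrix_ne_zero h0)
  obtain ⟨b, ε, hε, hb⟩ := exists_isUnit_wedgeForm (η := η) hs ha hdiv v hz
  obtain ⟨ε', hε'⟩ := hε.exists_left_inv
  set c := (N.submatrix u v).det with hc
  -- Modulo the columns `v` the form has rank two, with single entry `γ = β(e_(z 0), e_(z 1))` and
  -- `b γ = ε c`. Inverting this skew `2 × 2` matrix up to the factor `c` gives `x`.
  let x : p → A := (ε' * b) • (g (Pi.single (z 1) 1) • Pi.single (z 0) 1 -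
    g (Pi.single (z 0) 1) • Pi.single (z 1) 1)
  have hx0 : wedgeForm (orientFun η) a x (Pi.single (z 0) 1) = c * g (Pi.single (z 0) 1) := by
    simp only [x, map_smul, map_sub, LinearMap.smul_apply, LinearMap.sub_apply, wedgeForm_self _ ha, smul_eq_mul]
    rw [wedgeForm_swap _ ha]
    linear_combination (ε' * g (Pi.single (z 0) 1)) * hb + c * g (Pi.single (z 0) 1) * hε'
  have hx1 : wedgeForm (orientFun η) a x (Pi.single (z 1) 1) = c * g (Pi.single (z 1) 1) := by
    simp only [x, map_smul, map_sub, LinearMap.smul_apply, LinearMap.sub_apply, wedgeForm_self _ ha, smul_eq_mul]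
    linear_combination (ε' * g (Pi.single (z 1) 1)) * hb + c * g (Pi.single (z 1) 1) * hε'
  refine ⟨x, LinearMap.ext fun y => ?_⟩
  obtain ⟨m, m', hm⟩ := det_smul_eq_mulVec_add_sum N hz v y
  have hgcol : ∀ j, g (N.col (v j)) = 0 := by
    intro j
    rw [← Matrix.mulVec_single_one]
    exact hg _
  rw [← hc] at hm
  refine mul_left_cancel₀ h0 ?_
  have h1 : c * (c • g) y = (c • g) (c • y) := by rw [map_smul, smul_eq_mul]
  rw [h1, ← smul_eq_mul, ← map_smul, hm]
  simp only [map_add, map_sum, map_smul, wedgeForm_col_right hs hf ha hdiv h0, hgcol, mul_zero,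
    Finset.sum_const_zero, zero_add, LinearMap.smul_apply, Fin.sum_univ_two, hx0, hx1, smul_eq_mul]

/-- The radical of the form is the image of `N`, up to a minor. -/
theorem exists_mulVec_eq_det_smul [IsDomain A] (hs : r + 2 = f) (hf : f = Fintype.card p)
    (ha : a ∈ ⋀[A]^r (p → A)) (hdiv : DividesColumns N r a) {u : Fin r → p} {v : Fin r → q}
    (h0 : (N.submatrix u v).det ≠ 0) {x : p → A} (hx : wedgeForm (orientFun η) a x = 0) :
    ∃ y, N.mulVec y = (N.submatrix u v).det • x := by
  obtain ⟨z, hz⟩ := exists_bijective_append (hs.trans hf) (injective_of_det_submatrix_ne_zero h0)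
  obtain ⟨b, ε, hε, hb⟩ := exists_isUnit_wedgeForm (η := η) hs ha hdiv v hz
  have hγ : wedgeForm (orientFun η) a (Pi.single (z 0) 1) (Pi.single (z 1) 1) ≠ 0 :=
    right_ne_zero_of_mul (hb ▸ mul_ne_zero hε.ne_zero h0)
  obtain ⟨m, m', hm⟩ := det_smul_eq_mulVec_add_sum N hz v x
  have hw : ∀ w, wedgeForm (orientFun η) a ((N.submatrix u v).det • x) w = 0 := by
    intro w
    rw [map_smul, hx, smul_zero, LinearMap.zero_apply]
  have hcol : ∀ j w, wedgeForm (orientFun η) a (N.col (v j)) w = 0 := by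
    intro j w
    rw [wedgeForm_swap _ ha, wedgeForm_col_right hs hf ha hdiv h0, neg_zero]
  rw [hm] at hw
  simp only [map_add, map_sum, map_smul, LinearMap.add_apply, LinearMap.sum_apply,
    LinearMap.smul_apply, hcol, smul_zero, Finset.sum_const_zero, zero_add, Fin.sum_univ_two] at hw
  -- Modulo the columns, `c x` is a combination of `e_(z 0)` and `e_(z 1)`; pairing it with each of
  -- them isolates a coefficient times `γ ≠ 0`.
  have h1 : m' 0 = 0 := by
    have := hw (Pi.single (z 1) 1)
    rw [wedgeForm_self _ ha, smul_zero, add_zero] at this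
    exact (mul_eq_zero.mp this).resolve_right hγ
  have h2 : m' 1 = 0 := by
    have := hw (Pi.single (z 0) 1)
    rw [wedgeForm_self _ ha, smul_zero, zero_add, wedgeForm_swap _ ha, smul_neg, neg_eq_zero] at this
    exact (mul_eq_zero.mp this).resolve_right hγ
  refine ⟨∑ j, m j • Pi.single (v j) 1, ?_⟩
  rw [hm, Fin.sum_univ_two, h1, h2, zero_smul, zero_smul, add_zero, add_zero, Matrix.mulVec_sum]
  exact Finset.sum_congr rfl fun j _ => by rw [Matrix.mulVec_smul, Matrix.mulVec_single_one]

end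

/-! ### The dual of a presentation of rank two -/

/-- The index types of a resolution, preceded by those of the dual of its presentation. -/
def dualIndex (ι : ℕ → Type) : ℕ → Type
  | 0 => ι 1
  | 1 => ι 0
  | t + 2 => ι t

instance (ι : ℕ → Type) [∀ t, Fintype (ι t)] : ∀ t, Fintype (dualIndex ι t)
  | 0 => inferInstanceAs (Fintype (ι 1))
  | 1 => inferInstanceAs (Fintype (ι 0))
  | t + 2 => inferInstanceAs (Fintype (ι t))

instance (ι : ℕ → Type) [∀ t, DecidableEq (ι t)] : ∀ t, DecidableEq (dualIndex ι t)
  | 0 => inferInstanceAs (DecidableEq (ι 1))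
  | 1 => inferInstanceAs (DecidableEq (ι 0))
  | t + 2 => inferInstanceAs (DecidableEq (ι t))

/-- A resolution spliced with the dual of its presentation by a matrix `Ψ`. -/
def dualSplice {A : Type*} {ι : ℕ → Type} (α : ∀ t, Matrix (ι t) (ι (t + 1)) A)
    (Ψ : Matrix (ι 0) (ι 0) A) : ∀ t, Matrix (dualIndex ι t) (dualIndex ι (t + 1)) A
  | 0 => (α 0)ᵀ
  | 1 => Ψ
  | t + 2 => α t

/-- This is exactness at `F_0^*` of the complex `⋯ → F_1 → F_0 → F_0^* → F_1^*`. Here `α t` occupies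
the place `t + 2`, for which the acyclicity criterion wants grade at least `t + 3`, as assumed. At
`F_0` and `F_0^*` the homology is killed by the maximal minors of `α 0`, which starts the induction
in `exact_of_le_grade_rankIdeal`. -/
theorem exists_wedgeForm_eq {A : Type u} [CommRing A] [IsDomain A] {ι : ℕ → Type}
    [∀ t, Fintype (ι t)] [∀ t, DecidableEq (ι t)] {α : ∀ t, Matrix (ι t) (ι (t + 1)) A}
    (hex : ∀ t, Function.Exact (α (t + 1)).mulVecLin (α t).mulVecLin) {n : ℕ}
    (hempty : ∀ t, n < t → IsEmpty (ι t))
    (hgrade : ∀ t, t < n → ((t + 1 + 2 : ℕ) : ℕ∞) ≤ grade (rankIdeal (α t)))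
    (hcard : detRank (α 0) + 2 = Fintype.card (ι 0))
    (η : (⋀[A]^(Fintype.card (ι 0)) (ι 0 → A)) ≃ₗ[A] A) {a : ExteriorAlgebra A (ι 0 → A)}
    (ha : a ∈ ⋀[A]^(detRank (α 0)) (ι 0 → A)) (hdiv : DividesColumns (α 0) (detRank (α 0)) a)
    {g : (ι 0 → A) →ₗ[A] A} (hg : ∀ y, g ((α 0).mulVec y) = 0) :
    ∃ x, wedgeForm (orientFun η) a x = g := by
  let β := wedgeForm (orientFun η) a
  let Ψ : Matrix (ι 0) (ι 0) A := Matrix.of fun i j => β (Pi.single j 1) (Pi.single i 1)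
  have hΨ : ∀ x i, Ψ.mulVec x i = β x (Pi.single i 1) := by
    intro x i
    conv_rhs => rw [pi_eq_sum_univ' x]
    simp [Ψ, Matrix.mulVec, dotProduct, mul_comm]
  have hT : ∀ (g : (ι 0 → A) →ₗ[A] A) j,
      (α 0)ᵀ.mulVec (fun i => g (Pi.single i 1)) j = g ((α 0).col j) := by
    intro g j
    conv_rhs => rw [pi_eq_sum_univ' ((α 0).col j)]
    simp [Matrix.mulVec, dotProduct]
  have hβ : ∀ x y, β x ((α 0).mulVec y) = 0 := wedgeForm_mulVec_right hcard rfl ha hdiv rfl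
  have hmat : ∀ {p q o : Type} [Fintype q] [Fintype o] [DecidableEq o] (N : Matrix p q A)
      (N' : Matrix q o A), (∀ x, N.mulVec (N'.mulVec x) = 0) → N * N' = 0 := by
    intro p q o _ _ _ N N' h
    ext i j
    have := congrFun (h (Pi.single j 1)) i
    rwa [Matrix.mulVec_mulVec, Matrix.mulVec_single_one] at this
  have hvec : ∀ g g' : (ι 0 → A) →ₗ[A] A, (∀ i, g (Pi.single i 1) = g' (Pi.single i 1)) → g = g' :=
    fun g g' h => LinearMap.pi_ext' fun i => LinearMap.ext_ring (h i)
  have hfun : ∀ h : ι 0 → A, ∃ g : (ι 0 → A) →ₗ[A] A, ∀ i, g (Pi.single i 1) = h i :=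
    fun h => ⟨Fintype.linearCombination A h, fun i => by simp⟩
  have hT0 : ∀ g : (ι 0 → A) →ₗ[A] A,
      (α 0)ᵀ.mulVec (fun i => g (Pi.single i 1)) = 0 ↔ ∀ y, g ((α 0).mulVec y) = 0 := by
    intro g
    constructor
    · intro h y
      have h1 : g ∘ₗ (α 0).mulVecLin = 0 := LinearMap.pi_ext' fun j => LinearMap.ext_ring (by
        simpa [hT] using congrFun h j)
      exact LinearMap.congr_fun h1 y
    · intro h
      ext j
      rw [hT, ← Matrix.mulVec_single_one, h]
      rfl
  have hΨT : ∀ (r : ℕ) (u : Fin r → ι 0) (v : Fin r → ι 1), r = detRank (α 0) →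
      ((α 0).submatrix u v).det ≠ 0 → ∀ z, (α 0)ᵀ.mulVec z = 0 →
      ∃ x, Ψ.mulVec x = ((α 0).submatrix u v).det • z := by
    rintro r u v rfl h0 z hz
    obtain ⟨g, hgz⟩ := hfun z
    obtain rfl : (fun i => g (Pi.single i 1)) = z := funext hgz
    obtain ⟨x, hx⟩ := exists_wedgeForm_eq_det_smul (η := η) (g := g) hcard rfl ha hdiv h0
      ((hT0 g).mp hz)
    exact ⟨x, funext fun i => (hΨ x i).trans (LinearMap.congr_fun hx _)⟩
  have hΨN : ∀ (r : ℕ) (u : Fin r → ι 0) (v : Fin r → ι 1), r = detRank (α 0) →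
      ((α 0).submatrix u v).det ≠ 0 → ∀ z, Ψ.mulVec z = 0 →
      ∃ y, (α 0).mulVec y = ((α 0).submatrix u v).det • z := by
    rintro r u v rfl h0 z hz
    exact exists_mulVec_eq_det_smul (η := η) hcard rfl ha hdiv h0
      (hvec _ _ fun i => (hΨ z i).symm.trans (congrFun hz i))
  have hexact := exact_of_le_grade_rankIdeal (D := dualSplice α Ψ) (n := n) (by
      intro t
      match t with
      | 0 =>
        refine hmat (α 0)ᵀ Ψ fun x => ?_
        rw [funext (hΨ x), hT0]
        exact hβ x
      | 1 =>
        refine hmat Ψ (α 0) fun x => ?_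
        -- The form is known to vanish on the image of `α 0` in the second argument; skew symmetry
        -- moves this to the first.
        ext i
        rw [hΨ, wedgeForm_swap _ ha]
        exact neg_eq_zero.mpr (hβ _ _)
      | t + 2 =>
        exact hmat (α t) (α (t + 1)) fun x => (hex t).apply_apply_eq_zero x)
    hex (hempty (n + 1) (by omega)) hgrade (by
      intro y hy i hi z hz
      refine exists_pow_smul_of_mem_minorsIdeal (N'' := α 0) (fun u v z hz => ?_) hy hz
      by_cases h0 : ((α 0).submatrix u v).det = 0
      · exact ⟨1, 0, by rw [h0]; simp⟩
      simp only [exists_comm (α := ℕ)]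
      match i with
      | 0 =>
        obtain ⟨x, hx⟩ := hΨT _ u v rfl h0 z hz
        exact ⟨x, 1, by rw [pow_one]; exact hx⟩
      | 1 =>
        obtain ⟨x, hx⟩ := hΨN _ u v rfl h0 z hz
        exact ⟨x, 1, by rw [pow_one]; exact hx⟩)
  obtain ⟨x, hx⟩ := (hexact 0 (by omega) fun i => g (Pi.single i 1)).mp ((hT0 g).mpr hg)
  exact ⟨x, hvec _ _ fun i => (hΨ x i).symm.trans (congrFun hx i)⟩

/-- The dual of a presentation of rank two is resolved by the form of the multiplier. -/
theorem exact_wedgeDual_dualMap {A : Type u} [CommRing A] [IsDomain A] {ι : ℕ → Type}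
    [∀ t, Fintype (ι t)] [∀ t, DecidableEq (ι t)] {α : ∀ t, Matrix (ι t) (ι (t + 1)) A}
    (hex : ∀ t, Function.Exact (α (t + 1)).mulVecLin (α t).mulVecLin) {n : ℕ}
    (hempty : ∀ t, n < t → IsEmpty (ι t))
    (hgrade : ∀ t, t < n → ((t + 1 + 2 : ℕ) : ℕ∞) ≤ grade (rankIdeal (α t)))
    (hcard : detRank (α 0) + 2 = Fintype.card (ι 0))
    (η : (⋀[A]^(Fintype.card (ι 0)) (ι 0 → A)) ≃ₗ[A] A) {a : ExteriorAlgebra A (ι 0 → A)}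
    (ha : a ∈ ⋀[A]^(detRank (α 0)) (ι 0 → A)) (hdiv : DividesColumns (α 0) (detRank (α 0)) a) :
    Function.Exact (wedgeDual (orientFun η) a 1) (α 0).mulVecLin.dualMap := by
  have hform : ∀ x : ι 0 → A, wedgeDual (orientFun η) a 1 (exteriorPower.ιMulti A 1 fun _ => x) =
      wedgeForm (orientFun η) a x := by
    intro x
    ext i
    simp [wedgeDual, wedgeForm]
  intro g
  constructor
  · intro hg
    obtain ⟨x, hx⟩ := exists_wedgeForm_eq hex hempty hgrade hcard η ha hdiv (g := g)
      fun y => LinearMap.congr_fun hg y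
    exact ⟨_, (hform x).trans hx⟩
  · rintro ⟨x, rfl⟩
    have hx : x ∈ Submodule.span A (Set.range (exteriorPower.ιMulti A 1 (M := ι 0 → A))) := by
      rw [exteriorPower.ιMulti_span]; trivial
    induction hx using Submodule.span_induction with
    | mem x hx =>
      obtain ⟨V, rfl⟩ := hx
      have hV : V = fun _ => V 0 := funext fun i => by rw [Subsingleton.elim i 0]
      rw [hV, hform]
      exact LinearMap.ext fun y => wedgeForm_mulVec_right hcard rfl ha hdiv rfl _ y
    | zero => simp
    | add x y _ _ hx hy => rw [map_add, map_add, hx, hy, add_zero]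
    | smul c x _ hx => rw [map_smul, map_smul, hx, smul_zero]

end ReesDual

end

/-! ### The theorem -/

open MvPolynomial ReesDual in
theorem theorem4 {K : Type*} [Field K] (n d : ℕ)
    -- the homogeneous generators of the ideal `I`
    (f : Fin (n + 1) → MvPolynomial (Fin n) K)
    (hf : ∀ i, (f i).IsHomogeneous d)
    (I : Ideal (MvPolynomial (Fin n) K)) (hI : I = Ideal.span (Set.range f))
    -- `I` is perfect of codimension two
    (hheight : I.height = 2) (hperf : IsPerfect I)
    -- the graded presentation matrix and its column degrees
    (φ : Matrix (Fin (n + 1)) (Fin n) (MvPolynomial (Fin n) K)) (e : Fin n → ℕ)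
    (he : ∀ j, 0 < e j) (hmono : Monotone e)
    (hφ : ∀ i j, (φ i j).IsHomogeneous (e j))
    (hpres : Function.Exact (Matrix.mulVecLin φ)
      (Fintype.linearCombination (MvPolynomial (Fin n) K) f))
    -- the local bound on numbers of generators on the punctured spectrum
    (hG : ∀ (p : Ideal (MvPolynomial (Fin n) K)) [p.IsPrime], I ≤ p →
      p ≠ Ideal.span (Set.range X) →
      ((((I.map (algebraMap (MvPolynomial (Fin n) K)
        (Localization.AtPrime p))).spanFinrank : ℕ) : ℕ∞) : WithBot ℕ∞) ≤
          ringKrullDim (Localization.AtPrime p))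
    -- `0 ≤ i ≤ δ` and `k = δ - i`
    (i k : ℕ) (hi : i ≤ (∑ j, e j) - n) (hk : k = ((∑ j, e j) - n) - i)
    (hrank : Module.rank (MvPolynomial (Fin (n + 1)) K) (SymPart f k) = 2)
    -- the differentials `α t : F_(t+1) → F_t`
    (α : ∀ t, Matrix (KoszulIndex e k t) (KoszulIndex e k (t + 1)) (MvPolynomial (Fin (n + 1)) K))
    (hα : ∀ t, α t = koszulMatrix (symEquation φ) e k t)
    -- orientations of the modules `F_t`
    (η : ∀ t, (⋀[MvPolynomial (Fin (n + 1)) K]^(Fintype.card (KoszulIndex e k t))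
      (KoszulIndex e k t → MvPolynomial (Fin (n + 1)) K)) ≃ₗ[MvPolynomial (Fin (n + 1)) K]
        MvPolynomial (Fin (n + 1)) K) :
    -- the multipliers exist and are unique
    (∃! a, IsMultiplierFamily n α η a) ∧
    -- (a) implies (b)
    (SerreCondition (MvPolynomial (Fin (n + 1)) K) (SymPart f k) 2 →
      ∀ t, t < n → ((t + 1 + 2 : ℕ) : ℕ∞) ≤ grade (rankIdeal (α t))) ∧
    ∀ a, IsMultiplierFamily n α η a →
      -- the map given by `a_1` is graded, with shift `s_1`
      (∃ s : ℕ, (s : ℤ) = ∑ t ∈ Finset.range n, (-1) ^ t * (detRank (α t) : ℤ) ∧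
        ∀ (u : Fin (Fintype.card (KoszulIndex e k 0) - detRank (α 0) - 1) → KoszulIndex e k 0)
          (v : KoszulIndex e k 0),
          (wedgeDual (orientFun (η 0)) (a 0)
            (Fintype.card (KoszulIndex e k 0) - detRank (α 0) - 1)
            (exteriorPower.ιMulti _ _ (fun w => Pi.single (u w) 1))
            (Pi.single v 1)).IsHomogeneous s) ∧
      -- (b) implies (c)
      ((∀ t, t < n → ((t + 1 + 2 : ℕ) : ℕ∞) ≤ grade (rankIdeal (α t))) →
        Function.Exact
          (wedgeDual (orientFun (η 0)) (a 0)
            (Fintype.card (KoszulIndex e k 0) - detRank (α 0) - 1))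
          (Matrix.mulVecLin (α 0)).dualMap) := by
  subst hI
  obtain ⟨rs, hlen, hrs, hmem⟩ := exists_isWeaklyRegular_symEquation hpres hG
  have hex : ∀ t, Function.Exact (α (t + 1)).mulVecLin (α t).mulVecLin := by
    intro t
    rw [hα, hα]
    exact exact_koszulMatrix _ k (isHomogeneous_symEquation hφ) hlen hrs hmem t
  have hempty : ∀ t, n < t → IsEmpty (KoszulIndex e k t) := fun t ht => isEmpty_koszulIndex e k ht
  have hone : ∀ t i j, (α t i j).IsHomogeneous 1 := by
    intro t i j
    rw [hα]
    exact isHomogeneous_koszulMatrix_symEquation φ e k t i j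
  have hgrade : ∀ t, ((t + 1 : ℕ) : ℕ∞) ≤ grade (rankIdeal (α t)) :=
    le_grade_rankIdeal hex hempty 0 fun P _ rs _ _ => by
      rw [Nat.zero_min]
      exact fun i hi => absurd hi (Nat.not_lt_zero i)
  obtain ⟨equiv⟩ : Nonempty (((KoszulIndex e k 0 → MvPolynomial (Fin (n + 1)) K) ⧸
      LinearMap.range (α 0).mulVecLin) ≃ₗ[MvPolynomial (Fin (n + 1)) K] SymPart f k) := by
    have := nonempty_cokernel_equiv_degreePart (isHomogeneous_symEquation hφ) k
    rwa [← ker_toSym hpres, ← hα] at this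
  -- Rank two of `M` says `f_0 - r_1 = 2`, so the source of `ψ` is the first exterior power.
  have hcard : detRank (α 0) + 2 = Fintype.card (KoszulIndex e k 0) := by
    rw [← detRank_add_finrank_quotient_range (α 0), equiv.finrank_eq,
      Module.finrank_eq_of_rank_eq (n := 2) (by exact_mod_cast hrank)]
  have hq : Fintype.card (KoszulIndex e k 0) - detRank (α 0) - 1 = 1 := by omega
  obtain ⟨a, ha⟩ := exists_isMultiplierFamily (η := η) hempty hex hgrade
  refine ⟨⟨a, ha, fun a' ha' => isMultiplierFamily_unique hempty hex ha' ha⟩, ?_, ?_⟩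
  · intro hS t _
    have hπ : Function.Surjective (equiv.toLinearMap ∘ₗ (LinearMap.range (α 0).mulVecLin).mkQ) :=
      equiv.surjective.comp (Submodule.mkQ_surjective _)
    have hπex : Function.Exact (α 0).mulVecLin
        (equiv.toLinearMap ∘ₗ (LinearMap.range (α 0).mulVecLin).mkQ) := by
      intro x
      simp
    -- If every element were torsion, the rank of `M` would be zero.
    obtain ⟨m, hm⟩ : ∃ m : SymPart f k, ∀ a : MvPolynomial (Fin (n + 1)) K, a • m = 0 → a = 0 := by
      by_contra! h
      have h1 := rank_eq_zero_iff.mpr fun m : SymPart f k => (h m).imp fun _ h => ⟨h.2, h.1⟩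
      rw [hrank] at h1
      exact two_ne_zero h1
    exact le_grade_rankIdeal hex hempty 2
      (fun P _ rs hmem hrs => extVanish_of_serreCondition hπ hπex hm hS P rs hmem hrs) t
  · intro a ha
    constructor
    · obtain ⟨s, hs, hhom⟩ := ha.exists_isHomogeneous hex hempty hone n 0 (zero_add n)
      refine ⟨s, hs.trans (Finset.sum_congr rfl fun t _ => by rw [zero_add]), fun u v => ?_⟩
      have := hhom _ 1 u (fun _ => v) (by omega)
      simpa [wedgeDual] using this
    · intro hb
      rw [hq]
      exact exact_wedgeDual_dualMap hex hempty hb hcard (η 0) (ha.mem 0)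
        (ha.dividesColumns hempty 0)
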